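/- Strings $A,B\in\Sigma^n$ are compared by the edit distance $\mathrm{ED}(A,B)$, the least number of insertions, deletions and substitutions of single characters that turn $A$ into $B$. The machine is a word RAM with words of $\Theta(\log n+\log|\Sigma|)$ bits, unit-cost word operations and random access to memory and to the input strings. An algorithm with one-sided preprocessing consists of two fixed programs, both of which are given $n,k,\ell,|\Sigma|$: a randomized preprocessing program, which can draw uniformly random words and has access to $A$ but not to $B$, and a deterministic query program, which has access to $A$, to $B$ and to the memory contents left by the preprocessing. Theorem. For every constant $a\in\mathbb N$ there are a constant $b\in\mathbb N$ and an algorithm with one-sided preprocessing such that the following holds for all integers $1\le\ell\le k\le n$, every finite alphabet $\Sigma$ and every $A\in\Sigma^n$, where $L:=\lfloor\log_2 n\rfloor+1$. 1. The expected running time of the preprocessing of $A$ is at most $b\,L^{b}\cdot\frac{nk}{\ell}$, i.e. $\tilde O(nk/\ell)$. 2. For every $B\in\Sigma^n$ and every outcome of the preprocessing, the query halts after at most $b\,L^{b}\cdot\frac{n+k^2}{\ell}$ steps, i.e. in $\tilde O\big(\frac{n+k^2}{\ell}\big)$ time. 3. For every $B\in\Sigma^n$ (fixed independently of the random bits), with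 probability at least $1-\frac1n$ over the random bits used in the preprocessing, the query answers SMALL if $\mathrm{ED}(A,B)\le a\,L^{a}\cdot k$, and LARGE if $\mathrm{ED}(A,B)\ge b\,L^{b}\cdot k\ell$. That is, it distinguishes $\mathrm{ED}(A,B)\le\tilde O(k)$ from $\mathrm{ED}(A,B)\ge\tilde\Omega(k\ell)$. The constants and the programs depend on $a$ only; they do not depend on $n,k,\ell,\Sigma,A,B$. -/

import Mathlib

/-!
A randomized word RAM, presented as a structured programming language with an explicit step count.
A program is a finite piece of syntax; it has registers and a random-access memory of `w`-bit words,
random access to two input strings, and an instruction that draws a uniformly random word.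
-/

namespace WordRAM

/-- Word operations; arithmetic is modulo the number `M` of words, comparisons give `0` or `1`. -/
inductive Op
  | add | sub | mul | div | mod | lt | eq

/-- The result of a word operation, for words `x, y < M`. Division by `0` gives `0`. -/
def Op.eval (M : ℕ) : Op → ℕ → ℕ → ℕ
  | .add, x, y => (x + y) % M
  | .sub, x, y => (x + M - y) % M
  | .mul, x, y => (x * y) % M
  | .div, x, y => x / y
  | .mod, x, y => x % y
  | .lt, x, y => if x < y then 1 else 0
  | .eq, x, y => if x = y then 1 else 0

/-- Expressions: constants, registers, word operations, the memory word at a computed address, and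
the character at a computed position of the first or of the second input string. -/
inductive Expr
  | const (c : ℕ)
  | reg (r : ℕ)
  | op (o : Op) (e₁ e₂ : Expr)
  | load (e : Expr)
  | readA (e : Expr)
  | readB (e : Expr)

/-- Programs. `random r` puts a fresh random word into register `r`. -/
inductive Prog
  | skip
  | assign (r : ℕ) (e : Expr)
  | store (addr val : Expr)
  | random (r : ℕ)
  | seq (p q : Prog)
  | ite (e : Expr) (p q : Prog)
  | loop (e : Expr) (p : Prog)

/-- The program contains no `random` instruction, i.e. it is deterministic. -/
def Prog.RandomFree : Prog → Prop
  | .skip => True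
  | .assign _ _ => True
  | .store _ _ => True
  | .random _ => False
  | .seq p q => p.RandomFree ∧ q.RandomFree
  | .ite _ p q => p.RandomFree ∧ q.RandomFree
  | .loop _ p => p.RandomFree

/-- What is fixed during a run: the number `M` of words, the two input strings (as functions of the
position), and the sequence of random words. -/
structure Env where
  M : ℕ
  strA : ℕ → ℕ
  strB : ℕ → ℕ
  tape : ℕ → ℕ

/-- What changes during a run: registers, memory, and the number of random words already used. -/
structure State where
  reg : ℕ → ℕ
  mem : ℕ → ℕ
  used : ℕ

/-- The value of an expression. -/
def Expr.eval (E : Env) (s : State) : Expr → ℕ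
  | .const c => c % E.M
  | .reg r => s.reg r
  | .op o e₁ e₂ => o.eval E.M (e₁.eval E s) (e₂.eval E s)
  | .load e => s.mem (e.eval E s)
  | .readA e => E.strA (e.eval E s)
  | .readB e => E.strB (e.eval E s)

/-- The number of steps for evaluating an expression: one for each node. -/
def Expr.cost : Expr → ℕ
  | .const _ => 1
  | .reg _ => 1
  | .op _ e₁ e₂ => e₁.cost + e₂.cost + 1
  | .load e => e.cost + 1
  | .readA e => e.cost + 1
  | .readB e => e.cost + 1

/-- `Exec E p s s' t`: started in state `s`, the program `p` halts in state `s'` after `t` steps. -/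
inductive Exec (E : Env) : Prog → State → State → ℕ → Prop
  | skip (s : State) : Exec E .skip s s 1
  | assign (s : State) (r : ℕ) (e : Expr) :
      Exec E (.assign r e) s { s with reg := Function.update s.reg r (e.eval E s) } (e.cost + 1)
  | store (s : State) (addr val : Expr) :
      Exec E (.store addr val) s
        { s with mem := Function.update s.mem (addr.eval E s) (val.eval E s) }
        (addr.cost + val.cost + 1)
  | random (s : State) (r : ℕ) :
      Exec E (.random r) s
        { s with reg := Function.update s.reg r (E.tape s.used), used := s.used + 1 } 1
  | seq {p q : Prog} {s s' s'' : State} {t t' : ℕ} :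
      Exec E p s s' t → Exec E q s' s'' t' → Exec E (.seq p q) s s'' (t + t')
  | ite_true {e : Expr} {p q : Prog} {s s' : State} {t : ℕ} :
      e.eval E s ≠ 0 → Exec E p s s' t → Exec E (.ite e p q) s s' (e.cost + 1 + t)
  | ite_false {e : Expr} {p q : Prog} {s s' : State} {t : ℕ} :
      e.eval E s = 0 → Exec E q s s' t → Exec E (.ite e p q) s s' (e.cost + 1 + t)
  | loop_true {e : Expr} {p : Prog} {s s' s'' : State} {t t' : ℕ} :
      e.eval E s ≠ 0 → Exec E p s s' t → Exec E (.loop e p) s' s'' t' →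
        Exec E (.loop e p) s s'' (e.cost + 1 + t + t')
  | loop_false {e : Expr} {p : Prog} {s : State} :
      e.eval E s = 0 → Exec E (.loop e p) s s (e.cost + 1)

/-- The final state and the number of steps are determined by the initial state. -/
theorem Exec.unique {E : Env} {p : Prog} {s s₁ s₂ : State} {t₁ t₂ : ℕ}
    (h₁ : Exec E p s s₁ t₁) (h₂ : Exec E p s s₂ t₂) : s₁ = s₂ ∧ t₁ = t₂ := by
  induction h₁ generalizing s₂ t₂ with
  | skip | assign | store | random => cases h₂; exact ⟨rfl, rfl⟩
  | seq _ _ ih ih' =>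
    cases h₂ with
    | seq a b =>
      obtain ⟨rfl, rfl⟩ := ih a
      obtain ⟨rfl, rfl⟩ := ih' b
      exact ⟨rfl, rfl⟩
  | ite_true h _ ih =>
    cases h₂ with
    | ite_true _ a => obtain ⟨rfl, rfl⟩ := ih a; exact ⟨rfl, rfl⟩
    | ite_false g _ => exact absurd g h
  | ite_false h _ ih =>
    cases h₂ with
    | ite_true g _ => exact absurd h g
    | ite_false _ a => obtain ⟨rfl, rfl⟩ := ih a; exact ⟨rfl, rfl⟩
  | loop_true h _ _ ih ih' =>
    cases h₂ with
    | loop_true _ a b =>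
      obtain ⟨rfl, rfl⟩ := ih a
      obtain ⟨rfl, rfl⟩ := ih' b
      exact ⟨rfl, rfl⟩
    | loop_false g => exact absurd g h
  | loop_false h =>
    cases h₂ with
    | loop_true g _ _ => exact absurd h g
    | loop_false _ => exact ⟨rfl, rfl⟩

/-- The running time of a program; it is `∞` if the program does not halt. -/
noncomputable def runningTime (E : Env) (p : Prog) (s : State) : ENNReal :=
  ⨅ (t : ℕ) (_ : ∃ s', Exec E p s s' t), (t : ENNReal)

end WordRAM

open WordRAM

/-- One edit: the insertion, the deletion or the substitution of a single character. -/
inductive EditStep {α : Type*} : List α → List α → Prop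
  | insert (u v : List α) (x : α) : EditStep (u ++ v) (u ++ x :: v)
  | delete (u v : List α) (x : α) : EditStep (u ++ x :: v) (u ++ v)
  | subst (u v : List α) (x y : α) : EditStep (u ++ x :: v) (u ++ y :: v)

/-- `EditSeq xs ys d`: there is a sequence of `d` edits that turns `xs` into `ys`. -/
inductive EditSeq {α : Type*} : List α → List α → ℕ → Prop
  | refl (xs : List α) : EditSeq xs xs 0
  | step {xs ys zs : List α} {d : ℕ} : EditSeq xs ys d → EditStep ys zs → EditSeq xs zs (d + 1)

/-- The edit distance: the least number of edits that turn `A` into `B`. -/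
noncomputable def editDist {n σ : ℕ} (A B : Fin n → Fin σ) : ℕ :=
  sInf {d | EditSeq (List.ofFn A) (List.ofFn B) d}

/-- The character at position `i` (counted from `0`), as a number below `σ`;
beyond the end of the string it is the extra symbol `σ`. -/
def charAt {n σ : ℕ} (A : Fin n → Fin σ) (i : ℕ) : ℕ :=
  if h : i < n then (A ⟨i, h⟩ : ℕ) else σ

/-- The number of bits of a word: `c` times `log n + log σ`, up to rounding. -/
def wordBits (c n σ : ℕ) : ℕ := c * (Nat.log 2 n + Nat.log 2 σ + 1)

/-- The distribution of a sequence of independent uniformly random `w`-bit words. -/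
noncomputable def tapeMeasure (w : ℕ) : MeasureTheory.Measure (ℕ → Fin (2 ^ w)) :=
  MeasureTheory.Measure.infinitePi fun _ => (PMF.uniformOfFintype (Fin (2 ^ w))).toMeasure

/-- At the start of each phase the registers `0, 1, 2, 3` hold `n, k, ℓ, σ`, and the others `0`. -/
def inputRegs (n k ℓ σ : ℕ) : ℕ → ℕ
  | 0 => n
  | 1 => k
  | 2 => ℓ
  | 3 => σ
  | _ => 0

/-- Preprocessing: the first string is `A`, and there is no second string (it is empty). -/
def preEnv {n σ : ℕ} (w : ℕ) (A : Fin n → Fin σ) (ω : ℕ → Fin (2 ^ w)) : Env where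
  M := 2 ^ w
  strA := charAt A
  strB := fun _ => σ
  tape := fun i => ω i

/-- Preprocessing starts with an empty memory. -/
def preInit (n k ℓ σ : ℕ) : State where
  reg := inputRegs n k ℓ σ
  mem := fun _ => 0
  used := 0

/-- Query: random access to both strings, and no random words. -/
def queryEnv {n σ : ℕ} (w : ℕ) (A B : Fin n → Fin σ) : Env where
  M := 2 ^ w
  strA := charAt A
  strB := charAt B
  tape := fun _ => 0

/-- A query starts with the memory that preprocessing has left. -/
def queryInit (n k ℓ σ : ℕ) (s : State) : State where
  reg := inputRegs n k ℓ σ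
  mem := s.mem
  used := 0

/-- The answer of a query is in register `0`: `1` stands for small and `0` for large. -/
def CorrectAnswer (d : ℕ) (small large : ℝ) (s : State) : Prop :=
  ((d : ℝ) ≤ small → s.reg 0 = 1) ∧ (large ≤ (d : ℝ) → s.reg 0 = 0)

/-- The polylogarithmic factor `b (log n + 1) ^ b`, with the logarithm to base `2` rounded down. -/
def polylog (b n : ℕ) : ℕ := b * (Nat.log 2 n + 1) ^ b

/-!
Cut the strings into leaf blocks of length `l = 2 ^ ⌊log₂ ℓ⌋` and compare them only at one random
position of each leaf block. Let `K = a L ^ a k`. Preprocessing samples these positions and, for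
each of the `2 K + 1` relevant shifts of `A`, names the blocks of `2 ^ i` consecutive leaf blocks by
their sampled characters, in the manner of Karp, Miller and Rosenberg: the name of a block is
determined by the names of its halves, and it is found in a dictionary. The shifts are grouped into
classes of `l` consecutive ones, and a flag records which names occur in which class.

The query names the blocks of `B` with the same dictionaries. Then it computes, as Landau and
Vishkin do, the furthest position that can be reached in each class after `e` rounds, where a round
jumps over the longest matching block or moves to a neighbouring class. It answers SMALL if the end
of `B` is reached within `E = (⌊log₂ n⌋ + 3) (K + 1)` rounds.

If the distance is at most `K`, then the leaf blocks without an edit form at most `K + 1` runs, each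
on one diagonal. Each jump at least halves the distance to the end of the run, and moves between
classes are paid for by the edits, so the end is reached. Conversely, for a run of leaf blocks on a
diagonal with more than `H l` mismatches, all samples miss these mismatches with probability at most
`2 ^ (-H)`. By a union bound over runs and diagonals, some `H = O(L)` ensures that, with probability
at least `1 - 1 / n`, each jump costs at most `(H + 2) l` edits, and then reaching the end implies a
distance of at most `2 K + 3 l + E (H + 2) l`, which is `Õ(k ℓ)`.
-/

namespace WordRAM

/-! ### Running times and postconditions of structured programs -/

variable {E : Env} {s : State} {p q : Prog} {e : Expr}

/-- The size of a program: at least the number of steps that one pass through its text takes, where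
the test of a loop is counted twice to pay for the last, failing test. -/
def Prog.size : Prog → ℕ
  | .skip => 1
  | .assign _ e => e.cost + 1
  | .store addr val => addr.cost + val.cost + 1
  | .random _ => 1
  | .seq p q => p.size + q.size
  | .ite e p q => e.cost + 1 + p.size + q.size
  | .loop e p => 2 * (e.cost + 1) + p.size

/-- The registers that a program may assign. -/
def Prog.writes : Prog → List ℕ
  | .skip => []
  | .assign r _ => [r]
  | .store _ _ => []
  | .random r => [r]
  | .seq p q => p.writes ++ q.writes
  | .ite _ p q => p.writes ++ q.writes
  | .loop _ p => p.writes

/-- The program contains no loop. -/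
def Prog.isLoopFree : Prog → Bool
  | .skip => true
  | .assign _ _ => true
  | .store _ _ => true
  | .random _ => true
  | .seq p q => p.isLoopFree && q.isLoopFree
  | .ite _ p q => p.isLoopFree && q.isLoopFree
  | .loop _ _ => false

namespace State

variable {r r' v addr : ℕ} {W W' : List ℕ} {s₁ s₂ s₃ : State}

/-- The state after the word `v` has been put into register `r`. -/
def setReg (s : State) (r v : ℕ) : State :=
  { s with reg := Function.update s.reg r v }

/-- The state after the word `v` has been stored at the address `addr`. -/
def setMem (s : State) (addr v : ℕ) : State :=
  { s with mem := Function.update s.mem addr v }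

@[simp] theorem reg_setReg : (s.setReg r v).reg r' = if r' = r then v else s.reg r' :=
  Function.update_apply _ _ _ _

@[simp] theorem reg_setMem : (s.setMem addr v).reg = s.reg := rfl

/-- The two states have the same registers, except possibly those in the list `W`. -/
def AgreeOff (W : List ℕ) (s s' : State) : Prop :=
  ∀ r ∉ W, s'.reg r = s.reg r

theorem AgreeOff.trans (h : AgreeOff W s₁ s₂) (h' : AgreeOff W s₂ s₃) : AgreeOff W s₁ s₃ :=
  fun r hr => (h' r hr).trans (h r hr)

theorem AgreeOff.mono (h : AgreeOff W s₁ s₂) (hW : W ⊆ W') : AgreeOff W' s₁ s₂ :=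
  fun r hr => h r fun hr' => hr (hW hr')

theorem AgreeOff.setReg (h : AgreeOff W s₁ s₂) (hr : r ∈ W) : AgreeOff W s₁ (s₂.setReg r v) :=
  fun r' hr' => by rw [reg_setReg, if_neg (ne_of_mem_of_not_mem hr hr').symm, h r' hr']

end State

/-- The state in which a loop-free program halts; loops are skipped. -/
def Prog.apply (E : Env) : Prog → State → State
  | .skip, s => s
  | .assign r e, s => s.setReg r (e.eval E s)
  | .store addr val, s => s.setMem (addr.eval E s) (val.eval E s)
  | .random r, s => { s.setReg r (E.tape s.used) with used := s.used + 1 }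
  | .seq p q, s => q.apply E (p.apply E s)
  | .ite e p q, s => if e.eval E s = 0 then q.apply E s else p.apply E s
  | .loop _ _, s => s

theorem Exec.reg_of_notMem_writes {s' : State} {t r : ℕ} (h : Exec E p s s' t)
    (hr : r ∉ p.writes) : s'.reg r = s.reg r := by
  induction h with
  | skip | store | loop_false => rfl
  | assign | random =>
    exact Function.update_of_ne (fun h => hr (List.mem_singleton.2 h)) _ _
  | seq _ _ ih ih' =>
    simp only [Prog.writes, List.mem_append, not_or] at hr
    exact (ih' hr.2).trans (ih hr.1)
  | ite_true _ _ ih =>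
    exact ih fun h => hr (List.mem_append_left _ h)
  | ite_false _ _ ih =>
    exact ih fun h => hr (List.mem_append_right _ h)
  | loop_true _ _ _ ih ih' => exact (ih' hr).trans (ih hr)

/-- Started in state `s`, the program halts in a state that satisfies `Q`, and its running time is
that of executing every instruction `x` times. -/
def Runs (E : Env) (p : Prog) (s : State) (x : ℕ) (Q : State → Prop) : Prop :=
  ∃ s' t, Exec E p s s' t ∧ t ≤ p.size * x ∧ Q s'

namespace Runs

variable {x y : ℕ} {Q R : State → Prop}

theorem mono (h : Runs E p s x Q) (hxy : x ≤ y) (hQR : ∀ s', Q s' → R s') : Runs E p s y R := by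
  obtain ⟨s', t, hst, ht, hQ⟩ := h
  exact ⟨s', t, hst, ht.trans (Nat.mul_le_mul_left _ hxy), hQR s' hQ⟩

theorem imp (h : Runs E p s x Q) (hQR : ∀ s', Q s' → R s') : Runs E p s x R :=
  h.mono le_rfl hQR

theorem le (h : Runs E p s x Q) (hxy : x ≤ y) : Runs E p s y Q :=
  h.mono hxy fun _ => id

theorem frame (h : Runs E p s x Q) :
    Runs E p s x fun s' => Q s' ∧ State.AgreeOff p.writes s s' := by
  obtain ⟨s', t, hst, ht, hQ⟩ := h
  exact ⟨s', t, hst, ht, hQ, fun r hr => hst.reg_of_notMem_writes hr⟩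

theorem runningTime_le (h : Runs E p s x Q) : runningTime E p s ≤ (p.size * x : ℕ) := by
  obtain ⟨s', t, hst, ht, -⟩ := h
  exact (iInf₂_le t ⟨s', hst⟩).trans (by exact_mod_cast ht)

theorem seq (hp : Runs E p s x R) (hq : ∀ s', R s' → Runs E q s' x Q) :
    Runs E (.seq p q) s x Q := by
  obtain ⟨s', t, hst, ht, hR⟩ := hp
  obtain ⟨s'', t', hst', ht', hQ⟩ := hq s' hR
  exact ⟨s'', t + t', hst.seq hst', (Nat.add_le_add ht ht').trans_eq (add_mul _ _ _).symm, hQ⟩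

theorem apply (hp : p.isLoopFree) (hx : 0 < x) (h : Q (p.apply E s)) : Runs E p s x Q := by
  suffices ∀ s, ∃ t, Exec E p s (p.apply E s) t ∧ t ≤ p.size by
    obtain ⟨t, hst, ht⟩ := this s
    exact ⟨_, t, hst, ht.trans (Nat.le_mul_of_pos_right _ hx), h⟩
  intro s
  clear h
  induction p generalizing s with
  | skip => exact ⟨1, .skip s, le_rfl⟩
  | assign r e => exact ⟨_, .assign s r e, le_rfl⟩
  | store addr val => exact ⟨_, .store s addr val, le_rfl⟩
  | random r => exact ⟨1, .random s r, le_rfl⟩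
  | seq p q ihp ihq =>
    obtain ⟨hp, hq⟩ := Bool.and_eq_true_iff.1 hp
    obtain ⟨t, hst, ht⟩ := ihp hp s
    obtain ⟨t', hst', ht'⟩ := ihq hq (p.apply E s)
    exact ⟨t + t', hst.seq hst', Nat.add_le_add ht ht'⟩
  | ite e p q ihp ihq =>
    obtain ⟨hp, hq⟩ := Bool.and_eq_true_iff.1 hp
    by_cases he : e.eval E s = 0
    · obtain ⟨t, hst, ht⟩ := ihq hq s
      refine ⟨e.cost + 1 + t, ?_, by simp only [Prog.size]; omega⟩
      simpa only [Prog.apply, he, if_true] using Exec.ite_false he hst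
    · obtain ⟨t, hst, ht⟩ := ihp hp s
      refine ⟨e.cost + 1 + t, ?_, by simp only [Prog.size]; omega⟩
      simpa only [Prog.apply, he, if_false] using Exec.ite_true he hst
  | loop => exact absurd hp Bool.false_ne_true

theorem loop {I : ℕ → State → Prop} {m : ℕ} (hx : 0 < x) (hm : m ≤ y) (hy : 0 < y) (h0 : I 0 s)
    (hstep : ∀ i s', i < m → I i s' → e.eval E s' ≠ 0 ∧ Runs E p s' x (I (i + 1)))
    (hend : ∀ s', I m s' → e.eval E s' = 0) : Runs E (.loop e p) s (y * x) (I m) := by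
  suffices ∀ d i s, i + d = m → I i s → ∃ s' t, Exec E (.loop e p) s s' t ∧
      t ≤ d * (e.cost + 1 + p.size * x) + (e.cost + 1) ∧ I m s' by
    obtain ⟨s', t, hst, ht, hI⟩ := this m 0 s (Nat.zero_add m) h0
    refine ⟨s', t, hst, ht.trans ?_, hI⟩
    calc m * (e.cost + 1 + p.size * x) + (e.cost + 1)
        ≤ y * ((e.cost + 1) * x + p.size * x) + (e.cost + 1) * (y * x) := by
          gcongr
          · exact Nat.le_mul_of_pos_right _ hx
          · exact Nat.le_mul_of_pos_right _ (Nat.mul_pos hy hx)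
      _ = (Prog.loop e p).size * (y * x) := by simp only [Prog.size]; ring
  intro d
  induction d with
  | zero =>
    rintro i s rfl hI
    exact ⟨s, _, .loop_false (hend s hI), by omega, hI⟩
  | succ d ih =>
    intro i s hid hI
    obtain ⟨he, s', t, hst, ht, hI'⟩ := hstep i s (by omega) hI
    obtain ⟨s'', t', hst', ht', hI''⟩ := ih (i + 1) s' (by omega) hI'
    refine ⟨s'', _, .loop_true he hst hst', ?_, hI''⟩
    rw [Nat.succ_mul]
    omega

end Runs

/-! ### Expressions -/

namespace Expr

instance : Add Expr := ⟨.op .add⟩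
instance : Sub Expr := ⟨.op .sub⟩
instance : Mul Expr := ⟨.op .mul⟩
instance : Div Expr := ⟨.op .div⟩
instance : Mod Expr := ⟨.op .mod⟩
instance (c : ℕ) : OfNat Expr c := ⟨.const c⟩

/-- The expression for the comparison `e < f`. -/
def less (e f : Expr) : Expr := .op .lt e f

/-- The expression for the `m`-th power of `e`. -/
def pow (e : Expr) : ℕ → Expr
  | 0 => 1
  | m + 1 => e.pow m * e

section eval

variable {f : Expr} {c r : ℕ}

@[simp] theorem eval_const : (const c).eval E s = c % E.M := rfl
@[simp] theorem eval_ofNat : (no_index (OfNat.ofNat c) : Expr).eval E s = OfNat.ofNat c % E.M := rfl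
@[simp] theorem eval_reg : (reg r).eval E s = s.reg r := rfl
@[simp] theorem eval_load : (load e).eval E s = s.mem (e.eval E s) := rfl
@[simp] theorem eval_readA : (readA e).eval E s = E.strA (e.eval E s) := rfl
@[simp] theorem eval_readB : (readB e).eval E s = E.strB (e.eval E s) := rfl
@[simp] theorem eval_add : (e + f).eval E s = (e.eval E s + f.eval E s) % E.M := rfl
@[simp] theorem eval_sub : (e - f).eval E s = (e.eval E s + E.M - f.eval E s) % E.M := rfl
@[simp] theorem eval_mul : (e * f).eval E s = e.eval E s * f.eval E s % E.M := rfl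
@[simp] theorem eval_div : (e / f).eval E s = e.eval E s / f.eval E s := rfl
@[simp] theorem eval_mod : (e % f).eval E s = e.eval E s % f.eval E s := rfl

@[simp] theorem eval_less_eq_zero : (e.less f).eval E s = 0 ↔ f.eval E s ≤ e.eval E s := by
  simp [less, Expr.eval, Op.eval]

theorem eval_sub_of_le (h : f.eval E s ≤ e.eval E s) (he : e.eval E s < E.M) :
    (e - f).eval E s = e.eval E s - f.eval E s := by
  rw [eval_sub, Nat.sub_add_comm h, Nat.add_mod_right, Nat.mod_eq_of_lt (by omega)]

theorem eval_pow_of_lt {x m : ℕ} (he : e.eval E s = x) (hx : 0 < x) (h : x ^ m < E.M) :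
    (e.pow m).eval E s = x ^ m := by
  induction m with
  | zero => exact Nat.mod_eq_of_lt h
  | succ m ih =>
    have hle : x ^ m ≤ x ^ (m + 1) := Nat.pow_le_pow_right hx (Nat.le_succ m)
    rw [pow, eval_mul, ih (hle.trans_lt h), he, ← pow_succ, Nat.mod_eq_of_lt h]

end eval

end Expr

/-! ### Counting loops -/

/-- `for r in [lo, hi) do p` -/
def Prog.forRange (r : ℕ) (lo hi : Expr) (p : Prog) : Prog :=
  .seq (.assign r lo) (.loop ((Expr.reg r).less hi) (.seq p (.assign r (.reg r + 1))))

/-- `for r in [1, 2, 4, ...] while lo + 2 * r ≤ hi do p` -/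
def Prog.doubling (r : ℕ) (lo hi : Expr) (p : Prog) : Prog :=
  .seq (.assign r 1) (.loop ((lo + .reg r * 2).less (hi + 1)) (.seq p (.assign r (.reg r * 2))))

namespace Runs

variable {x y : ℕ} {r : ℕ} {lower upper : Expr} {I : ℕ → State → Prop}

theorem assign {Q : State → Prop} (hx : 0 < x) (h : Q (s.setReg r (e.eval E s))) :
    Runs E (.assign r e) s x Q :=
  Runs.apply (p := .assign r e) rfl hx h

theorem assign_seq {v : ℕ} {Q : State → Prop} (hx : 0 < x) (he : e.eval E s = v)
    (h : Runs E p (s.setReg r v) x Q) : Runs E (.seq (.assign r e) p) s x Q :=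
  (assign hx (Q := fun s' => s' = s.setReg r v) (congrArg _ he)).seq fun _ hs' => hs' ▸ h

theorem forRange {v m : ℕ} (hx : 0 < x) (hm : m - v ≤ y) (hy : 0 < y)
    (hr : r ∉ p.writes) (hlo : lower.eval E s = v) (hvm : v ≤ m) (hM : m < E.M)
    (hhi : ∀ s', State.AgreeOff (r :: p.writes) s s' → upper.eval E s' = m)
    (h0 : I v (s.setReg r v))
    (hstep : ∀ j s', v ≤ j → j < m → State.AgreeOff (r :: p.writes) s s' → s'.reg r = j → I j s' →
      Runs E p s' x fun s'' => I (j + 1) (s''.setReg r (j + 1))) :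
    Runs E (.forRange r lower upper p) s (y * x) (I m) := by
  have hyx : 0 < y * x := Nat.mul_pos hy hx
  refine Runs.assign_seq hyx hlo ?_
  have hinit : State.AgreeOff (r :: p.writes) s (s.setReg r v) :=
    State.AgreeOff.setReg (fun _ _ => rfl) (List.mem_cons_self ..)
  refine (Runs.loop (m := m - v)
    (I := fun i s' => I (v + i) s' ∧ s'.reg r = v + i ∧ State.AgreeOff (r :: p.writes) s s')
    hx hm hy ⟨h0, by simp, hinit⟩ ?_ ?_).imp fun s' h => ?_
  · rintro i s' hi ⟨hI, hreg, hs'⟩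
    refine ⟨by rw [Ne, Expr.eval_less_eq_zero, hhi s' hs', Expr.eval_reg]; omega, ?_⟩
    refine Runs.seq (hstep (v + i) s' (by omega) (by omega) hs' hreg hI).frame ?_
    rintro s'' ⟨hI', hf⟩
    have hval : (Expr.reg r + 1).eval E s'' = v + i + 1 := by
      rw [Expr.eval_add, Expr.eval_reg, hf r hr, hreg, Expr.eval_ofNat, Nat.add_mod_mod,
        Nat.mod_eq_of_lt (by omega)]
    refine Runs.assign hx ⟨by rw [hval]; exact hI', by simp [hval, add_assoc],
      (hs'.trans (hf.mono (List.subset_cons_self ..))).setReg (List.mem_cons_self ..)⟩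
  · rintro s' ⟨-, hreg, hs'⟩
    rw [Expr.eval_less_eq_zero, hhi s' hs', Expr.eval_reg]
    omega
  · simpa only [Nat.add_sub_cancel' hvm] using h.1

theorem lt_log_two_sub_iff {v m i : ℕ} : i < Nat.log 2 (m - v) ↔ v + 2 ^ (i + 1) ≤ m := by
  rcases le_or_gt m v with hmv | hvm
  · rw [Nat.sub_eq_zero_of_le hmv, Nat.log_zero_right]
    have := Nat.two_pow_pos (i + 1)
    omega
  · rw [← Nat.succ_le_iff, Nat.le_log_iff_pow_le one_lt_two (by omega)]
    omega

theorem doubling_test_eq_zero {v m i : ℕ} (hM : v + 2 * m + 2 < E.M)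
    (hi : i ≤ Nat.log 2 (m - v)) (hlo : lower.eval E s = v) (hhi : upper.eval E s = m)
    (hreg : s.reg r = 2 ^ i) :
    ((lower + .reg r * 2).less (upper + 1)).eval E s = 0 ↔ m < v + 2 ^ (i + 1) := by
  have hpow : v + 2 * 2 ^ i < E.M := by
    rcases i with _ | i
    · omega
    · have := lt_log_two_sub_iff.1 hi
      omega
  rw [Expr.eval_less_eq_zero]
  simp (disch := omega) only [Expr.eval_add, Expr.eval_mul, Expr.eval_reg, Expr.eval_ofNat,
    hlo, hhi, hreg, Nat.mod_eq_of_lt]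
  omega

theorem doubling {v m : ℕ} (hx : 0 < x) (hy : Nat.log 2 (m - v) ≤ y) (hy0 : 0 < y)
    (hr : r ∉ p.writes) (hM : v + 2 * m + 2 < E.M)
    (hlo : ∀ s', State.AgreeOff (r :: p.writes) s s' → lower.eval E s' = v)
    (hhi : ∀ s', State.AgreeOff (r :: p.writes) s s' → upper.eval E s' = m)
    (h0 : I 0 (s.setReg r 1))
    (hstep : ∀ i s', v + 2 ^ (i + 1) ≤ m → State.AgreeOff (r :: p.writes) s s' → s'.reg r = 2 ^ i →
      I i s' → Runs E p s' x fun s'' => I (i + 1) (s''.setReg r (2 ^ (i + 1)))) :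
    Runs E (.doubling r lower upper p) s (y * x) fun s' =>
      I (Nat.log 2 (m - v)) s' ∧ s'.reg r = 2 ^ Nat.log 2 (m - v) := by
  have hyx : 0 < y * x := Nat.mul_pos hy0 hx
  refine Runs.assign_seq hyx (Nat.mod_eq_of_lt (by omega) : 1 % E.M = 1) ?_
  have hinit : State.AgreeOff (r :: p.writes) s (s.setReg r 1) :=
    State.AgreeOff.setReg (fun _ _ => rfl) (List.mem_cons_self ..)
  refine (Runs.loop (I := fun i s' => I i s' ∧ s'.reg r = 2 ^ i ∧
    State.AgreeOff (r :: p.writes) s s') hx hy hy0 ⟨h0, by simp, hinit⟩ ?_ ?_).imp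
    fun s' h => ⟨h.1, h.2.1⟩
  · rintro i s' hi ⟨hI, hreg, hs'⟩
    have him : v + 2 ^ (i + 1) ≤ m := lt_log_two_sub_iff.1 hi
    refine ⟨by rw [Ne, doubling_test_eq_zero hM hi.le (hlo s' hs') (hhi s' hs') hreg]; omega, ?_⟩
    refine Runs.seq (hstep i s' him hs' hreg hI).frame fun s'' ⟨hI', hf⟩ => ?_
    have hval : (Expr.reg r * 2).eval E s'' = 2 ^ (i + 1) := by
      rw [Expr.eval_mul, Expr.eval_reg, hf r hr, hreg, Expr.eval_ofNat, Nat.mul_mod_mod, ← pow_succ,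
        Nat.mod_eq_of_lt (by omega)]
    refine Runs.assign hx ⟨by rw [hval]; exact hI', by simp [hval],
      (hs'.trans (hf.mono (List.subset_cons_self ..))).setReg (List.mem_cons_self ..)⟩
  · rintro s' ⟨-, hreg, hs'⟩
    rw [doubling_test_eq_zero hM le_rfl (hlo s' hs') (hhi s' hs') hreg, ← not_le,
      ← lt_log_two_sub_iff]
    exact lt_irrefl _

end Runs

end WordRAM

namespace GapEditDistance

/-! ### Memory layout -/

/-- An injective pairing function without division or case distinction. -/
def pair (x y : ℕ) : ℕ := (x + y) * (x + y) + y

theorem pair_inj {x y x' y' : ℕ} : pair x y = pair x' y' ↔ x = x' ∧ y = y' := by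
  refine ⟨fun h => ?_, by rintro ⟨rfl, rfl⟩; rfl⟩
  unfold pair at h
  have hsum : x + y = x' + y' := by
    rcases lt_trichotomy (x + y) (x' + y') with g | g | g
    · nlinarith
    · exact g
    · nlinarith
  rw [hsum] at h
  omega

theorem pair_lt {x y Z : ℕ} (hx : x < Z) (hy : y < Z) : pair x y < 4 * Z ^ 2 := by
  unfold pair
  nlinarith

/-- An expression for the pairing function. -/
def pairExpr (e f : Expr) : Expr := (e + f) * (e + f) + f

theorem eval_pairExpr {E : Env} {s : State} {e f : Expr} {x y : ℕ} (he : e.eval E s = x)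
    (hf : f.eval E s = y) (h : pair x y < E.M) : (pairExpr e f).eval E s = pair x y := by
  unfold pair at h ⊢
  have := Nat.le_mul_self (x + y)
  simp (disch := omega) only [pairExpr, Expr.eval_add, Expr.eval_mul, he, hf, Nat.mod_eq_of_lt]

/-- Five numbers as one; a balanced tree of pairs keeps it below a small power of its arguments. -/
def encode (g u v x y : ℕ) : ℕ := pair (pair g u) (pair (pair v x) y)

theorem encode_inj {g u v x y g' u' v' x' y' : ℕ} :
    encode g u v x y = encode g' u' v' x' y' ↔ (g = g' ∧ u = u') ∧ (v = v' ∧ x = x') ∧ y = y' := by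
  simp only [encode, pair_inj]

/-- An expression for the encoding of five numbers. -/
def encodeExpr (g u v x y : Expr) : Expr := pairExpr (pairExpr g u) (pairExpr (pairExpr v x) y)

theorem eval_encodeExpr {E : Env} {s : State} {eg eu ev ex ey : Expr} {g u v x y Z : ℕ}
    (hM : 2 ^ 14 * Z ^ 8 ≤ E.M) (hg : eg.eval E s = g) (hu : eu.eval E s = u)
    (hv : ev.eval E s = v) (hx : ex.eval E s = x) (hy : ey.eval E s = y) (hgZ : g < Z) (huZ : u < Z)
    (hvZ : v < Z) (hxZ : x < Z) (hyZ : y < Z) :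
    (encodeExpr eg eu ev ex ey).eval E s = encode g u v x y := by
  have hZ1 : Z ≤ 4 * Z ^ 2 := by nlinarith
  have hZ2 : 4 * Z ^ 2 ≤ 4 * (4 * Z ^ 2) ^ 2 := by nlinarith
  have hZ3 : 4 * (4 * (4 * Z ^ 2) ^ 2) ^ 2 = 2 ^ 14 * Z ^ 8 := by ring
  have hZ4 : 4 * (4 * Z ^ 2) ^ 2 ≤ 4 * (4 * (4 * Z ^ 2) ^ 2) ^ 2 := by nlinarith
  have hgu := pair_lt hgZ huZ
  have hvx := pair_lt hvZ hxZ
  have hvxy := pair_lt hvx (hyZ.trans_le hZ1)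
  have hall := pair_lt (hgu.trans_le hZ2) hvxy
  exact eval_pairExpr (eval_pairExpr hg hu (by omega))
    (eval_pairExpr (eval_pairExpr hv hx (by omega)) hy (by omega)) (by omega)

/-- The entries of the data structure, as memory cells whose indices are numbers (at run time) or
expressions (in the programs): the position sampled in leaf block `p`; the name of the block of
`h` leaf blocks from `p` on in the first string shifted by `t`; the dictionary of the names of
blocks of length `h` whose halves have the names `x` and `y`; the flag that says whether the name
`x` occurs for a shift in class `r`; the name of a block of the second string; the furthest position
reached after `e` rounds in class `r`. -/
inductive Cell (α : Type)
  | sample (p : α)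
  | name (h p t : α)
  | dict (h p x y : α)
  | flag (h p x r : α)
  | queryName (h p : α)
  | furthest (e r : α)
  deriving DecidableEq

namespace Cell

/-- The address of a memory cell. -/
def address : Cell ℕ → ℕ
  | sample p => encode 0 0 p 0 0
  | name h p t => encode 1 h p t 0
  | dict h p x y => encode 2 h p x y
  | flag h p x r => encode 3 h p x r
  | queryName h p => encode 4 h p 0 0
  | furthest e r => encode 5 e r 0 0

theorem address_injective : Function.Injective address := by
  rintro (_ | _) (_ | _) <;> simp [address, encode_inj] <;> tauto

/-- An expression for the address of a cell. -/
def expr : Cell Expr → Expr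
  | sample p => encodeExpr 0 0 p 0 0
  | name h p t => encodeExpr 1 h p t 0
  | dict h p x y => encodeExpr 2 h p x y
  | flag h p x r => encodeExpr 3 h p x r
  | queryName h p => encodeExpr 4 h p 0 0
  | furthest e r => encodeExpr 5 e r 0 0

/-- The cell that is denoted by a cell whose indices are expressions. -/
def eval (E : Env) (s : State) : Cell Expr → Cell ℕ
  | sample p => sample (p.eval E s)
  | name h p t => name (h.eval E s) (p.eval E s) (t.eval E s)
  | dict h p x y => dict (h.eval E s) (p.eval E s) (x.eval E s) (y.eval E s)
  | flag h p x r => flag (h.eval E s) (p.eval E s) (x.eval E s) (r.eval E s)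
  | queryName h p => queryName (h.eval E s) (p.eval E s)
  | furthest e r => furthest (e.eval E s) (r.eval E s)

/-- All indices are less than `Z`. -/
def Below (Z : ℕ) : Cell ℕ → Prop
  | sample p => p < Z
  | name h p t => h < Z ∧ p < Z ∧ t < Z
  | dict h p x y => h < Z ∧ p < Z ∧ x < Z ∧ y < Z
  | flag h p x r => h < Z ∧ p < Z ∧ x < Z ∧ r < Z
  | queryName h p => h < Z ∧ p < Z
  | furthest e r => e < Z ∧ r < Z

theorem eval_expr {E : Env} {s : State} {Z : ℕ} (hM : 2 ^ 14 * Z ^ 8 ≤ E.M) (hZ : 6 ≤ Z)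
    {c : Cell Expr} {c' : Cell ℕ} (hc : c.eval E s = c') (hc' : c'.Below Z) :
    c.expr.eval E s = c'.address := by
  subst hc
  have hZM : Z ≤ 2 ^ 14 * Z ^ 8 :=
    (Nat.le_self_pow (by norm_num) Z).trans (Nat.le_mul_of_pos_left _ (by norm_num))
  have hconst (i : ℕ) (hi : i < 6) : (Expr.const i).eval E s = i := Nat.mod_eq_of_lt (by omega)
  cases c <;> simp only [eval, Below] at hc' <;>
    exact eval_encodeExpr hM (hconst _ (by norm_num)) rfl rfl rfl rfl (by omega) (by omega)
      (by omega) (by omega) (by omega)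

end Cell

/-- The memory of a state, indexed by cells instead of addresses. -/
def cells (s : State) (c : Cell ℕ) : ℕ := s.mem c.address

theorem cells_setMem {s : State} {c : Cell ℕ} {v : ℕ} :
    cells (s.setMem c.address v) = Function.update (cells s) c v :=
  (Function.update_comp_eq_of_injective s.mem Cell.address_injective c v)

/-! ### The programs -/

/-- The registers; the first four hold the input. -/
inductive Reg
  | n | k | ℓ | σ | K | L | l | N | T | R | E | h | p | t | e | r | x | y
  deriving DecidableEq

instance : Coe Reg ℕ := ⟨Reg.ctorIdx⟩
instance : Coe Reg Expr := ⟨fun a => .reg a⟩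

theorem Reg.ctorIdx_inj {a b : Reg} : a.ctorIdx = b.ctorIdx ↔ a = b :=
  ⟨fun h => by rw [← Reg.ofNat_ctorIdx a, h, Reg.ofNat_ctorIdx], congrArg _⟩

section

open Reg

local infixr:30 ";;" => Prog.seq
local infix:40 "≔" => Prog.assign

/-- The memory word in a cell. -/
def load (c : Cell Expr) : Expr := .load c.expr

/-- The instruction that stores a word in a cell. -/
def store (c : Cell Expr) (e : Expr) : Prog := .store c.expr e

/-- Computes `L = ⌊log₂ n⌋ + 1` and the length `l = 2 ^ ⌊log₂ ℓ⌋` of a leaf block. -/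
def logProg : Prog :=
  L ≔ 1 ;;
  .doubling x 0 n (L ≔ L + 1) ;;
  .doubling l 0 ℓ .skip

/-- Computes the number `N` of leaf blocks, the greatest shift `K`, the number `T` of shifts, the
number `R` of classes of shifts and the number `E` of rounds. -/
def boundsProg (a : ℕ) : Prog :=
  N ≔ n / l ;;
  K ≔ .const a * Expr.pow L a * k ;;
  T ≔ K * 2 + 1 ;;
  R ≔ K * 2 / l + 1 ;;
  E ≔ (L + 2) * (K + 1)

/-- Computes the parameters from the input. -/
def setupProg (a : ℕ) : Prog :=
  logProg ;; boundsProg a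

/-- Samples a position `x` of the leaf block `p`. -/
def drawProg : Prog :=
  .random x ;;
  x ≔ p * l + x % l ;;
  store (.sample p) x

/-- Reads the character at the sampled position `x` of the first string for each shift. -/
def readShiftsProg : Prog :=
  .forRange t 0 T (store (.name 1 p t) (.readA (x + t - K)))

/-- Samples a position of each leaf block and reads its characters. -/
def sampleProg : Prog :=
  .forRange p 0 N (drawProg ;; readShiftsProg)

/-- Puts the address of the dictionary entry for the names of the halves of the block of length
`2 * h` at `p` in the string shifted by `t` into `x`, and enters `t + 1` there if it is `0`. -/
def dictProg : Prog :=
  x ≔ Cell.expr (.dict (h * 2) p (load (.name h p t)) (load (.name h (p + h) t))) ;;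
  .ite (.load x) .skip (.store x (t + 1))

/-- Records `y` as the name of the block of length `2 * h` at `p` for the shift `t`. -/
def recordProg : Prog :=
  store (.name (h * 2) p t) y ;;
  store (.flag (h * 2) p y (t / l + 1)) 1

/-- Names the block of length `2 * h` at `p` for the shift `t`, given the names of its halves. -/
def nameProg : Prog :=
  dictProg ;;
  y ≔ .load x ;;
  recordProg

/-- Runs a program for all blocks, in the order of their length; it gets half of the length. -/
def forBlocks (body : Prog) : Prog :=
  .doubling h 0 N (.forRange p 0 (N + 1 - h * 2) body)

/-- The preprocessing program. -/
def preProg (a : ℕ) : Prog :=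
  setupProg a ;; sampleProg ;; forBlocks (.forRange t 0 T nameProg)

/-- Reads the sampled positions of the second string. -/
def readProg : Prog :=
  .forRange p 0 N (store (.queryName 1 p) (.readB (load (.sample p))))

/-- Looks up the name of the block of length `2 * h` at `p`, given the names of its halves. -/
def lookupProg : Prog :=
  store (.queryName (h * 2) p)
    (load (.dict (h * 2) p (load (.queryName h p)) (load (.queryName h (p + h)))))

/-- Sets `x` to the end of the block of length `2 * h` at `p` if it matches in class `r`. -/
def extendProg : Prog :=
  .ite (load (.flag (h * 2) p (load (.queryName (h * 2) p)) r)) (x ≔ p + h * 2) .skip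

/-- Finds the end `x` of the longest block at `p` that matches in class `r`. -/
def jumpProg : Prog :=
  x ≔ p + 1 ;;
  .doubling h p N extendProg

/-- Replaces `x` by its maximum with a memory word. -/
def maxProg (c : Cell Expr) : Prog :=
  .ite ((x : Expr).less (load c)) (x ≔ load c) .skip

/-- Enters the maximum of `x` and the entries of the neighbouring classes in the next round. -/
def relaxProg : Prog :=
  maxProg (.furthest e (r - 1)) ;;
  maxProg (.furthest e (r + 1)) ;;
  store (.furthest (e + 1) r) x

/-- Computes the furthest position in class `r` after `e + 1` rounds. -/
def entryProg : Prog :=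
  p ≔ load (.furthest e r) ;; jumpProg ;; relaxProg

/-- Computes the furthest positions for all rounds and classes. -/
def tableProg : Prog :=
  .forRange e 0 E (.forRange r 1 (R + 1) entryProg)

/-- Answers whether the end of the strings has been reached. -/
def answerProg : Prog :=
  n ≔ 0 ;;
  .forRange r 1 (R + 1) (.ite ((load (.furthest E r)).less N) .skip (n ≔ 1))

/-- The query program. -/
def queryProg (a : ℕ) : Prog :=
  setupProg a ;; readProg ;; forBlocks lookupProg ;; tableProg ;; answerProg

theorem queryProg_randomFree (a : ℕ) : (queryProg a).RandomFree := by
  simp [queryProg, setupProg, logProg, boundsProg, readProg, forBlocks, lookupProg,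
    tableProg, entryProg, jumpProg, extendProg, relaxProg, maxProg, answerProg, Prog.forRange,
    Prog.doubling, store, Prog.RandomFree]

end

section DataStructure

variable {E : Env} {s : State}

theorem cells_setReg {r v : ℕ} : cells (s.setReg r v) = cells s := rfl

/-- The parameters of the data structure: the length `l` of a leaf block, the number `N` of leaf
blocks, the greatest shift `K`, the number `E` of rounds, and a bound `Z` on all indices. -/
structure Params where
  (l N K E Z : ℕ)
  l_pos : 0 < l
  N_pos : 0 < N
  N_mul_l_lt : N * l < Z
  lt_Z : 2 * N + E + (2 * K + 1) + (2 * K / l + 1) + 6 < Z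

namespace Params

/-- The number of shifts; shift `t` moves by `t - K` characters. -/
def T (P : Params) : ℕ := 2 * P.K + 1

/-- The number of classes of shifts; shift `t` is in class `t / l + 1`. -/
def R (P : Params) : ℕ := 2 * P.K / P.l + 1

variable {P : Params}

theorem sum_lt_Z (P : Params) : 2 * P.N + P.E + P.T + P.R + 6 < P.Z := P.lt_Z

theorem class_le {t : ℕ} (ht : t < P.T) : t / P.l + 1 ≤ P.R :=
  Nat.succ_le_succ (Nat.div_le_div_right (Nat.le_of_lt_succ ht))

theorem Z_le (hM : 2 ^ 14 * P.Z ^ 8 ≤ E.M) : 2 ^ 14 * P.Z ≤ E.M :=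
  (Nat.mul_le_mul_left _ (Nat.le_self_pow (by norm_num) _)).trans hM

/-- The registers that hold the parameters. -/
def _root_.GapEditDistance.Reg.params : List Reg := [.l, .N, .K, .T, .R, .E]

/-- The registers hold the parameters. -/
structure Regs (P : Params) (s : State) : Prop where
  l : s.reg Reg.l = P.l
  N : s.reg Reg.N = P.N
  K : s.reg Reg.K = P.K
  T : s.reg Reg.T = P.T
  R : s.reg Reg.R = P.R
  E : s.reg Reg.E = P.E

theorem Regs.of_agreeOff {s' : State} {W : List ℕ} (h : P.Regs s) (hs : State.AgreeOff W s s')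
    (hW : ∀ a ∈ Reg.params, (a : ℕ) ∉ W) : P.Regs s' where
  l := (hs _ (hW _ (by decide))).trans h.l
  N := (hs _ (hW _ (by decide))).trans h.N
  K := (hs _ (hW _ (by decide))).trans h.K
  T := (hs _ (hW _ (by decide))).trans h.T
  R := (hs _ (hW _ (by decide))).trans h.R
  E := (hs _ (hW _ (by decide))).trans h.E

end Params

variable {P : Params} {c : Cell Expr} {c' : Cell ℕ}

theorem eval_cell (hM : 2 ^ 14 * P.Z ^ 8 ≤ E.M) (hc : c.eval E s = c') (hc' : c'.Below P.Z) :
    c.expr.eval E s = c'.address :=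
  Cell.eval_expr hM (by have := P.sum_lt_Z; omega) hc hc'

theorem eval_load (hM : 2 ^ 14 * P.Z ^ 8 ≤ E.M) (hc : c.eval E s = c') (hc' : c'.Below P.Z) :
    (load c).eval E s = cells s c' :=
  congrArg s.mem (eval_cell hM hc hc')

variable {x : ℕ}

theorem runs_store {e : Expr} {v : ℕ} {Q : State → Prop} (hM : 2 ^ 14 * P.Z ^ 8 ≤ E.M) (hx : 0 < x)
    (hc : c.eval E s = c') (hc' : c'.Below P.Z) (he : e.eval E s = v)
    (hQ : Q (s.setMem c'.address v)) : Runs E (store c e) s x Q :=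
  Runs.apply rfl hx (by simpa only [store, Prog.apply, eval_cell hM hc hc', he] using hQ)

variable {body : Prog}

theorem runs_forStarts {i : ℕ} {I : ℕ → (Cell ℕ → ℕ) → Prop} (hM : 2 ^ 14 * P.Z ^ 8 ≤ E.M)
    (hx : 0 < x) (hs : P.Regs s) (hh : s.reg Reg.h = 2 ^ i) (hi : 2 ^ (i + 1) ≤ P.N)
    (hbody : ∀ a ∈ Reg.h :: .p :: Reg.params, (a : ℕ) ∉ body.writes) (h0 : I 0 (cells s))
    (hstep : ∀ p s', p + 2 ^ (i + 1) ≤ P.N → P.Regs s' → s'.reg Reg.h = 2 ^ i →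
      s'.reg Reg.p = p → I p (cells s') → Runs E body s' x fun s'' => I (p + 1) (cells s'')) :
    Runs E (.forRange Reg.p 0 (Reg.N + 1 - Reg.h * 2) body) s (P.N * x) fun s' =>
      I (P.N + 1 - 2 ^ (i + 1)) (cells s') := by
  have hMZ := P.Z_le hM
  have hZ := P.sum_lt_Z
  have hpow := Nat.two_pow_pos (i + 1)
  have hpow' := Nat.pow_succ 2 i
  have hframe {s'} (hs' : State.AgreeOff (Reg.p.ctorIdx :: body.writes) s s') :
      P.Regs s' ∧ s'.reg Reg.h = 2 ^ i := by
    refine ⟨hs.of_agreeOff hs' fun a ha =>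
        List.not_mem_cons_of_ne_of_not_mem ?_ (hbody a (by simp [ha])),
      (hs' _ (List.not_mem_cons_of_ne_of_not_mem (by decide) (hbody _ (by decide)))).trans hh⟩
    revert a
    decide
  refine Runs.forRange (I := fun p s' => I p (cells s')) (v := 0) hx (by omega) P.N_pos
    (hbody _ (by decide)) (Nat.zero_mod _) (Nat.zero_le _) (by omega) (fun s' hs' => ?_) h0
    fun p s' _ hp hs' hpreg hI => ?_
  · obtain ⟨hregs, hreg⟩ := hframe hs'
    have hadd : ((Reg.N : Expr) + 1).eval E s' = P.N + 1 := by
      simp (disch := omega) only [Expr.eval_add, Expr.eval_reg, Expr.eval_ofNat, hregs.N,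
        Nat.mod_eq_of_lt]
    have hmul : ((Reg.h : Expr) * 2).eval E s' = 2 ^ (i + 1) := by
      simp (disch := omega) only [Expr.eval_mul, Expr.eval_reg, Expr.eval_ofNat, hreg,
        Nat.mod_eq_of_lt, hpow']
    rw [Expr.eval_sub_of_le, hadd, hmul] <;> omega
  · obtain ⟨hregs, hreg⟩ := hframe hs'
    exact hstep p s' (by omega) hregs hreg hpreg hI

theorem runs_forBlocks {I : ℕ → ℕ → (Cell ℕ → ℕ) → Prop} (hM : 2 ^ 14 * P.Z ^ 8 ≤ E.M)
    (hx : 0 < x) (hs : P.Regs s)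
    (hbody : ∀ a ∈ Reg.h :: .p :: Reg.params, (a : ℕ) ∉ body.writes) (h0 : I 0 0 (cells s))
    (hnext : ∀ i m, 2 ^ (i + 1) ≤ P.N → I i (P.N + 1 - 2 ^ (i + 1)) m → I (i + 1) 0 m)
    (hstep : ∀ i p s', p + 2 ^ (i + 1) ≤ P.N → P.Regs s' → s'.reg Reg.h = 2 ^ i →
      s'.reg Reg.p = p → I i p (cells s') → Runs E body s' x fun s'' => I i (p + 1) (cells s'')) :
    Runs E (forBlocks body) s ((Nat.log 2 P.N + 1) * (P.N * x)) fun s' =>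
      P.Regs s' ∧ I (Nat.log 2 P.N) 0 (cells s') := by
  have hMZ := P.Z_le hM
  have hZ := P.sum_lt_Z
  have hh : (Reg.h : ℕ) ∉ body.writes := hbody _ (by decide)
  have hparam (a) (ha : a ∈ Reg.params) : (a : ℕ) ∉ (forBlocks body).writes := by
    have hne : a ≠ .h ∧ a ≠ .p := by revert a; decide
    have := hbody a (by simp [ha])
    simp [forBlocks, Prog.doubling, Prog.forRange, Prog.writes, Reg.ctorIdx_inj, this, hne]
  have hregs {s'} (hs' : State.AgreeOff (forBlocks body).writes s s') : P.Regs s' :=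
    hs.of_agreeOff hs' hparam
  have hwrites : Reg.h.ctorIdx :: (Prog.forRange Reg.p 0 (Reg.N + 1 - Reg.h * 2) body).writes ⊆
      (forBlocks body).writes := by
    simp [forBlocks, Prog.doubling, Prog.writes]
  have hloop := Runs.doubling (E := E) (s := s) (r := Reg.h) (lower := 0) (upper := Reg.N)
    (p := .forRange Reg.p 0 (Reg.N + 1 - Reg.h * 2) body) (x := P.N * x)
    (I := fun i s' => I i 0 (cells s')) (v := 0) (m := P.N) (y := Nat.log 2 P.N + 1)
    (Nat.mul_pos P.N_pos hx) (by simp) (by omega)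
    (by simp [Prog.forRange, Prog.writes, Reg.ctorIdx_inj, hh]) (by omega)
    (fun s' _ => Nat.zero_mod _) (fun s' hs' => (hregs (hs'.mono hwrites)).N) h0
    fun i s' hi hs' hreg hI => ?_
  · exact hloop.frame.imp fun s' h => ⟨hregs h.2, h.1.1⟩
  · rw [zero_add] at hi
    exact (runs_forStarts hM hx (hregs (hs'.mono hwrites)) hreg hi hbody hI fun p s' =>
      hstep i p s').imp fun s' => hnext i _ hi

/-! ### Correctness of the preprocessing -/

open Classical in
/-- One more than the least number below `m` with property `p`, and `0` if there is none. -/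
noncomputable def firstBelow (p : ℕ → Prop) : ℕ → ℕ
  | 0 => 0
  | m + 1 => if firstBelow p m = 0 then if p m then m + 1 else 0 else firstBelow p m

section
variable {p q : ℕ → Prop} {m m' t : ℕ}

theorem firstBelow_congr (h : ∀ t < m, (p t ↔ q t)) : firstBelow p m = firstBelow q m := by
  induction m with
  | zero => rfl
  | succ m ih =>
    rw [firstBelow, firstBelow, ih fun t ht => h t (by omega)]
    have hm := h m (by omega)
    by_cases hp : p m
    · rw [if_pos hp, if_pos (hm.1 hp)]
    · rw [if_neg hp, if_neg fun hq => hp (hm.2 hq)]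

theorem firstBelow_le : firstBelow p m ≤ m := by
  induction m with
  | zero => rfl
  | succ m ih => unfold firstBelow; split_ifs <;> omega

theorem firstBelow_ne_zero (ht : t < m) (h : p t) : firstBelow p m ≠ 0 := by
  induction m with
  | zero => omega
  | succ m ih =>
    unfold firstBelow
    rcases eq_or_ne (firstBelow p m) 0 with h0 | h0
    · have : t = m := by
        by_contra hne
        exact ih (by omega) h0
      subst this
      simp [h0, h]
    · simp [h0]

theorem firstBelow_spec (h : firstBelow p m = t + 1) : t < m ∧ p t := by
  induction m with
  | zero => simp [firstBelow] at h
  | succ m ih =>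
    unfold firstBelow at h
    split_ifs at h with h1 h2
    · obtain rfl : m = t := by omega
      exact ⟨by omega, h2⟩
    · exact ⟨by have := (ih h).1; omega, (ih h).2⟩

theorem firstBelow_stable (h : firstBelow p m ≠ 0) (hm : m ≤ m') :
    firstBelow p m' = firstBelow p m := by
  induction m', hm using Nat.le_induction with
  | base => rfl
  | succ k _ ih => rw [firstBelow, if_neg (by rwa [ih]), ih]

theorem firstBelow_succ_of_not (h : ¬ p m) : firstBelow p (m + 1) = firstBelow p m := by
  rw [firstBelow]; split_ifs with h1
  · exact h1.symm
  · rfl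

theorem firstBelow_succ_of (h : p m) :
    firstBelow p (m + 1) = if firstBelow p m = 0 then m + 1 else firstBelow p m := by
  rw [firstBelow, if_pos h]
end

/-- The name of the block of `h` leaf blocks from `p` on in a sequence `f`: its character if
`h = 1`, otherwise the least shift `t < T` (plus one) where it agrees with `a`, or `0`. -/
noncomputable def blockName (a : ℕ → ℕ → ℕ) (T h p : ℕ) (f : ℕ → ℕ) : ℕ :=
  if h = 1 then f p else firstBelow (fun t => ∀ i, p ≤ i → i < p + h → a i t = f i) T

section
variable {a : ℕ → ℕ → ℕ} {T h p t : ℕ} {f : ℕ → ℕ}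

theorem blockName_eq_iff (ht : t < T) (hh : 1 ≤ h) :
    blockName a T h p (fun i => a i t) = blockName a T h p f ↔
      ∀ i, p ≤ i → i < p + h → a i t = f i := by
  unfold blockName
  split_ifs with h1
  · subst h1
    exact ⟨fun g i hi hi' => by obtain rfl : i = p := by omega
                                exact g, fun g => g p le_rfl (by omega)⟩
  · constructor
    · intro g
      have h0 := firstBelow_ne_zero (p := fun t' => ∀ i, p ≤ i → i < p + h → a i t' = a i t) ht
        fun _ _ _ => rfl
      obtain ⟨u, hu⟩ := Nat.exists_eq_succ_of_ne_zero h0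
      have h1 := (firstBelow_spec hu).2
      rw [g] at hu
      have h2 := (firstBelow_spec hu).2
      exact fun i hi hi' => (h1 i hi hi').symm.trans (h2 i hi hi')
    · intro g
      exact firstBelow_congr fun t' _ => ⟨fun k i hi hi' => (k i hi hi').trans (g i hi hi'),
        fun k i hi hi' => (k i hi hi').trans (g i hi hi').symm⟩

/-- The property that is looked up for a pair of names. -/
def PairAt (a : ℕ → ℕ → ℕ) (T h p x y t : ℕ) : Prop :=
  blockName a T h p (fun i => a i t) = x ∧ blockName a T h (p + h) (fun i => a i t) = y

theorem blockName_double (hh : 1 ≤ h) : blockName a T (h * 2) p f =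
    firstBelow (PairAt a T h p (blockName a T h p f) (blockName a T h (p + h) f)) T := by
  rw [blockName, if_neg (by omega)]
  refine firstBelow_congr fun m hm => ?_
  rw [PairAt, blockName_eq_iff hm hh, blockName_eq_iff hm hh]
  constructor
  · exact fun g => ⟨fun i _ _ => g i (by omega) (by omega),
      fun i _ _ => g i (by omega) (by omega)⟩
  · rintro ⟨g1, g2⟩ i hi hi'
    rcases lt_or_ge i (p + h) with hlt | hge
    · exact g1 i hi hlt
    · exact g2 i hge (by omega)

theorem blockName_lt {Z : ℕ} (hT : T < Z) (hf : f p < Z) : blockName a T h p f < Z := by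
  unfold blockName
  split_ifs
  · exact hf
  · exact firstBelow_le.trans_lt hT

end

theorem firstBelow_pairAt_succ {a : ℕ → ℕ → ℕ} {T h p t : ℕ} (hh : 1 ≤ h) (ht : t < T) :
    firstBelow (PairAt a T h p (blockName a T h p fun i => a i t)
      (blockName a T h (p + h) fun i => a i t)) (t + 1) =
      blockName a T (h * 2) p fun i => a i t := by
  rw [blockName_double hh]
  exact (firstBelow_stable (firstBelow_ne_zero (Nat.lt_succ_self t) ⟨rfl, rfl⟩) ht).symm

/-- The tables of the block of length `2 * h` at `p` are correct for the shifts below `t`: the names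
of the block in the shifted strings, the dictionary of the pairs of names of its halves, and the
flags of the classes of shifts in which a name occurs. -/
structure BlockTable (P : Params) (a : ℕ → ℕ → ℕ) (h p t : ℕ) (m : Cell ℕ → ℕ) : Prop where
  name : ∀ t' < t, m (.name (h * 2) p t') = blockName a P.T (h * 2) p fun i => a i t'
  dict : ∀ x y, m (.dict (h * 2) p x y) = firstBelow (PairAt a P.T h p x y) t
  flag : ∀ x r, m (.flag (h * 2) p x r) ≠ 0 ↔
    ∃ t' < t, t' / P.l + 1 = r ∧ (blockName a P.T (h * 2) p fun i => a i t') = x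

/-- The memory after the block of length `2 * h` at `p` has been named for the shift `t`. -/
noncomputable def recordName (P : Params) (a : ℕ → ℕ → ℕ) (h p t : ℕ) (m : Cell ℕ → ℕ) :
    Cell ℕ → ℕ :=
  let name h p := blockName a P.T h p fun i => a i t
  let m := Function.update m (.dict (h * 2) p (name h p) (name h (p + h))) (name (h * 2) p)
  let m := Function.update m (.name (h * 2) p t) (name (h * 2) p)
  Function.update m (.flag (h * 2) p (name (h * 2) p) (t / P.l + 1)) 1

namespace BlockTable

variable {a : ℕ → ℕ → ℕ} {h p t h' p' t' : ℕ} {m : Cell ℕ → ℕ}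

theorem step (H : BlockTable P a h p t m) (hh : 1 ≤ h) (ht : t < P.T) :
    BlockTable P a h p (t + 1) (recordName P a h p t m) where
  name t' ht' := by
    rcases eq_or_ne t' t with rfl | hne
    · simp [recordName]
    · simpa [recordName, hne] using H.name t' (by omega)
  dict x y := by
    by_cases hxy : PairAt a P.T h p x y t
    · obtain ⟨rfl, rfl⟩ := hxy
      simp [recordName, firstBelow_pairAt_succ hh ht]
    · rw [firstBelow_succ_of_not hxy, ← H.dict]
      have : ¬ (x = blockName a P.T h p (fun i => a i t) ∧
        y = blockName a P.T h (p + h) fun i => a i t) := fun g => hxy ⟨g.1.symm, g.2.symm⟩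
      simp [recordName, this]
  flag x r := by
    simp only [Nat.lt_succ_iff_lt_or_eq, or_and_right, exists_or, exists_eq_left, ← H.flag]
    by_cases hxr : t / P.l + 1 = r ∧ (blockName a P.T (h * 2) p fun i => a i t) = x
    · obtain ⟨rfl, rfl⟩ := hxr
      simp [recordName]
    · have : ¬ (x = (blockName a P.T (h * 2) p fun i => a i t) ∧ r = t / P.l + 1) :=
        fun g => hxr ⟨g.2.symm, g.1.symm⟩
      simp [recordName, this, hxr]

theorem recordName_of_ne (H : BlockTable P a h' p' t' m) (hne : ¬ (h' = h ∧ p' = p)) :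
    BlockTable P a h' p' t' (recordName P a h p t m) := by
  have hne' : h' = h → p' ≠ p := fun g g' => hne ⟨g, g'⟩
  refine ⟨fun t ht => ?_, fun x y => ?_, fun x r => ?_⟩
  · simpa +contextual [recordName, Function.update_apply, hne'] using H.name t ht
  · simpa +contextual [recordName, Function.update_apply, hne'] using H.dict x y
  · simpa +contextual [recordName, Function.update_apply, hne'] using H.flag x r

end BlockTable

variable {a : ℕ → ℕ → ℕ} {h p t x : ℕ}

theorem eval_double {s : State} (hh : s.reg Reg.h = h) (hM : 2 < E.M) (hhM : h * 2 < E.M) :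
    ((Reg.h : Expr) * 2).eval E s = h * 2 := by
  simp (disch := omega) only [Expr.eval_mul, Expr.eval_reg, Expr.eval_ofNat, hh, Nat.mod_eq_of_lt]

theorem eval_middle {s : State} (hh : s.reg Reg.h = h) (hp : s.reg Reg.p = p) (hM : p + h < E.M) :
    ((Reg.p : Expr) + Reg.h).eval E s = p + h := by
  simp (disch := omega) only [Expr.eval_add, Expr.eval_reg, hh, hp, Nat.mod_eq_of_lt]

theorem runs_dictProg {u v : ℕ} (hM : 2 ^ 14 * P.Z ^ 8 ≤ E.M) (hx : 0 < x)
    (hh : s.reg Reg.h = h) (hp : s.reg Reg.p = p) (ht : s.reg Reg.t = t)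
    (hpN : p + h * 2 ≤ P.N) (htT : t < P.T) (hu : u < P.Z) (hv : v < P.Z)
    (hleft : cells s (.name h p t) = u) (hright : cells s (.name h (p + h) t) = v) :
    Runs E dictProg s x fun s' => s'.reg Reg.x = (Cell.dict (h * 2) p u v).address ∧
      cells s' = Function.update (cells s) (.dict (h * 2) p u v)
        (if cells s (.dict (h * 2) p u v) = 0 then t + 1 else cells s (.dict (h * 2) p u v)) := by
  have hMZ := P.Z_le hM
  have hZ := P.sum_lt_Z
  set c := Cell.dict (h * 2) p u v with hc
  refine Runs.seq (R := fun s₁ => s₁ = s.setReg Reg.x c.address) (Runs.assign hx ?_) ?_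
  · rw [eval_cell (c' := c) hM _ ⟨by omega, by omega, hu, hv⟩]
    simp only [Cell.eval, eval_double (E := E) hh (by omega) (by omega), Expr.eval_reg, hp, hh, ht,
      (eval_load (c' := .name h p t) hM _ ⟨by omega, by omega, by omega⟩).trans hleft,
      (eval_load (c' := .name h (p + h) t) hM _ ⟨by omega, by omega, by omega⟩).trans hright,
      eval_middle (E := E) hh hp (by omega), hc]
  rintro _ rfl
  have hreg : (s.setReg Reg.x c.address).reg Reg.x = c.address := by simp
  have hload : (s.setReg Reg.x c.address).mem c.address = cells s c := rfl
  have ht' : ((Reg.t : Expr) + 1).eval E (s.setReg Reg.x c.address) = t + 1 := by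
    simp (disch := omega) [Reg.ctorIdx_inj, ht, Nat.mod_eq_of_lt]
  refine Runs.apply rfl hx ?_
  simp only [Prog.apply, Expr.eval_load, Expr.eval_reg, hreg, hload]
  split_ifs with h0
  · rw [ht', cells_setMem, cells_setReg]
    exact ⟨hreg, rfl⟩
  · rw [Function.update_eq_self]
    exact ⟨hreg, rfl⟩

theorem runs_recordProg {v : ℕ} (hM : 2 ^ 14 * P.Z ^ 8 ≤ E.M) (hx : 0 < x)
    (hh : s.reg Reg.h = h) (hp : s.reg Reg.p = p) (ht : s.reg Reg.t = t)
    (hl : s.reg Reg.l = P.l) (hy : s.reg Reg.y = v) (hpN : p + h * 2 ≤ P.N) (htT : t < P.T)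
    (hv : v < P.Z) :
    Runs E recordProg s x fun s' => cells s' = Function.update
      (Function.update (cells s) (.name (h * 2) p t) v) (.flag (h * 2) p v (t / P.l + 1)) 1 := by
  have hMZ := P.Z_le hM
  have hZ := P.sum_lt_Z
  have hclass := P.class_le htT
  have hdouble := eval_double (E := E) hh (by omega) (by omega)
  refine (runs_store (c' := .name (h * 2) p t) (v := v) hM hx ?_ ⟨by omega, by omega, by omega⟩ ?_
    (Q := fun s' => s' = _) rfl).seq ?_
  · simp only [Cell.eval, Expr.eval_reg, hdouble, hp, ht]
  · exact hy
  rintro _ rfl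
  refine runs_store (c' := .flag (h * 2) p v (t / P.l + 1)) (v := 1) hM hx ?_
    ⟨by omega, by omega, hv, by omega⟩ ?_ ?_
  · have hdiv : ((Reg.t : Expr) / Reg.l + 1).eval E s = t / P.l + 1 := by
      simp (disch := omega) only [Expr.eval_add, Expr.eval_div, Expr.eval_reg, Expr.eval_ofNat, ht,
        hl, Nat.mod_eq_of_lt]
    exact congr (congr (congr (congrArg Cell.flag hdouble) hp) hy) hdiv
  · have hone : 1 % E.M = 1 := Nat.mod_eq_of_lt (by omega)
    exact hone
  · rw [cells_setMem, cells_setMem]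

theorem runs_nameProg (hM : 2 ^ 14 * P.Z ^ 8 ≤ E.M) (ha : ∀ p t, a p t < P.Z) (hx : 0 < x)
    (hs : P.Regs s) (hh : s.reg Reg.h = h) (hp : s.reg Reg.p = p) (ht : s.reg Reg.t = t)
    (hh1 : 1 ≤ h) (hpN : p + h * 2 ≤ P.N) (htT : t < P.T)
    (hleft : cells s (.name h p t) = blockName a P.T h p fun i => a i t)
    (hright : cells s (.name h (p + h) t) = blockName a P.T h (p + h) fun i => a i t)
    (H : BlockTable P a h p t (cells s)) :
    Runs E nameProg s x fun s' => cells s' = recordName P a h p t (cells s) := by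
  have hZ := P.sum_lt_Z
  have hname {h' p' : ℕ} : (blockName a P.T h' p' fun i => a i t) < P.Z :=
    blockName_lt (by omega) (ha _ _)
  set v := blockName a P.T (h * 2) p fun i => a i t with hv
  have hsucc := firstBelow_pairAt_succ (a := a) (p := p) hh1 htT
  rw [firstBelow_succ_of ⟨rfl, rfl⟩, ← H.dict, ← hv] at hsucc
  refine (runs_dictProg hM hx hh hp ht hpN htT hname hname hleft hright).frame.seq ?_
  rw [hsucc]
  rintro s₁ ⟨⟨hx₁, hm⟩, hs₁⟩
  refine Runs.seq (Runs.assign (Q := fun s₂ => s₂ = s₁.setReg Reg.y v) hx ?_) ?_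
  · rw [Expr.eval_load, Expr.eval_reg, hx₁]
    exact congrArg (s₁.setReg _) ((congrFun hm _).trans (Function.update_self _ _ _))
  have hframe (a : Reg) (ha : a ≠ .x ∧ a ≠ .y) : (s₁.setReg Reg.y v).reg a = s.reg a := by
    rw [← hs₁ a (by simp [dictProg, Prog.writes, Reg.ctorIdx_inj, ha]), State.reg_setReg,
      if_neg (Reg.ctorIdx_inj.not.2 ha.2)]
  have hy : (s₁.setReg Reg.y v).reg Reg.y = v := by simp
  rintro _ rfl
  refine (runs_recordProg (v := v) hM hx ((hframe .h (by decide)).trans hh)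
    ((hframe .p (by decide)).trans hp) ((hframe .t (by decide)).trans ht)
    ((hframe .l (by decide)).trans hs.l) hy hpN htT hname).imp fun s' h => ?_
  rw [h, cells_setReg, hm]
  rfl

/-- For how many shifts the block of length `2 ^ (j + 1)` at `p'` has been named when the blocks
before the one of length `2 ^ (i + 1)` at `p` are done, and this one for `t` shifts. -/
def processed (T i p t j p' : ℕ) : ℕ :=
  if j < i ∨ j = i ∧ p' < p then T else if j = i ∧ p' = p then t else 0

/-- The memory in the course of the preprocessing: the sampled positions `q`, the characters `a`
sampled in the shifted strings, and the tables of the blocks as far as they have been processed. -/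
structure Tables (P : Params) (a : ℕ → ℕ → ℕ) (q : ℕ → ℕ) (i p t : ℕ) (m : Cell ℕ → ℕ) : Prop where
  sample : ∀ p' < P.N, m (.sample p') = q p'
  char : ∀ p' < P.N, ∀ t' < P.T, m (.name 1 p' t') = a p' t'
  block : ∀ j p', p' + 2 ^ (j + 1) ≤ P.N →
    BlockTable P a (2 ^ j) p' (processed P.T i p t j p') m
  furthest : ∀ e r, m (.furthest e r) = 0

namespace Tables

variable {q : ℕ → ℕ} {i t' : ℕ} {m : Cell ℕ → ℕ}

theorem name (H : Tables P a q i p t m) {p' : ℕ} (hp' : p' + 2 ^ i ≤ P.N) (ht' : t' < P.T) :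
    m (.name (2 ^ i) p' t') = blockName a P.T (2 ^ i) p' fun p => a p t' := by
  rcases i with _ | j
  · exact H.char p' hp' t' ht'
  · exact (H.block j p' hp').name t' (by rwa [processed, if_pos (.inl j.lt_succ_self)])

theorem congr (H : Tables P a q i p t m) {i' p' : ℕ}
    (h : ∀ j u, u + 2 ^ (j + 1) ≤ P.N → processed P.T i' p' t' j u = processed P.T i p t j u) :
    Tables P a q i' p' t' m :=
  { H with block := fun j u hu => h j u hu ▸ H.block j u hu }

theorem step (H : Tables P a q i p t m) (hp : p + 2 ^ (i + 1) ≤ P.N) (ht : t < P.T) :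
    Tables P a q i p (t + 1) (recordName P a (2 ^ i) p t m) where
  sample p' hp' := by simpa [recordName] using H.sample p' hp'
  char p' hp' t' ht' := by
    have : 1 ≠ 2 ^ i * 2 := by omega
    simpa [recordName, this] using H.char p' hp' t' ht'
  block j p' hp' := by
    rcases em (j = i ∧ p' = p) with ⟨rfl, rfl⟩ | hne
    · have hproc (t) : processed P.T j p' t j p' = t := by simp [processed]
      have := H.block j p' hp'
      rw [hproc] at this ⊢
      exact this.step Nat.one_le_two_pow ht
    · have := H.block j p' hp'
      rw [processed, if_neg hne] at this ⊢
      exact this.recordName_of_ne fun h => hne ⟨Nat.pow_right_injective le_rfl h.1, h.2⟩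
  furthest e r := by simpa [recordName] using H.furthest e r

theorem nextStart (H : Tables P a q i p P.T m) : Tables P a q i (p + 1) 0 m :=
  H.congr fun j u _ => by unfold processed; split_ifs <;> first | rfl | omega

theorem nextLength (hi : 2 ^ (i + 1) ≤ P.N) (H : Tables P a q i (P.N + 1 - 2 ^ (i + 1)) 0 m) :
    Tables P a q (i + 1) 0 0 m := by
  refine H.congr fun j u hu => ?_
  unfold processed
  rcases lt_trichotomy j i with h | rfl | h
  · rw [if_pos (by omega), if_pos (by omega)]
  · rw [if_pos (by omega), if_pos (by omega)]
  · rw [if_neg (by omega), ite_self, if_neg (by omega), ite_self]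

end Tables

variable {q : ℕ → ℕ} {i : ℕ}

theorem runs_nameShifts (hM : 2 ^ 14 * P.Z ^ 8 ≤ E.M) (ha : ∀ p t, a p t < P.Z) (hx : 0 < x)
    (hs : P.Regs s) (hh : s.reg Reg.h = 2 ^ i) (hp : s.reg Reg.p = p) (hpN : p + 2 ^ (i + 1) ≤ P.N)
    (H : Tables P a q i p 0 (cells s)) :
    Runs E (.forRange Reg.t 0 Reg.T nameProg) s (P.T * x) fun s' =>
      Tables P a q i (p + 1) 0 (cells s') := by
  have hMZ := P.Z_le hM
  have hZ := P.sum_lt_Z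
  have hframe (b : Reg) (hb : b ≠ .t ∧ b ≠ .x ∧ b ≠ .y) :
      (b : ℕ) ∉ Reg.t.ctorIdx :: nameProg.writes := by
    simp [nameProg, dictProg, recordProg, store, Prog.writes, Reg.ctorIdx_inj, hb]
  have hregs {s'} (hs' : State.AgreeOff (Reg.t.ctorIdx :: nameProg.writes) s s') : P.Regs s' :=
    hs.of_agreeOff hs' fun b hb => hframe b (by revert b; decide)
  refine (Runs.forRange (I := fun t s' => Tables P a q i p t (cells s')) (lower := 0)
    (upper := Reg.T) hx le_rfl (Nat.succ_pos _)
    (by simp [nameProg, dictProg, recordProg, store, Prog.writes, Reg.ctorIdx_inj])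
    (Nat.zero_mod _) (Nat.zero_le _) (by omega) (fun s' hs' => (hregs hs').T) H
    fun t s' _ ht hs' htreg hI => ?_).imp fun s' => Tables.nextStart
  refine (runs_nameProg hM ha hx (hregs hs') ((hs' _ (hframe .h (by decide))).trans hh)
    ((hs' _ (hframe .p (by decide))).trans hp) htreg Nat.one_le_two_pow (by omega) ht
    (hI.name (by omega) ht) (hI.name (by omega) ht) ?_).imp fun s'' h => ?_
  · simpa [processed] using hI.block i p hpN
  · rw [cells_setReg, h]
    exact hI.step hpN ht

/-- The memory after the positions of the leaf blocks below `p` have been sampled. -/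
structure Sampled (P : Params) (a : ℕ → ℕ → ℕ) (q : ℕ → ℕ) (p : ℕ) (m : Cell ℕ → ℕ) : Prop where
  sample : ∀ p' < p, m (.sample p') = q p'
  char : ∀ p' < p, ∀ t < P.T, m (.name 1 p' t) = a p' t
  blank : ∀ c : Cell ℕ, (∀ p', c ≠ .sample p') → (∀ p' t, c ≠ .name 1 p' t) → m c = 0

namespace Sampled

variable {m m' : Cell ℕ → ℕ}

theorem extend (H : Sampled P a q p m) (hp : m' (.sample p) = q p)
    (ht : ∀ t < P.T, m' (.name 1 p t) = a p t)
    (hm : ∀ c, c ≠ .sample p → (∀ t, c ≠ .name 1 p t) → m' c = m c) :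
    Sampled P a q (p + 1) m' where
  sample p' hp' := by
    rcases eq_or_ne p' p with rfl | hne
    · exact hp
    · exact (hm _ (by simpa using hne) (by simp)).trans (H.sample p' (by omega))
  char p' hp' t htT := by
    rcases eq_or_ne p' p with rfl | hne
    · exact ht t htT
    · exact (hm _ (by simp) (by simp [hne])).trans (H.char p' (by omega) t htT)
  blank c hc hc' := (hm c (hc p) (hc' p)).trans (H.blank c hc hc')

theorem tables (H : Sampled P a q P.N m) : Tables P a q 0 0 0 m where
  sample := H.sample
  char := H.char
  block j p' _ := by
    have : processed P.T 0 0 0 j p' = 0 := by simp [processed]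
    rw [this]
    constructor
    · simp
    · exact fun x y => H.blank _ (by simp) (by simp)
    · exact fun x r => by simp [H.blank (.flag (2 ^ j * 2) p' x r)]
  furthest e r := H.blank _ (by simp) (by simp)

end Sampled

theorem Params.mul_l_add_lt {r : ℕ} (hp : p < P.N) (hr : r < P.l) : p * P.l + r < P.Z := by
  have := P.N_mul_l_lt
  have : (p + 1) * P.l ≤ P.N * P.l := Nat.mul_le_mul_right _ hp
  rw [Nat.succ_mul] at this
  omega

theorem runs_drawProg (hM : 2 ^ 14 * P.Z ^ 8 ≤ E.M) (hx : 0 < x) (hs : P.Regs s)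
    (hp : s.reg Reg.p = p) (hpN : p < P.N) (hq : q p = p * P.l + E.tape s.used % P.l) :
    Runs E drawProg s x fun s' => s'.used = s.used + 1 ∧ s'.reg Reg.x = q p ∧
      cells s' = Function.update (cells s) (.sample p) (q p) := by
  have hMZ := P.Z_le hM
  have hZ := P.sum_lt_Z
  have hqZ := P.mul_l_add_lt hpN (Nat.mod_lt (E.tape s.used) P.l_pos)
  refine (Runs.apply rfl hx (Q := fun s' => s' = _) rfl).seq ?_
  rintro _ rfl
  refine Runs.assign_seq hx rfl ?_
  have heval : ((Reg.p : Expr) * Reg.l + Reg.x % Reg.l).eval E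
      ((Prog.random Reg.x).apply E s) = q p := by
    simp only [Prog.apply, Expr.eval_add, Expr.eval_mul, Expr.eval_mod, Expr.eval_reg]
    simp (disch := omega) [Reg.ctorIdx_inj, hp, hs.l, Nat.mod_eq_of_lt, hq]
  rw [heval]
  refine runs_store (c' := .sample p) (v := q p) hM hx ?_ ?_ ?_ ⟨rfl, ?_, cells_setMem⟩
  · simp [Cell.eval, Reg.ctorIdx_inj, Prog.apply, hp]
  · exact (by omega : p < P.Z)
  · simp
  · simp

theorem runs_readShiftsProg (hM : 2 ^ 14 * P.Z ^ 8 ≤ E.M) (hx : 0 < x)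
    (hs : P.Regs s) (hp : s.reg Reg.p = p) (hxq : s.reg Reg.x = q p) (hpN : p < P.N)
    (hqZ : q p < P.Z) (ha : ∀ t < P.T, E.strA ((q p + t + E.M - P.K) % E.M) = a p t) :
    Runs E readShiftsProg s (P.T * x) fun s' => s'.used = s.used ∧
      (∀ t < P.T, cells s' (.name 1 p t) = a p t) ∧
      ∀ c, (∀ t, c ≠ .name 1 p t) → cells s' c = cells s c := by
  have hMZ := P.Z_le hM
  have hZ := P.sum_lt_Z
  refine Runs.forRange (E := E) (s := s) (r := Reg.t) (lower := 0) (upper := Reg.T)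
    (I := fun t s' => s'.used = s.used ∧ (∀ t' < t, cells s' (.name 1 p t') = a p t') ∧
      ∀ c, (∀ t, c ≠ .name 1 p t) → cells s' c = cells s c)
    hx le_rfl (Nat.succ_pos _) (by decide) (Nat.zero_mod _) (Nat.zero_le _) (by omega)
    (fun s' hs' => (hs.of_agreeOff hs' (by decide)).T) ⟨rfl, by simp, fun _ _ => rfl⟩
    fun t s' _ ht hs' htreg ⟨hu, hI, hI'⟩ => ?_
  have hK := (hs.of_agreeOff hs' (by decide)).K
  have hone : 1 % E.M = 1 := Nat.mod_eq_of_lt (by omega)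
  have hp' := (hs' Reg.p (by decide)).trans hp
  have hx' := (hs' Reg.x (by decide)).trans hxq
  refine runs_store (c' := .name 1 p t) (v := a p t) hM hx ?_ ⟨by omega, by omega, by omega⟩
    ?_ ⟨hu, fun t' ht' => ?_, fun c hc => ?_⟩
  · exact congr (congr (congrArg Cell.name hone) hp') htreg
  · rw [← ha t ht, Expr.eval_readA, Expr.eval_sub, Expr.eval_add]
    simp (disch := omega) only [Expr.eval_reg, hx', htreg, hK, Nat.mod_eq_of_lt]
  · rw [cells_setReg, cells_setMem]
    rcases eq_or_ne t' t with rfl | hne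
    · exact Function.update_self _ _ _
    · rw [Function.update_of_ne (by simpa using hne), hI t' (by omega)]
  · rw [cells_setReg, cells_setMem, Function.update_of_ne (hc t), hI' c hc]

theorem runs_sampleProg (hM : 2 ^ 14 * P.Z ^ 8 ≤ E.M) (hx : 0 < x) (hs : P.Regs s)
    (hu : s.used = 0) (hmem : ∀ c, cells s c = 0)
    (hq : ∀ p < P.N, q p = p * P.l + E.tape p % P.l)
    (ha : ∀ p < P.N, ∀ t < P.T, E.strA ((q p + t + E.M - P.K) % E.M) = a p t) :
    Runs E sampleProg s (P.N * (P.T * x)) fun s' => P.Regs s' ∧ Tables P a q 0 0 0 (cells s') := by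
  have hMZ := P.Z_le hM
  have hZ := P.sum_lt_Z
  have hTx : x ≤ P.T * x := Nat.le_mul_of_pos_left _ (Nat.succ_pos _)
  refine (Runs.forRange (E := E) (s := s) (r := Reg.p) (lower := 0) (upper := Reg.N)
    (p := drawProg.seq readShiftsProg) (I := fun p s' => s'.used = p ∧ Sampled P a q p (cells s'))
    (hx.trans_le hTx) le_rfl P.N_pos (by decide) (Nat.zero_mod _) (Nat.zero_le _) (by omega)
    (fun s' hs' => (hs.of_agreeOff hs' (by decide)).N) ⟨hu, by simp, by simp, fun c _ _ => hmem c⟩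
    fun p s' _ hp hs' hpreg ⟨hu, hI⟩ => ?_).frame.imp fun s' h =>
      ⟨hs.of_agreeOff h.2 (by decide), h.1.2.tables⟩
  have hs' := hs.of_agreeOff hs' (by decide)
  have hqZ := P.mul_l_add_lt hp (Nat.mod_lt (E.tape p) P.l_pos)
  refine ((runs_drawProg hM hx hs' hpreg hp (hu.symm ▸ hq p hp : q p = _)).frame.le hTx).seq ?_
  rintro s₁ ⟨⟨hu₁, hx₁, hm₁⟩, hs₁⟩
  refine (runs_readShiftsProg hM hx (hs'.of_agreeOff hs₁ (by decide))
    ((hs₁ _ (by decide)).trans hpreg) hx₁ hp (by rw [hq p hp]; exact hqZ) (ha p hp)).imp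
    fun s₂ ⟨hu₂, hchar, hm₂⟩ => ⟨(hu₂.trans hu₁).trans (congrArg _ hu), hI.extend ?_ hchar ?_⟩
  · exact (hm₂ _ (by simp)).trans (by rw [hm₁, Function.update_self])
  · exact fun c hc hc' => (hm₂ c hc').trans (by rw [hm₁, Function.update_of_ne hc])

theorem runs_preProg_tables (hM : 2 ^ 14 * P.Z ^ 8 ≤ E.M) (hx : 0 < x) (hs : P.Regs s)
    (hu : s.used = 0) (hmem : ∀ c, cells s c = 0) (haZ : ∀ p t, a p t < P.Z)
    (hq : ∀ p < P.N, q p = p * P.l + E.tape p % P.l)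
    (ha : ∀ p < P.N, ∀ t < P.T, E.strA ((q p + t + E.M - P.K) % E.M) = a p t) :
    Runs E (.seq sampleProg (forBlocks (.forRange Reg.t 0 Reg.T nameProg))) s
      ((Nat.log 2 P.N + 1) * (P.N * (P.T * x))) fun s' =>
        Tables P a q (Nat.log 2 P.N) 0 0 (cells s') := by
  refine ((runs_sampleProg hM hx hs hu hmem hq ha).le (Nat.le_mul_of_pos_left _
    (Nat.succ_pos _))).seq fun s₁ ⟨hs₁, H⟩ => ?_
  refine (runs_forBlocks (I := fun i p => Tables P a q i p 0) hM
    (Nat.mul_pos (Nat.succ_pos _) hx) hs₁ (by decide) H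
    (fun i m hi => Tables.nextLength hi) fun i p s' hp hs' hh hpreg H => ?_).imp fun _ => And.right
  exact runs_nameShifts hM haZ hx hs' hh hpreg hp H

/-! ### Correctness of the query -/

/-- The memory after the preprocessing: its tables are complete, and the cells of the table of
furthest positions, whose border the query does not fill, are still `0`. -/
structure Preprocessed (P : Params) (a : ℕ → ℕ → ℕ) (q : ℕ → ℕ) (m : Cell ℕ → ℕ) : Prop where
  sample : ∀ p < P.N, m (.sample p) = q p
  block : ∀ j p, p + 2 ^ (j + 1) ≤ P.N → BlockTable P a (2 ^ j) p P.T m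
  furthest : ∀ e r, m (.furthest e r) = 0

variable {m : Cell ℕ → ℕ} {b : ℕ → ℕ} {e r v : ℕ}

theorem Tables.preprocessed (H : Tables P a q (Nat.log 2 P.N) 0 0 m) : Preprocessed P a q m where
  sample := H.sample
  block j p hp := by
    have hj : j + 1 ≤ Nat.log 2 P.N := Nat.le_log_of_pow_le one_lt_two (by omega)
    simpa only [processed, if_pos (Or.inl hj : j < Nat.log 2 P.N ∨ _)] using H.block j p hp
  furthest := H.furthest

theorem Preprocessed.update_queryName (H : Preprocessed P a q m) :
    Preprocessed P a q (Function.update m (.queryName h p) v) where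
  sample p hp := by simpa using H.sample p hp
  block j p hp :=
    ⟨by simpa using (H.block j p hp).name, by simpa using (H.block j p hp).dict,
      by simpa using (H.block j p hp).flag⟩
  furthest := by simpa using H.furthest

/-- The memory while the blocks of the second string are looked up: the names of the blocks of
length at most `2 ^ i`, and of those of length `2 ^ (i + 1)` that start before `p`, are known. -/
structure QueryNames (P : Params) (a : ℕ → ℕ → ℕ) (q b : ℕ → ℕ) (i p : ℕ) (m : Cell ℕ → ℕ) :
    Prop where
  preprocessed : Preprocessed P a q m
  name : ∀ j p', p' + 2 ^ j ≤ P.N → j ≤ i ∨ j = i + 1 ∧ p' < p →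
    m (.queryName (2 ^ j) p') = blockName a P.T (2 ^ j) p' b

theorem QueryNames.nextLength (H : QueryNames P a q b i (P.N + 1 - 2 ^ (i + 1)) m) :
    QueryNames P a q b (i + 1) 0 m :=
  { H with
    name := fun j p hp hj => H.name j p hp <| by
      by_cases hji : j = i + 1
      · subst hji; omega
      · omega }

theorem QueryNames.step (H : QueryNames P a q b i p m) :
    QueryNames P a q b i (p + 1) (Function.update m (.queryName (2 ^ (i + 1)) p)
      (blockName a P.T (2 ^ (i + 1)) p b)) where
  preprocessed := H.preprocessed.update_queryName
  name j p' hp' hj := by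
    by_cases hne : j = i + 1 ∧ p' = p
    · rw [hne.1, hne.2, Function.update_self]
    · rw [Function.update_of_ne, H.name j p' hp' (by omega)]
      simpa [Nat.pow_right_inj] using hne

theorem runs_readProg (hM : 2 ^ 14 * P.Z ^ 8 ≤ E.M) (hx : 0 < x) (hs : P.Regs s)
    (H : Preprocessed P a q (cells s))
    (hb : ∀ p < P.N, E.strB (q p) = b p) :
    Runs E readProg s (P.N * x) fun s' => P.Regs s' ∧ QueryNames P a q b 0 0 (cells s') := by
  have hMZ := P.Z_le hM
  have hZ := P.sum_lt_Z
  refine (Runs.forRange (E := E) (s := s) (r := Reg.p) (lower := 0) (upper := Reg.N)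
    (p := store (.queryName 1 Reg.p) (.readB (load (.sample Reg.p))))
    (I := fun p s' => Preprocessed P a q (cells s') ∧
      ∀ p' < p, cells s' (.queryName 1 p') = b p')
    hx le_rfl P.N_pos (by decide) (Nat.zero_mod _) (Nat.zero_le _) (by omega)
    (fun s' hs' => (hs.of_agreeOff hs' (by decide)).N) ⟨H, by simp⟩
    fun p s' _ hp _ hpreg ⟨H, hname⟩ => ?_).frame.imp fun s' ⟨⟨H, hname⟩, hs'⟩ =>
      ⟨hs.of_agreeOff hs' (by decide), H, fun j p hp hj => ?_⟩
  · have hone : 1 % E.M = 1 := Nat.mod_eq_of_lt (by omega)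
    refine runs_store (c' := .queryName 1 p) (v := b p) hM hx
      (congr (congrArg Cell.queryName hone) hpreg) ⟨by omega, by omega⟩ ?_ ?_
    · rw [Expr.eval_readB, eval_load (c := .sample Reg.p) hM (congrArg Cell.sample hpreg)
        (show p < P.Z by omega), H.sample p hp, hb p hp]
    · rw [cells_setReg, cells_setMem]
      refine ⟨H.update_queryName, fun p' hp' => ?_⟩
      rcases eq_or_ne p' p with rfl | hne
      · rw [Function.update_self]
      · rw [Function.update_of_ne (by simpa using hne), hname p' (by omega)]
  · obtain rfl : j = 0 := by omega
    exact hname p (by simpa using hp)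

variable {f g u w : Expr} {y z : ℕ}

theorem eval_load_queryName (hM : 2 ^ 14 * P.Z ^ 8 ≤ E.M) (hf : f.eval E s = h)
    (hg : g.eval E s = p) (hh : h < P.Z) (hp : p < P.Z) (hv : cells s (.queryName h p) = v) :
    (load (.queryName f g)).eval E s = v := by
  subst hf hg hv
  exact eval_load hM rfl ⟨hh, hp⟩

theorem eval_load_dict (hM : 2 ^ 14 * P.Z ^ 8 ≤ E.M) (hf : f.eval E s = h) (hg : g.eval E s = p)
    (hu : u.eval E s = y) (hw : w.eval E s = z) (hh : h < P.Z) (hp : p < P.Z) (hy : y < P.Z)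
    (hz : z < P.Z) (hv : cells s (.dict h p y z) = v) : (load (.dict f g u w)).eval E s = v := by
  subst hf hg hu hw hv
  exact eval_load hM rfl ⟨hh, hp, hy, hz⟩

theorem eval_load_flag (hM : 2 ^ 14 * P.Z ^ 8 ≤ E.M) (hf : f.eval E s = h) (hg : g.eval E s = p)
    (hu : u.eval E s = y) (hw : w.eval E s = r) (hh : h < P.Z) (hp : p < P.Z) (hy : y < P.Z)
    (hr : r < P.Z) (hv : cells s (.flag h p y r) = v) : (load (.flag f g u w)).eval E s = v := by
  subst hf hg hu hw hv
  exact eval_load hM rfl ⟨hh, hp, hy, hr⟩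

theorem eval_load_furthest (hM : 2 ^ 14 * P.Z ^ 8 ≤ E.M) (hf : f.eval E s = e)
    (hg : g.eval E s = r) (he : e < P.Z) (hr : r < P.Z) (hv : cells s (.furthest e r) = v) :
    (load (.furthest f g)).eval E s = v := by
  subst hf hg hv
  exact eval_load hM rfl ⟨he, hr⟩

theorem runs_lookupProg (hM : 2 ^ 14 * P.Z ^ 8 ≤ E.M) (hb : ∀ p, b p < P.Z) (hx : 0 < x)
    (hh : s.reg Reg.h = 2 ^ i) (hp : s.reg Reg.p = p)
    (hpN : p + 2 ^ (i + 1) ≤ P.N) (H : QueryNames P a q b i p (cells s)) :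
    Runs E lookupProg s x fun s' => QueryNames P a q b i (p + 1) (cells s') := by
  have hMZ := P.Z_le hM
  have hZ := P.sum_lt_Z
  have hpow := pow_succ 2 i
  have hpos := Nat.two_pow_pos i
  have hname {h p : ℕ} : blockName a P.T h p b < P.Z := blockName_lt (by omega) (hb _)
  have hdouble : ((Reg.h : Expr) * 2).eval E s = 2 ^ (i + 1) := by
    rw [hpow]; exact eval_double hh (by omega) (by omega)
  have hmiddle : ((Reg.p : Expr) + Reg.h).eval E s = p + 2 ^ i := by
    simp (disch := omega) only [Expr.eval_add, Expr.eval_reg, hh, hp, Nat.mod_eq_of_lt]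
  have hleft : (load (.queryName Reg.h Reg.p)).eval E s = blockName a P.T (2 ^ i) p b :=
    eval_load_queryName hM hh hp (by omega) (by omega) (H.name i p (by omega) (.inl le_rfl))
  have hright : (load (.queryName Reg.h (Reg.p + Reg.h))).eval E s =
      blockName a P.T (2 ^ i) (p + 2 ^ i) b :=
    eval_load_queryName hM hh hmiddle (by omega) (by omega) (H.name i _ (by omega) (.inl le_rfl))
  refine runs_store (c' := .queryName (2 ^ (i + 1)) p) (v := blockName a P.T (2 ^ (i + 1)) p b)
    hM hx (congr (congrArg Cell.queryName hdouble) hp) ⟨by omega, by omega⟩ ?_ ?_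
  · refine eval_load_dict hM hdouble hp hleft hright (by omega) (by omega) hname hname ?_
    rw [hpow, (H.preprocessed.block i p hpN).dict, blockName_double Nat.one_le_two_pow]
  · rw [cells_setMem]
    exact H.step

/-- Some shift of class `r` takes the sampled characters of the block of length `h` at `p` of the
second string to those of the first. -/
def MatchIn (P : Params) (a : ℕ → ℕ → ℕ) (b : ℕ → ℕ) (h p r : ℕ) : Prop :=
  ∃ t < P.T, t / P.l + 1 = r ∧ ∀ i, p ≤ i → i < p + h → a i t = b i

/-- The memory words from which the query learns which blocks match. -/
structure MatchFlags (P : Params) (good : ℕ → ℕ → ℕ → Prop) (m : Cell ℕ → ℕ) : Prop where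
  name_lt : ∀ i p, p + 2 ^ (i + 1) ≤ P.N → m (.queryName (2 ^ (i + 1)) p) < P.Z
  flag : ∀ i p r, p + 2 ^ (i + 1) ≤ P.N →
    (m (.flag (2 ^ (i + 1)) p (m (.queryName (2 ^ (i + 1)) p)) r) ≠ 0 ↔ good (2 ^ (i + 1)) p r)

theorem QueryNames.matchFlags (hb : ∀ p, b p < P.Z)
    (H : QueryNames P a q b (Nat.log 2 P.N) 0 m) : MatchFlags P (MatchIn P a b) m := by
  have hname (i p : ℕ) (hp : p + 2 ^ (i + 1) ≤ P.N) :
      m (.queryName (2 ^ (i + 1)) p) = blockName a P.T (2 ^ (i + 1)) p b :=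
    H.name _ p hp (.inl (Nat.le_log_of_pow_le one_lt_two (by omega)))
  refine ⟨fun i p hp => ?_, fun i p r hp => ?_⟩
  · rw [hname i p hp]
    exact blockName_lt (by have := P.sum_lt_Z; omega) (hb p)
  · rw [hname i p hp, pow_succ, (H.preprocessed.block i p hp).flag]
    refine exists_congr fun t => and_congr_right fun ht => and_congr_right fun _ => ?_
    exact blockName_eq_iff ht (by have := Nat.two_pow_pos i; omega)

/-! ### The table of furthest positions -/

open Classical in
/-- The end of the longest block at `p` of one of the lengths `2, 4, …, 2 ^ i` that is good in
class `r`, or `p + 1` if there is none. -/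
noncomputable def jump (good : ℕ → ℕ → ℕ → Prop) (p r : ℕ) : ℕ → ℕ
  | 0 => p + 1
  | i + 1 => if good (2 ^ (i + 1)) p r then p + 2 ^ (i + 1) else jump good p r i

/-- The furthest position that is reached after `e` rounds in class `r`, where a round either jumps
in its class or moves to a neighbouring class. -/
noncomputable def furthest (good : ℕ → ℕ → ℕ → Prop) (N R : ℕ) : ℕ → ℕ → ℕ
  | 0, _ => 0
  | e + 1, r => if 1 ≤ r ∧ r ≤ R then
      max (max (jump good (furthest good N R e r) r (Nat.log 2 (N - furthest good N R e r)))
        (furthest good N R e (r - 1))) (furthest good N R e (r + 1)) else 0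

variable {good : ℕ → ℕ → ℕ → Prop} {N R : ℕ}

theorem jump_le (hi : i ≤ Nat.log 2 (N - p)) : jump good p r i ≤ max (p + 1) N := by
  induction i with
  | zero => exact le_max_left _ _
  | succ i ih =>
    rw [jump]
    split_ifs
    · have hne : N - p ≠ 0 := fun h => by simp [h] at hi
      have := Nat.pow_le_of_le_log hne hi
      omega
    · exact ih (by omega)

theorem furthest_le : furthest good N R e r ≤ N + e := by
  induction e generalizing r with
  | zero => exact Nat.zero_le _
  | succ e ih =>
    rw [furthest]
    split_ifs
    · have hjump :=
        jump_le (good := good) (r := r) (le_refl (Nat.log 2 (N - furthest good N R e r)))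
      have hstay := ih (r := r)
      have hleft := ih (r := r - 1)
      have hright := ih (r := r + 1)
      omega
    · exact Nat.zero_le _

theorem furthest_eq_zero (hr : r = 0 ∨ R < r) : furthest good N R e r = 0 := by
  cases e with
  | zero => rfl
  | succ e => rw [furthest, if_neg (by omega)]

/-- The memory while the table of furthest positions is computed: the rounds up to `e` are done, and
round `e + 1` for the classes below `r`. -/
structure FurthestTable (P : Params) (good : ℕ → ℕ → ℕ → Prop) (e r : ℕ) (m : Cell ℕ → ℕ) :
    Prop where
  flags : MatchFlags P good m
  entry : ∀ e' r', e' ≤ e ∨ e' = e + 1 ∧ r' < r ∨ r' = 0 ∨ P.R < r' →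
    m (.furthest e' r') = furthest good P.N P.R e' r'

namespace FurthestTable

theorem init (H : MatchFlags P good m) (hF : ∀ e r, m (.furthest e r) = 0) :
    FurthestTable P good 0 1 m where
  flags := H
  entry e' r' h := by
    rw [hF]
    obtain rfl | hr' : e' = 0 ∨ r' = 0 ∨ P.R < r' := by omega
    · rfl
    · rw [furthest_eq_zero hr']

theorem nextRound (H : FurthestTable P good e (P.R + 1) m) : FurthestTable P good (e + 1) 1 m where
  flags := H.flags
  entry e' r' h := H.entry e' r' (by omega)

theorem step (H : FurthestTable P good e r m) : FurthestTable P good e (r + 1)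
    (Function.update m (.furthest (e + 1) r) (furthest good P.N P.R (e + 1) r)) where
  flags := ⟨by simpa using H.flags.name_lt, by simpa using H.flags.flag⟩
  entry e' r' h := by
    by_cases hne : e' = e + 1 ∧ r' = r
    · rw [hne.1, hne.2, Function.update_self]
    · rw [Function.update_of_ne (by simpa using hne), H.entry e' r' (by omega)]

end FurthestTable

theorem runs_extendProg (hM : 2 ^ 14 * P.Z ^ 8 ≤ E.M) (hx : 0 < x) (hr : s.reg Reg.r = r)
    (hp : s.reg Reg.p = p) (hh : s.reg Reg.h = 2 ^ i) (hi : p + 2 ^ (i + 1) ≤ P.N) (hrR : r ≤ P.R)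
    (H : MatchFlags P good (cells s)) (hjump : s.reg Reg.x = jump good p r i) :
    Runs E extendProg s x fun s' =>
      cells s' = cells s ∧ s'.reg Reg.x = jump good p r (i + 1) := by
  have hMZ := P.Z_le hM
  have hZ := P.sum_lt_Z
  have hpow := pow_succ 2 i
  have hdouble : ((Reg.h : Expr) * 2).eval E s = 2 ^ (i + 1) := by
    rw [hpow]; exact eval_double hh (by omega) (by omega)
  have hname : (load (.queryName (Reg.h * 2) Reg.p)).eval E s =
      cells s (.queryName (2 ^ (i + 1)) p) :=
    eval_load_queryName hM hdouble hp (by omega) (by omega) rfl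
  have hflag : (load (.flag (Reg.h * 2) Reg.p (load (.queryName (Reg.h * 2) Reg.p)) Reg.r)).eval
      E s ≠ 0 ↔ good (2 ^ (i + 1)) p r := by
    rw [← H.flag i p r hi]
    exact not_congr (Eq.congr_left (eval_load_flag hM hdouble hp hname hr (by omega) (by omega)
      (H.name_lt i p hi) (by omega) rfl))
  refine Runs.apply rfl hx ?_
  simp only [extendProg, Prog.apply]
  split_ifs with h0
  · rw [jump, if_neg (mt hflag.2 (not_not.2 h0))]
    exact ⟨rfl, hjump⟩
  · rw [jump, if_pos (hflag.1 h0)]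
    refine ⟨rfl, ?_⟩
    simp (disch := omega) only [State.reg_setReg, if_true, Expr.eval_add, Expr.eval_reg, hp,
      hdouble, Nat.mod_eq_of_lt]

theorem runs_jumpProg (hM : 2 ^ 14 * P.Z ^ 8 ≤ E.M) (hx : 0 < x) (hs : P.Regs s)
    (hr : s.reg Reg.r = r) (hp : s.reg Reg.p = p) (hpN : p ≤ P.N + P.E) (hrR : r ≤ P.R)
    (H : MatchFlags P good (cells s)) :
    Runs E jumpProg s ((Nat.log 2 P.N + 1) * x) fun s' =>
      cells s' = cells s ∧ s'.reg Reg.x = jump good p r (Nat.log 2 (P.N - p)) := by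
  have hMZ := P.Z_le hM
  have hZ := P.sum_lt_Z
  have hlog : Nat.log 2 (P.N - p) ≤ Nat.log 2 P.N + 1 :=
    (Nat.log_mono_right (Nat.sub_le _ _)).trans (Nat.le_succ _)
  refine Runs.assign_seq (v := p + 1) (Nat.mul_pos (Nat.succ_pos _) hx) ?_ ?_
  · simp (disch := omega) only [Expr.eval_add, Expr.eval_reg, Expr.eval_ofNat, hp, Nat.mod_eq_of_lt]
  refine (Runs.doubling (E := E) (s := s.setReg Reg.x (p + 1)) (r := Reg.h)
    (I := fun i s' => cells s' = cells s ∧ s'.reg Reg.x = jump good p r i)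
    (v := p) (m := P.N) (lower := Reg.p) (upper := Reg.N) (p := extendProg) hx hlog
    (Nat.succ_pos _) (by decide) (by omega) (fun s' hs' => (hs' _ (by decide)).trans hp)
    (fun s' hs' => (hs' _ (by decide)).trans hs.N) ⟨rfl, by simp [jump, Reg.ctorIdx_inj]⟩
    fun i s' hi hs' hh ⟨hm, hjump⟩ => ?_).imp fun s' h => h.1
  refine (runs_extendProg hM hx ((hs' _ (by decide)).trans hr) ((hs' _ (by decide)).trans hp) hh hi
    hrR (hm ▸ H) hjump).imp fun s'' ⟨hm', hx'⟩ => ⟨hm'.trans hm, ?_⟩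
  rw [State.reg_setReg, if_neg (by decide), hx']

theorem runs_maxProg (hM : 2 ^ 14 * P.Z ^ 8 ≤ E.M) (hx : 0 < x) (hf : f.eval E s = e)
    (hg : g.eval E s = r) (he : e < P.Z) (hr : r < P.Z) (hv : cells s (.furthest e r) = v) :
    Runs E (maxProg (.furthest f g)) s x fun s' =>
      cells s' = cells s ∧ s'.reg Reg.x = max (s.reg Reg.x) v := by
  refine Runs.apply (p := .ite _ (.assign _ _) .skip) rfl hx ?_
  simp only [Prog.apply, Expr.eval_less_eq_zero, Expr.eval_reg,
    eval_load_furthest hM hf hg he hr hv]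
  split_ifs with h
  · exact ⟨rfl, (max_eq_left h).symm⟩
  · exact ⟨rfl, by rw [max_eq_right (not_le.1 h).le, State.reg_setReg, if_pos rfl]⟩

theorem runs_relaxProg (hM : 2 ^ 14 * P.Z ^ 8 ≤ E.M) (hx : 0 < x)
    (he : s.reg Reg.e = e) (hr : s.reg Reg.r = r) (heE : e < P.E) (hr0 : 1 ≤ r) (hrR : r ≤ P.R) :
    Runs E relaxProg s x fun s' => cells s' = Function.update (cells s) (.furthest (e + 1) r) (max
      (max (s.reg Reg.x) (cells s (.furthest e (r - 1)))) (cells s (.furthest e (r + 1)))) := by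
  have hMZ := P.Z_le hM
  have hZ := P.sum_lt_Z
  have hone {s' : State} : (1 : Expr).eval E s' = 1 :=
    (Nat.mod_eq_of_lt (by omega) : 1 % E.M = 1)
  have hsub : ((Reg.r : Expr) - 1).eval E s = r - 1 := by
    rw [Expr.eval_sub_of_le, hone, Expr.eval_reg, hr] <;> rw [Expr.eval_reg, hr]
    exacts [hone.trans_le hr0, by omega]
  have hadd {s' : State} {b : Reg} {v : ℕ} (hb : s'.reg b = v) (hv : v + 1 < P.Z) :
      ((b : Expr) + 1).eval E s' = v + 1 := by
    simp (disch := omega) only [Expr.eval_add, Expr.eval_reg, Expr.eval_ofNat, hb, Nat.mod_eq_of_lt]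
  refine (runs_maxProg (f := Reg.e) hM hx he hsub (by omega) (by omega) rfl).frame.seq
    fun s₁ ⟨⟨hm₁, hx₁⟩, hs₁⟩ => ?_
  have he₁ := (hs₁ _ (by decide)).trans he
  have hr₁ := (hs₁ _ (by decide)).trans hr
  refine (runs_maxProg (f := Reg.e) hM hx he₁ (hadd hr₁ (by omega)) (by omega) (by omega)
    (congrFun hm₁ _)).frame.seq fun s₂ ⟨⟨hm₂, hx₂⟩, hs₂⟩ => ?_
  have he₂ := (hs₂ _ (by decide)).trans he₁
  have hr₂ := (hs₂ _ (by decide)).trans hr₁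
  refine runs_store (c' := .furthest (e + 1) r) hM hx
    (congr (congrArg Cell.furthest (hadd he₂ (by omega))) hr₂) ⟨by omega, by omega⟩ rfl ?_
  rw [cells_setMem, hm₂, hm₁, Expr.eval_reg, hx₂, hx₁]

theorem runs_entryProg (hM : 2 ^ 14 * P.Z ^ 8 ≤ E.M) (hx : 0 < x) (hs : P.Regs s)
    (he : s.reg Reg.e = e) (hr : s.reg Reg.r = r) (heE : e < P.E) (hr0 : 1 ≤ r) (hrR : r ≤ P.R)
    (H : FurthestTable P good e r (cells s)) :
    Runs E entryProg s ((Nat.log 2 P.N + 1) * x) fun s' =>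
      FurthestTable P good e (r + 1) (cells s') := by
  have hZ := P.sum_lt_Z
  have hxlog : x ≤ (Nat.log 2 P.N + 1) * x := Nat.le_mul_of_pos_left _ (Nat.succ_pos _)
  have hF (r') : cells s (.furthest e r') = furthest good P.N P.R e r' :=
    H.entry e r' (.inl le_rfl)
  set F := furthest good P.N P.R e
  have hFle : F r ≤ P.N + e := furthest_le
  refine Runs.assign_seq (hx.trans_le hxlog)
    (eval_load_furthest hM he hr (by omega) (by omega) (hF r)) ?_
  have hp : State.AgreeOff [Reg.p.ctorIdx] s (s.setReg Reg.p (F r)) :=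
    State.AgreeOff.setReg (fun _ _ => rfl) (by simp)
  refine (runs_jumpProg (s := s.setReg Reg.p (F r)) (p := F r) hM hx (hs.of_agreeOff hp (by decide))
    ((hp _ (by decide)).trans hr) (by simp) (by omega) hrR H.flags).frame.seq
    fun s₁ ⟨⟨hm₁, hx₁⟩, hs₁⟩ => ?_
  refine ((runs_relaxProg hM hx ((hs₁ _ (by decide)).trans ((hp _ (by decide)).trans he))
    ((hs₁ _ (by decide)).trans ((hp _ (by decide)).trans hr)) heE hr0 hrR).le hxlog).imp
    fun s₂ hm₂ => ?_
  rw [hm₂, hm₁, hx₁, cells_setReg, hF, hF]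
  convert H.step using 2
  rw [furthest, if_pos ⟨hr0, hrR⟩]

theorem runs_tableProg (hM : 2 ^ 14 * P.Z ^ 8 ≤ E.M) (hx : 0 < x) (hs : P.Regs s)
    (H : FurthestTable P good 0 1 (cells s)) :
    Runs E tableProg s ((P.E + 1) * (P.R * ((Nat.log 2 P.N + 1) * x))) fun s' =>
      P.Regs s' ∧ FurthestTable P good P.E 1 (cells s') := by
  have hMZ := P.Z_le hM
  have hZ := P.sum_lt_Z
  have hlogx : 0 < (Nat.log 2 P.N + 1) * x := Nat.mul_pos (Nat.succ_pos _) hx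
  refine (Runs.forRange (E := E) (s := s) (r := Reg.e) (lower := 0) (upper := Reg.E)
    (p := .forRange Reg.r 1 (Reg.R + 1) entryProg)
    (I := fun e s' => FurthestTable P good e 1 (cells s'))
    (Nat.mul_pos (Nat.succ_pos _) hlogx) (by omega) (Nat.succ_pos _) (by decide)
    (Nat.zero_mod _) (Nat.zero_le _) (by omega)
    (fun s' hs' => (hs.of_agreeOff hs' (by decide)).E) H
    fun e s' _ he hs' hereg H => ?_).frame.imp fun s' h => ⟨hs.of_agreeOff h.2 (by decide), h.1⟩
  have hs' := hs.of_agreeOff hs' (by decide)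
  have hone : 1 % E.M = 1 := Nat.mod_eq_of_lt (by omega)
  refine (Runs.forRange (E := E) (s := s') (r := Reg.r) (lower := 1) (upper := Reg.R + 1)
    (p := entryProg) (I := fun r s' => FurthestTable P good e r (cells s'))
    hlogx (v := 1) (m := P.R + 1) (y := P.R) (by omega) (Nat.succ_pos _) (by decide)
    hone (Nat.succ_pos _) (by omega)
    (fun s₁ hs₁ => ?_) H
    fun r s₁ hr0 hr hs₁ hrreg H => ?_).imp fun s₁ H => H.nextRound
  · simp (disch := omega) only [Expr.eval_add, Expr.eval_reg, Expr.eval_ofNat,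
      (hs'.of_agreeOff hs₁ (by decide)).R, Nat.mod_eq_of_lt]
  · exact runs_entryProg hM hx (hs'.of_agreeOff hs₁ (by decide)) ((hs₁ _ (by decide)).trans hereg)
      hrreg he hr0 (by omega) H

/-- In some class the furthest position after the last round is the end of the strings. -/
def ReachesEnd (P : Params) (good : ℕ → ℕ → ℕ → Prop) : Prop :=
  ∃ r, 1 ≤ r ∧ r ≤ P.R ∧ P.N ≤ furthest good P.N P.R P.E r

open Classical in
theorem runs_answerProg (hM : 2 ^ 14 * P.Z ^ 8 ≤ E.M) (hx : 0 < x) (hs : P.Regs s)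
    (H : FurthestTable P good P.E 1 (cells s)) :
    Runs E answerProg s (P.R * x) fun s' => s'.reg 0 = if ReachesEnd P good then 1 else 0 := by
  have hMZ := P.Z_le hM
  have hZ := P.sum_lt_Z
  have hone {s' : State} : (1 : Expr).eval E s' = 1 :=
    (Nat.mod_eq_of_lt (by omega) : 1 % E.M = 1)
  set F := furthest good P.N P.R P.E
  refine Runs.assign_seq (Nat.mul_pos (Nat.succ_pos _) hx) (Nat.zero_mod _) ?_
  have hs₀ : P.Regs (s.setReg Reg.n 0) :=
    hs.of_agreeOff (.setReg (W := [Reg.n.ctorIdx]) (fun _ _ => rfl) (by simp)) (by decide)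
  refine (Runs.forRange (E := E) (s := s.setReg Reg.n 0) (r := Reg.r) (lower := 1)
    (upper := Reg.R + 1)
    (p := .ite ((load (.furthest Reg.E Reg.r)).less Reg.N) .skip (.assign Reg.n 1))
    (v := 1) (m := P.R + 1) (y := P.R)
    (I := fun r s' => cells s' = cells s ∧
      s'.reg Reg.n = if ∃ r', 1 ≤ r' ∧ r' < r ∧ P.N ≤ F r' then 1 else 0)
    hx (by omega) (Nat.succ_pos _) (by decide) hone (Nat.succ_pos _) (by omega)
    (fun s' hs' => ?_) ⟨rfl, (if_neg (by omega)).symm⟩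
    fun r s' hr0 hr hs' hreg ⟨hm, hn⟩ => Runs.apply rfl hx ?_).imp fun s' ⟨_, hn⟩ => ?_
  · simp (disch := omega) only [Expr.eval_add, Expr.eval_reg, Expr.eval_ofNat,
      (hs₀.of_agreeOff hs' (by decide)).R, Nat.mod_eq_of_lt]
  · have hs' := hs₀.of_agreeOff hs' (by decide)
    have hload : (load (.furthest Reg.E Reg.r)).eval E s' = F r :=
      eval_load_furthest hM hs'.E hreg (by omega) (by omega)
        ((congrFun hm _).trans (H.entry _ _ (.inl le_rfl)))
    simp only [Prog.apply, Expr.eval_less_eq_zero, hload, Expr.eval_reg, hs'.N]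
    have hsucc : (∃ r', 1 ≤ r' ∧ r' < r + 1 ∧ P.N ≤ F r') ↔
        (∃ r', 1 ≤ r' ∧ r' < r ∧ P.N ≤ F r') ∨ P.N ≤ F r := by
      simp only [Nat.lt_succ_iff_lt_or_eq, or_and_right, and_or_left, exists_or]
      simp [hr0]
    rw [if_congr hsucc rfl rfl]
    by_cases hF : P.N ≤ F r
    · rw [if_pos hF, if_pos (.inr hF)]
      exact ⟨hm, hone (s' := s')⟩
    · rw [if_neg hF, if_congr (or_iff_left hF) rfl rfl]
      exact ⟨hm, hn⟩
  · simp only [Nat.lt_succ_iff] at hn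
    exact hn

end DataStructure

section Programs

variable {E : Env} {s : State} {P : Params} {x : ℕ}

/-! ### Parameters from the input -/

/-- The parameters are those that the programs compute from the input `n`, `k`, `ℓ`. -/
structure Params.Fits (P : Params) (a n k ℓ : ℕ) : Prop where
  ℓ_pos : 0 < ℓ
  ℓ_le_k : ℓ ≤ k
  k_le_n : k ≤ n
  l_eq : P.l = 2 ^ Nat.log 2 ℓ
  N_eq : P.N = n / P.l
  K_eq : P.K = polylog a n * k
  E_eq : P.E = (Nat.log 2 n + 3) * (P.K + 1)
  n_lt_Z : n < P.Z
  pow_lt_Z : a + (Nat.log 2 n + 1) ^ a + polylog a n < P.Z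

variable {a n k ℓ σ : ℕ}

theorem runs_logProg (hℓ : ℓ ≤ n) (hn : 2 * n + 2 < E.M) (hsn : s.reg Reg.n = n)
    (hsℓ : s.reg Reg.ℓ = ℓ) :
    Runs E logProg s (Nat.log 2 n + 1) fun s' => s'.mem = s.mem ∧ s'.used = s.used ∧
      s'.reg Reg.L = Nat.log 2 n + 1 ∧ s'.reg Reg.l = 2 ^ Nat.log 2 ℓ := by
  have hone {s' : State} : (1 : Expr).eval E s' = 1 :=
    (Nat.mod_eq_of_lt (by omega) : 1 % E.M = 1)
  have hzero {s' : State} : (0 : Expr).eval E s' = 0 := Nat.zero_mod _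
  refine Runs.assign_seq (Nat.succ_pos _) hone ?_
  refine ((Runs.doubling (s := s.setReg Reg.L 1) (r := Reg.x)
    (lower := 0) (upper := Reg.n) (p := .assign Reg.L (Reg.L + 1)) (v := 0) (m := n)
    (y := Nat.log 2 n + 1)
    (I := fun i s' => s'.reg Reg.L = i + 1 ∧ s'.mem = s.mem ∧ s'.used = s.used)
    Nat.one_pos (Nat.le_succ _) (Nat.succ_pos _) (by decide) (by omega) (fun _ _ => hzero)
    (fun s' hs' => (hs' _ (by decide)).trans hsn) ⟨rfl, rfl, rfl⟩
    fun i s' hi _ _ ⟨hL, hm, hu⟩ =>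
      Runs.assign Nat.one_pos ⟨?_, hm, hu⟩).frame.le (mul_one _).le).seq
    fun s' ⟨⟨⟨hL, hm, hu⟩, _⟩, hs'⟩ => ?_
  · have : 2 ^ (i + 1) > i + 1 := Nat.lt_two_pow_self
    simp (disch := omega) [Reg.ctorIdx_inj, hL, Nat.mod_eq_of_lt]
  · refine (Runs.doubling (s := s') (r := Reg.l) (lower := 0)
      (upper := Reg.ℓ) (p := .skip) (v := 0) (m := ℓ)
      (I := fun _ s' => s'.reg Reg.L = Nat.log 2 n + 1 ∧ s'.mem = s.mem ∧ s'.used = s.used)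
      Nat.one_pos ((Nat.log_mono_right hℓ).trans (Nat.le_succ _)) (Nat.succ_pos _) (by decide)
      (by omega) (fun _ _ => hzero)
      (fun s'' hs'' => (hs'' _ (by decide)).trans ((hs' _ (by decide)).trans hsℓ))
      ⟨hL, hm, hu⟩ fun i s'' _ _ _ hI => Runs.apply rfl Nat.one_pos hI).mono (mul_one _).le
      fun s'' ⟨⟨hL, hm, hu⟩, hl⟩ => ⟨hm, hu, hL, hl⟩

theorem Params.Fits.runs_boundsProg (F : P.Fits a n k ℓ) (hM : 2 ^ 14 * P.Z ^ 8 ≤ E.M)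
    (hx : 0 < x) (hn : s.reg Reg.n = n) (hk : s.reg Reg.k = k) (hL : s.reg Reg.L = Nat.log 2 n + 1)
    (hl : s.reg Reg.l = P.l) :
    Runs E (boundsProg a) s x fun s' => P.Regs s' ∧ s'.mem = s.mem ∧ s'.used = s.used := by
  have hMZ := P.Z_le hM
  have hZ := P.sum_lt_Z
  have hT : P.T = 2 * P.K + 1 := rfl
  have hR : P.R < E.M := by omega
  have hK := F.K_eq
  have hpow := F.pow_lt_Z
  have hE := F.E_eq
  have hLE : Nat.log 2 n + 3 ≤ P.E := hE ▸ Nat.le_mul_of_pos_right _ (Nat.succ_pos _)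
  have hpolylog {s' : State} (h : s'.reg Reg.L = Nat.log 2 n + 1) :
      (Expr.const a * Expr.pow Reg.L a).eval E s' = polylog a n := by
    rw [Expr.eval_mul, Expr.eval_const, Expr.eval_pow_of_lt (e := Reg.L) h (Nat.succ_pos _)
      (by omega), Nat.mod_eq_of_lt (by omega : a < E.M)]
    exact Nat.mod_eq_of_lt (show polylog a n < E.M by omega)
  refine Runs.assign_seq (v := P.N) hx ?_ <| Runs.assign_seq (v := P.K) hx ?_ <|
    Runs.assign_seq (v := P.T) hx ?_ <| Runs.assign_seq (v := P.R) hx ?_ <|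
    Runs.assign (Q := fun s' => P.Regs s' ∧ s'.mem = s.mem ∧ s'.used = s.used) hx ?_
  · rw [Expr.eval_div, Expr.eval_reg, Expr.eval_reg, hn, hl, F.N_eq]
  · rw [Expr.eval_mul, hpolylog (by simp [Reg.ctorIdx_inj, hL]), Expr.eval_reg,
      State.reg_setReg, if_neg (by decide), hk, ← hK, Nat.mod_eq_of_lt (by omega)]
  · simp (disch := omega) only [Expr.eval_add, Expr.eval_mul, Expr.eval_reg, Expr.eval_ofNat,
      State.reg_setReg, if_true, Nat.mod_eq_of_lt, hT, mul_comm]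
  · simp (disch := omega) only [Expr.eval_add, Expr.eval_mul, Expr.eval_div, Expr.eval_reg,
      Expr.eval_ofNat, State.reg_setReg, Reg.ctorIdx_inj, reduceCtorEq, if_true, if_false, hl,
      Nat.mod_eq_of_lt, mul_comm P.K]
    exact Nat.mod_eq_of_lt hR
  · have hEeval : ((Reg.L + 2 : Expr) * (Reg.K + 1)).eval E ((((s.setReg Reg.N P.N).setReg Reg.K
        P.K).setReg Reg.T P.T).setReg Reg.R P.R) = P.E := by
      simp (disch := omega) only [Expr.eval_add, Expr.eval_mul, Expr.eval_reg, Expr.eval_ofNat,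
        State.reg_setReg, Reg.ctorIdx_inj, reduceCtorEq, if_true, if_false, hL,
        Nat.mod_eq_of_lt]
      change (Nat.log 2 n + 3) * (P.K + 1) % E.M = P.E
      rw [← hE, Nat.mod_eq_of_lt (by omega)]
    rw [hEeval]
    exact ⟨by constructor <;> simp [Reg.ctorIdx_inj, hl], rfl, rfl⟩

theorem Params.Fits.runs_setupProg (F : P.Fits a n k ℓ) (hM : 2 ^ 14 * P.Z ^ 8 ≤ E.M)
    (hs : s.reg = inputRegs n k ℓ σ) :
    Runs E (setupProg a) s (Nat.log 2 n + 1) fun s' =>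
      P.Regs s' ∧ s'.mem = s.mem ∧ s'.used = s.used := by
  have hMZ := P.Z_le hM
  have hn := F.n_lt_Z
  refine (runs_logProg (F.ℓ_le_k.trans F.k_le_n) (by omega) (congrFun hs _)
    (congrFun hs _)).frame.seq fun s' ⟨⟨hm, hu, hL, hl⟩, hs'⟩ => ?_
  refine (F.runs_boundsProg hM (Nat.succ_pos _) ((hs' _ (by decide)).trans (congrFun hs _))
    ((hs' _ (by decide)).trans (congrFun hs _)) hL (hl.trans F.l_eq.symm)).imp
    fun s'' ⟨hP, hm', hu'⟩ => ⟨hP, hm'.trans hm, hu'.trans hu⟩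

theorem polylog_le_pow {V : ℕ} (hV : 2 ≤ V) (hn : Nat.log 2 n + 1 ≤ V) :
    polylog a n ≤ V ^ (2 * a) := by
  rw [two_mul, pow_add]
  exact Nat.mul_le_mul (Nat.lt_two_pow_self.le.trans (Nat.pow_le_pow_left hV a))
    (Nat.pow_le_pow_left hn a)

theorem exists_params (hℓ : 0 < ℓ) (hℓk : ℓ ≤ k) (hkn : k ≤ n) : ∃ P : Params,
    P.Fits a n k ℓ ∧ σ < P.Z ∧ 2 ^ 14 * P.Z ^ 8 ≤ 2 ^ wordBits (16 * a + 70) n σ := by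
  set V := 2 ^ (Nat.log 2 n + Nat.log 2 σ + 1) with hV
  set K := polylog a n * k
  have hV2 : 2 ≤ V := Nat.le_self_pow (Nat.succ_ne_zero _) 2
  have hlt {m : ℕ} (hm : Nat.log 2 m ≤ Nat.log 2 n + Nat.log 2 σ) : m < V :=
    (Nat.lt_pow_succ_log_self one_lt_two m).trans_le
      (Nat.pow_le_pow_right two_pos (Nat.succ_le_succ hm))
  have hnV : n < V := hlt (Nat.le_add_right _ _)
  have hσV : σ < V := hlt (Nat.le_add_left _ _)
  have hLV : Nat.log 2 n + 1 ≤ V := (Nat.succ_le_succ (Nat.log_le_self 2 n)).trans hnV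
  set u := V ^ (2 * a + 2) with hu
  have hle {i : ℕ} (hi : i ≤ 2 * a + 2) : V ^ i ≤ u := Nat.pow_le_pow_right (by omega) hi
  have hVu : V ≤ u := Nat.le_self_pow (Nat.succ_ne_zero _) V
  have hau : a ≤ u := Nat.lt_two_pow_self.le.trans
    ((Nat.pow_le_pow_left hV2 a).trans (hle (by omega)))
  have hLau : (Nat.log 2 n + 1) ^ a ≤ u := (Nat.pow_le_pow_left hLV a).trans (hle (by omega))
  have hpoly : polylog a n ≤ u := (polylog_le_pow hV2 hLV).trans (hle (by omega))
  have hKV : K ≤ V ^ (2 * a + 1) := Nat.mul_le_mul (polylog_le_pow hV2 hLV) (by omega)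
  have hKu : K ≤ u := hKV.trans (hle (by omega))
  have hLKu : (Nat.log 2 n + 1) * K ≤ u := by
    rw [hu, pow_succ V (2 * a + 1), mul_comm]
    exact Nat.mul_le_mul hKV hLV
  have hZ : 32 * u ≤ V ^ (2 * a + 7) := by
    rw [show 2 * a + 7 = 5 + (2 * a + 2) by ring, pow_add V 5]
    exact Nat.mul_le_mul_right _ (Nat.pow_le_pow_left hV2 5)
  have hl : 0 < 2 ^ Nat.log 2 ℓ := Nat.two_pow_pos _
  have hlℓ : 2 ^ Nat.log 2 ℓ ≤ ℓ := Nat.pow_log_le_self 2 hℓ.ne'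
  have hE : (Nat.log 2 n + 3) * (K + 1) = (Nat.log 2 n + 1) * K + 2 * K + Nat.log 2 n + 3 := by
    ring
  have hN := Nat.div_le_self n (2 ^ Nat.log 2 ℓ)
  have hNl := Nat.div_mul_le_self n (2 ^ Nat.log 2 ℓ)
  have hR := Nat.div_le_self (2 * K) (2 ^ Nat.log 2 ℓ)
  refine ⟨⟨2 ^ Nat.log 2 ℓ, n / 2 ^ Nat.log 2 ℓ, K, (Nat.log 2 n + 3) * (K + 1), V ^ (2 * a + 7),
    hl, Nat.div_pos (by omega) hl, by omega, by omega⟩,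
    ⟨hℓ, hℓk, hkn, rfl, rfl, rfl, rfl, by dsimp only; omega, by dsimp only; omega⟩,
    by dsimp only; omega, ?_⟩
  rw [wordBits, mul_comm (16 * a + 70), pow_mul, ← hV, ← pow_mul,
    show 16 * a + 70 = 14 + (2 * a + 7) * 8 by ring, pow_add]
  exact Nat.mul_le_mul_right _ (Nat.pow_le_pow_left hV2 14)

/-! ### The two programs -/

theorem charAt_le (A : Fin n → Fin σ) (i : ℕ) : charAt A i ≤ σ := by
  unfold charAt
  split
  · exact (A _).2.le
  · exact le_rfl

/-- The character of `A` at the position `x + t - K`, where the extra symbol stands before the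
beginning of `A` as well: `0 ≤ t ≤ 2 * K` encodes the shift `t - K`. -/
def shiftedChar (A : Fin n → Fin σ) (K x t : ℕ) : ℕ :=
  if K ≤ x + t then charAt A (x + t - K) else σ

theorem shiftedChar_le (A : Fin n → Fin σ) (K x t : ℕ) : shiftedChar A K x t ≤ σ := by
  unfold shiftedChar
  split
  · exact charAt_le A _
  · exact le_rfl

theorem charAt_mod (A : Fin n → Fin σ) {K x t M : ℕ} (hx : x + t < M) (hK : K + n ≤ M) :
    charAt A ((x + t + M - K) % M) = shiftedChar A K x t := by
  unfold shiftedChar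
  split_ifs with h
  · rw [Nat.sub_add_comm h, Nat.add_mod_right, Nat.mod_eq_of_lt (by omega)]
  · rw [Nat.mod_eq_of_lt (by omega), charAt, dif_neg (by omega)]

/-- The position that is sampled in the leaf block `p` with the random words `ω`. -/
def samplePos (P : Params) {w : ℕ} (ω : ℕ → Fin (2 ^ w)) (p : ℕ) : ℕ :=
  p * P.l + (ω p : ℕ) % P.l

namespace Params.Fits

theorem N_mul_l_le (F : P.Fits a n k ℓ) : P.N * P.l ≤ n := F.N_eq ▸ Nat.div_mul_le_self _ _

theorem lt_N_mul_l_add (F : P.Fits a n k ℓ) : n < P.N * P.l + P.l :=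
  F.N_eq ▸ Nat.lt_div_mul_add P.l_pos

theorem log_N_le (F : P.Fits a n k ℓ) : Nat.log 2 P.N ≤ Nat.log 2 n :=
  Nat.log_mono_right (F.N_eq ▸ Nat.div_le_self _ _)

variable {w : ℕ}

theorem runs_preProg (F : P.Fits a n k ℓ) (hM : 2 ^ 14 * P.Z ^ 8 ≤ 2 ^ w) (hσ : σ < P.Z)
    (A : Fin n → Fin σ) (ω : ℕ → Fin (2 ^ w)) :
    Runs (preEnv w A ω) (preProg a) (preInit n k ℓ σ) ((Nat.log 2 n + 1) * (P.N * P.T)) fun s =>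
      Preprocessed P (fun p t => shiftedChar A P.K (samplePos P ω p) t) (samplePos P ω)
        (cells s) := by
  have hMZ : 2 ^ 14 * P.Z ≤ 2 ^ w := P.Z_le (E := preEnv w A ω) hM
  have hZ := P.sum_lt_Z
  have hn := F.n_lt_Z
  have hNl := F.N_mul_l_le
  have hT : P.T = 2 * P.K + 1 := rfl
  refine ((F.runs_setupProg (E := preEnv w A ω) hM rfl).le (Nat.le_mul_of_pos_right _
    (Nat.mul_pos P.N_pos (Nat.succ_pos _)))).seq fun s ⟨hs, hm, hu⟩ => ?_
  refine (runs_preProg_tables (E := preEnv w A ω) hM Nat.one_pos hs hu (fun c => congrFun hm _)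
    (fun p t => (shiftedChar_le A _ _ _).trans_lt hσ) (fun p _ => rfl)
    fun p hp t ht => ?_).mono ?_ fun s h => h.preprocessed
  · have hp' : samplePos P ω p < P.N * P.l :=
      (Nat.add_lt_add_left (Nat.mod_lt _ P.l_pos) _).trans_le
        ((Nat.succ_mul p P.l).symm.trans_le (Nat.mul_le_mul_right _ hp))
    exact charAt_mod A (show samplePos P ω p + t < 2 ^ w by omega) (show _ ≤ 2 ^ w by omega)
  · rw [mul_one]
    exact Nat.mul_le_mul_right _ (Nat.succ_le_succ F.log_N_le)

open Classical in
theorem runs_queryProg (F : P.Fits a n k ℓ) (hM : 2 ^ 14 * P.Z ^ 8 ≤ 2 ^ w) (hσ : σ < P.Z)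
    (A B : Fin n → Fin σ) {a' : ℕ → ℕ → ℕ} {q : ℕ → ℕ} {s : State}
    (H : Preprocessed P a' q (cells s)) :
    Runs (queryEnv w A B) (queryProg a) (queryInit n k ℓ σ s)
      ((Nat.log 2 n + 1) * (P.N + (P.E + 1) * P.R)) fun s' => s'.reg 0 =
        if ReachesEnd P (MatchIn P a' fun p => charAt B (q p)) then 1 else 0 := by
  have hb (p : ℕ) : charAt B (q p) < P.Z := (charAt_le B _).trans_lt hσ
  have hlog : Nat.log 2 P.N + 1 ≤ Nat.log 2 n + 1 := Nat.succ_le_succ F.log_N_le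
  have hN : P.N ≤ P.N + (P.E + 1) * P.R := Nat.le_add_right _ _
  have hER : (P.E + 1) * P.R ≤ P.N + (P.E + 1) * P.R := Nat.le_add_left _ _
  have hR : P.R ≤ (P.E + 1) * P.R := Nat.le_mul_of_pos_left _ (Nat.succ_pos _)
  have hL {y : ℕ} : y ≤ (Nat.log 2 n + 1) * y := Nat.le_mul_of_pos_left _ (Nat.succ_pos _)
  set E := queryEnv w A B
  refine ((F.runs_setupProg (E := E) hM rfl).le (Nat.le_mul_of_pos_right _
    (P.N_pos.trans_le hN))).seq fun s₁ ⟨hs₁, hm, _⟩ => ?_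
  have hcells : cells s₁ = cells s := congrArg (fun m (c : Cell ℕ) => m c.address) hm
  refine ((runs_readProg (E := E) hM Nat.one_pos hs₁ (hcells ▸ H) fun p _ => rfl).le
    ((mul_one _).trans_le (hN.trans hL))).seq fun s₂ ⟨hs₂, H₂⟩ => ?_
  refine ((runs_forBlocks (E := E) (I := QueryNames P a' q fun p => charAt B (q p))
    hM Nat.one_pos hs₂ (by decide) H₂ (fun i m _ H => H.nextLength)
    fun i p s' hp _ hh hpreg H => runs_lookupProg hM hb Nat.one_pos hh hpreg hp H).le
    (Nat.mul_le_mul hlog ((mul_one _).trans_le hN))).seq fun s₃ ⟨hs₃, H₃⟩ => ?_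
  refine ((runs_tableProg (E := E) hM Nat.one_pos hs₃
    (.init (H₃.matchFlags hb) H₃.preprocessed.furthest)).le ?_).seq fun s₄ ⟨hs₄, H₄⟩ => ?_
  · calc (P.E + 1) * (P.R * ((Nat.log 2 P.N + 1) * 1))
        = (Nat.log 2 P.N + 1) * ((P.E + 1) * P.R) := by ring
      _ ≤ _ := Nat.mul_le_mul hlog hER
  · exact (runs_answerProg (E := E) hM Nat.one_pos hs₄ H₄).le
      ((mul_one _).trans_le (hR.trans (hER.trans hL)))

end Params.Fits

end Programs

/-! ### Small edit distance -/

section Alignment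

variable {α : Type*} {xs ys u v : List α} {pos cost : ℕ → ℕ} {y : α} {d j : ℕ}

/-- An alignment of `xs` with `ys`: before position `x` of `ys` it has cost `cost x`, and it
continues at position `pos x` of `xs`. The shift changes by at most the change of the cost, and
characters match where the cost does not change. -/
structure IsAlignment (xs ys : List α) (pos cost : ℕ → ℕ) : Prop where
  pos_zero_le : pos 0 ≤ cost 0
  cost_le_succ : ∀ x, cost x ≤ cost (x + 1)
  pos_succ_le : ∀ x, pos (x + 1) + cost x ≤ pos x + 1 + cost (x + 1)
  le_pos_succ : ∀ x, pos x + 1 + cost x ≤ pos (x + 1) + cost (x + 1)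
  getElem?_eq : ∀ x, cost (x + 1) = cost x → xs[pos x]? = ys[x]?

namespace IsAlignment

theorem refl (xs : List α) : IsAlignment xs xs id 0 := by
  constructor <;> simp

theorem insert (H : IsAlignment xs (u ++ v) pos cost) (y : α) :
    IsAlignment xs (u ++ y :: v) (fun x => if x ≤ u.length then pos x else pos (x - 1))
      fun x => if x ≤ u.length then cost x else cost (x - 1) + 1 := by
  have h0 := H.pos_zero_le
  have h1 := H.cost_le_succ
  have h2 := H.pos_succ_le
  have h3 := H.le_pos_succ
  have h4 := H.getElem?_eq
  constructor <;> grind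

theorem delete (H : IsAlignment xs (u ++ y :: v) pos cost) :
    IsAlignment xs (u ++ v) (fun x => if x < u.length then pos x else pos (x + 1))
      fun x => if x < u.length then cost x else cost (x + 1) + 1 := by
  have h0 := H.pos_zero_le
  have h1 := H.cost_le_succ
  have h2 := H.pos_succ_le
  have h3 := H.le_pos_succ
  have h4 := H.getElem?_eq
  constructor <;> grind

theorem subst (H : IsAlignment xs (u ++ y :: v) pos cost) (z : α) :
    IsAlignment xs (u ++ z :: v) pos
      fun x => if x ≤ u.length then cost x else cost x + 1 := by
  have h0 := H.pos_zero_le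
  have h1 := H.cost_le_succ
  have h2 := H.pos_succ_le
  have h3 := H.le_pos_succ
  have h4 := H.getElem?_eq
  constructor <;> grind

theorem pos_add_le (H : IsAlignment xs ys pos cost) :
    pos (x + j) + cost x ≤ pos x + j + cost (x + j) := by
  induction j with
  | zero => exact le_rfl
  | succ j ih => have := add_assoc x j 1 ▸ H.pos_succ_le (x + j); omega

theorem le_pos_add (H : IsAlignment xs ys pos cost) :
    pos x + j + cost x ≤ pos (x + j) + cost (x + j) := by
  induction j with
  | zero => exact le_rfl
  | succ j ih => have := add_assoc x j 1 ▸ H.le_pos_succ (x + j); omega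

theorem cost_mono (H : IsAlignment xs ys pos cost) : Monotone cost :=
  monotone_nat_of_le_succ H.cost_le_succ

theorem pos_le (H : IsAlignment xs ys pos cost) (x : ℕ) : pos x ≤ x + cost x := by
  have h0 := H.pos_zero_le
  have hx := H.pos_add_le (x := 0) (j := x)
  rw [zero_add] at hx
  omega

theorem le_pos (H : IsAlignment xs ys pos cost) (x : ℕ) : x ≤ pos x + cost x := by
  have hx := H.le_pos_add (x := 0) (j := x)
  rw [zero_add] at hx
  omega

end IsAlignment

theorem exists_isAlignment (h : EditSeq xs ys d) :
    ∃ pos cost, IsAlignment xs ys pos cost ∧ ∀ x, cost x ≤ d := by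
  induction h with
  | refl => exact ⟨id, 0, .refl _, fun _ => le_rfl⟩
  | step _ hs ih =>
    obtain ⟨pos, cost, H, hd⟩ := ih
    cases hs with
    | insert u v y => exact ⟨_, _, H.insert y, by grind⟩
    | delete u v y => exact ⟨_, _, H.delete, by grind⟩
    | subst u v y z => exact ⟨_, _, H.subst z, by grind⟩

end Alignment

section Furthest

variable {good : ℕ → ℕ → ℕ → Prop} {N R e r r' j δ : ℕ}

theorem succ_le_jump : p + 1 ≤ jump good p r i := by
  induction i with
  | zero => exact le_rfl
  | succ i ih =>
    rw [jump]
    split_ifs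
    · exact Nat.add_le_add_left Nat.one_le_two_pow _
    · exact ih

theorem le_jump_of_good (hj : j ≤ i) (h : good (2 ^ j) p r) : p + 2 ^ j ≤ jump good p r i := by
  induction i with
  | zero => rw [Nat.le_zero.1 hj]; exact le_rfl
  | succ i ih =>
    rw [jump]
    split_ifs with hi
    · exact Nat.add_le_add_left (Nat.pow_le_pow_right two_pos hj) _
    · exact ih (Nat.le_of_lt_succ (hj.lt_of_ne fun hji => hi (hji ▸ h)))

theorem furthest_succ (h1 : 1 ≤ r) (hR : r ≤ R) : furthest good N R (e + 1) r =
    max (max (jump good (furthest good N R e r) r (Nat.log 2 (N - furthest good N R e r)))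
      (furthest good N R e (r - 1))) (furthest good N R e (r + 1)) := by
  rw [furthest, if_pos ⟨h1, hR⟩]

theorem jump_le_furthest (h1 : 1 ≤ r) (hR : r ≤ R) :
    jump good (furthest good N R e r) r (Nat.log 2 (N - furthest good N R e r)) ≤
      furthest good N R (e + 1) r := by
  rw [furthest_succ h1 hR, max_assoc]
  exact le_max_left _ _

theorem furthest_lt_succ (h1 : 1 ≤ r) (hR : r ≤ R) :
    furthest good N R e r < furthest good N R (e + 1) r :=
  succ_le_jump.trans (jump_le_furthest h1 hR)

theorem furthest_mono (h1 : 1 ≤ r) (hR : r ≤ R) : Monotone (furthest good N R · r) :=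
  monotone_nat_of_le_succ fun _ => (furthest_lt_succ h1 hR).le

theorem furthest_move (h1 : 1 ≤ r') (hR : r' ≤ R) (h : r ≤ r' + δ) (h' : r' ≤ r + δ) :
    furthest good N R e r ≤ furthest good N R (e + δ) r' := by
  induction δ generalizing r' with
  | zero => rw [le_antisymm h h']; exact le_rfl
  | succ δ ih =>
    rcases lt_trichotomy r r' with hlt | rfl | hgt
    · rw [← add_assoc, furthest_succ h1 hR]
      rcases eq_or_ne r' 1 with rfl | hne
      · rw [furthest_eq_zero (.inl (Nat.lt_one_iff.1 hlt))]
        exact Nat.zero_le _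
      · exact (ih (by omega) (by omega) (by omega) (by omega)).trans
          ((le_max_right _ _).trans (le_max_left _ _))
    · exact furthest_mono h1 hR (Nat.le_add_right _ _)
    · rw [← add_assoc, furthest_succ h1 hR]
      by_cases hrR : r ≤ R
      · exact (ih (by omega) (by omega) (by omega) (by omega)).trans (le_max_right _ _)
      · rw [furthest_eq_zero (.inr (not_le.1 hrR))]
        exact Nat.zero_le _

theorem sub_furthest_succ_le (h1 : 1 ≤ r) (hR : r ≤ R) (hi : i ≤ N)
    (hgood : ∀ h, furthest good N R e r + h ≤ i → good h (furthest good N R e r) r) :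
    i - furthest good N R (e + 1) r ≤ (i - furthest good N R e r) / 2 := by
  have hjump := jump_le_furthest (good := good) (N := N) (e := e) h1 hR
  have hlt := furthest_lt_succ (good := good) (N := N) (e := e) h1 hR
  set p := furthest good N R e r
  rcases Nat.lt_or_ge p i with hpi | hpi
  · have hpow := Nat.pow_log_le_self 2 (Nat.sub_ne_zero_of_lt hpi)
    have hlog := Nat.lt_pow_succ_log_self one_lt_two (i - p)
    have := (le_jump_of_good (Nat.log_mono_right (Nat.sub_le_sub_right hi p))
      (hgood (2 ^ Nat.log 2 (i - p)) (by omega))).trans hjump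
    omega
  · omega

theorem le_furthest_of_good {i₀ u : ℕ} (h1 : 1 ≤ r) (hR : r ≤ R) (hi : i ≤ N)
    (hgood : ∀ p h, i₀ ≤ p → p + h ≤ i → good h p r) (h0 : i₀ ≤ furthest good N R e r)
    (hu : i - furthest good N R e r < 2 ^ u) : i ≤ furthest good N R (e + u) r := by
  induction u generalizing e with
  | zero => exact Nat.sub_eq_zero_iff_le.1 (Nat.lt_one_iff.1 hu)
  | succ u ih =>
    have hhalf := sub_furthest_succ_le h1 hR hi fun h => hgood _ h h0
    rw [pow_succ] at hu
    rw [add_comm u, ← add_assoc]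
    exact ih (h0.trans (furthest_lt_succ h1 hR).le) (by omega)

end Furthest

section BlockAlignment

variable {a : ℕ → ℕ → ℕ} {b sh c : ℕ → ℕ} {L : ℕ}

/-- An alignment of the sampled characters `a` and `b` block by block: the block `i` has the shift
`sh i`, and the cost before it is `c i`. -/
structure BlockAlignment (P : Params) (a : ℕ → ℕ → ℕ) (b sh c : ℕ → ℕ) : Prop where
  cost_mono : Monotone c
  cost_le : ∀ i, c i ≤ P.K
  shift_lt : ∀ i, sh i < P.T
  shift_succ_le : ∀ i, sh (i + 1) + c i ≤ sh i + c (i + 1)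
  le_shift_succ : ∀ i, sh i + c i ≤ sh (i + 1) + c (i + 1)
  eq_of_cost_eq : ∀ i, c (i + 1) = c i → a i (sh i) = b i

namespace BlockAlignment

variable {i₀ : ℕ}

theorem shift_eq (H : BlockAlignment P a b sh c) (hi : i₀ ≤ i) (hc : c i₀ = c i) :
    sh i₀ = sh i := by
  induction i, hi using Nat.le_induction with
  | base => rfl
  | succ i hi ih =>
    have h1 := H.cost_mono hi
    have h2 := H.cost_mono (Nat.le_add_right i 1)
    have h3 := H.shift_succ_le i
    have h4 := H.le_shift_succ i
    rw [ih (by omega)]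
    omega

theorem matchIn (H : BlockAlignment P a b sh c) (hc : c i₀ = c i) (hp : i₀ ≤ p)
    (hph : p + h ≤ i) : MatchIn P a b h p (sh i / P.l + 1) := by
  refine ⟨sh i, H.shift_lt i, rfl, fun x hx hxh => ?_⟩
  have h1 := H.cost_mono (hp.trans hx)
  have h2 := H.cost_mono (Nat.le_add_right x 1)
  have h3 := H.cost_mono (show x + 1 ≤ i by omega)
  rw [← H.shift_eq (show x ≤ i by omega) (by omega)]
  exact H.eq_of_cost_eq x (by omega)

theorem le_furthest_add (H : BlockAlignment P a b sh c) (hL : P.N < 2 ^ L) (hi : i ≤ P.N)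
    {e : ℕ} (hc : c i₀ = c i)
    (h0 : i₀ ≤ furthest (MatchIn P a b) P.N P.R e (sh i / P.l + 1)) :
    i ≤ furthest (MatchIn P a b) P.N P.R (e + L) (sh i / P.l + 1) :=
  le_furthest_of_good (Nat.le_add_left _ _) (P.class_le (H.shift_lt i)) hi
    (fun _ _ => H.matchIn hc) h0 (by omega)

theorem class_succ_le (H : BlockAlignment P a b sh c) (i : ℕ) :
    sh i / P.l + 1 ≤ sh (i + 1) / P.l + 1 + (c (i + 1) - c i) ∧
      sh (i + 1) / P.l + 1 ≤ sh i / P.l + 1 + (c (i + 1) - c i) := by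
  have hc := H.cost_mono (Nat.le_add_right i 1)
  have hdiv {x y δ : ℕ} (hxy : x ≤ y + δ) : x / P.l + 1 ≤ y / P.l + 1 + δ := by
    rw [add_right_comm, ← Nat.add_mul_div_right y δ P.l_pos]
    exact Nat.succ_le_succ (Nat.div_le_div_right (hxy.trans
      (Nat.add_le_add_left (Nat.le_mul_of_pos_right _ P.l_pos) _)))
  have h1 := H.shift_succ_le i
  have h2 := H.le_shift_succ i
  exact ⟨hdiv (by omega), hdiv (by omega)⟩

theorem exists_le_furthest (H : BlockAlignment P a b sh c) (hL : P.N < 2 ^ L) (hi : i ≤ P.N) :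
    ∃ i₀, c i₀ = c i ∧
      i₀ ≤ furthest (MatchIn P a b) P.N P.R ((L + 2) * c i) (sh i / P.l + 1) := by
  induction i with
  | zero => exact ⟨0, rfl, Nat.zero_le _⟩
  | succ i ih =>
    obtain ⟨i₀, hi₀, h0⟩ := ih (Nat.le_of_succ_le hi)
    rcases (H.cost_mono (Nat.le_add_right i 1)).eq_or_lt with heq | hlt
    · exact ⟨i₀, hi₀.trans heq, by rwa [← heq, ← H.shift_eq (Nat.le_add_right i 1) heq]⟩
    · refine ⟨i + 1, rfl, ?_⟩
      have hclass (i : ℕ) : sh i / P.l + 1 ≤ P.R := P.class_le (H.shift_lt i)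
      obtain ⟨h1, h2⟩ := H.class_succ_le i
      calc i + 1 ≤ furthest (MatchIn P a b) P.N P.R ((L + 2) * c i + L + 1) (sh i / P.l + 1) :=
            (H.le_furthest_add hL (Nat.le_of_succ_le hi) hi₀ h0).trans_lt
              (furthest_lt_succ (Nat.le_add_left _ _) (hclass i))
        _ ≤ _ := furthest_move (Nat.le_add_left _ _) (hclass (i + 1)) h1 h2
        _ ≤ _ := furthest_mono (Nat.le_add_left _ _) (hclass (i + 1)) <| by
          obtain ⟨δ, hδ⟩ := Nat.exists_eq_add_of_lt hlt
          rw [hδ, mul_add, mul_add, show c i + δ + 1 - c i = δ + 1 by omega]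
          nlinarith

theorem reachesEnd (H : BlockAlignment P a b sh c) (hL : P.N < 2 ^ L)
    (hE : P.E = (L + 2) * (P.K + 1)) : ReachesEnd P (MatchIn P a b) := by
  obtain ⟨i₀, hc, h0⟩ := H.exists_le_furthest hL le_rfl
  have hclass : sh P.N / P.l + 1 ≤ P.R := P.class_le (H.shift_lt P.N)
  refine ⟨_, Nat.le_add_left _ _, hclass, (H.le_furthest_add hL le_rfl hc h0).trans
    (furthest_mono (Nat.le_add_left _ _) hclass ?_)⟩
  calc (L + 2) * c P.N + L ≤ (L + 2) * P.K + (L + 2) :=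
        Nat.add_le_add (Nat.mul_le_mul_left _ (H.cost_le _)) (Nat.le_add_right _ _)
    _ = P.E := by rw [hE, Nat.mul_succ]

end BlockAlignment

variable {A B : Fin n → Fin σ} {q pos cost : ℕ → ℕ} {d : ℕ}

theorem charAt_eq_of_getElem? {x y : ℕ} (h : (List.ofFn A)[x]? = (List.ofFn B)[y]?) :
    charAt A x = charAt B y := by
  simp only [List.getElem?_ofFn] at h
  unfold charAt
  split_ifs at h ⊢ <;> simp_all

theorem IsAlignment.blockAlignment (H : IsAlignment (List.ofFn A) (List.ofFn B) pos cost)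
    (hK : ∀ x, cost x ≤ P.K) (hq : ∀ p, p * P.l ≤ q p ∧ q p < p * P.l + P.l) :
    BlockAlignment P (fun p t => shiftedChar A P.K (q p) t) (fun p => charAt B (q p))
      (fun i => pos (i * P.l) + P.K - i * P.l) fun i => cost (i * P.l) where
  cost_mono := H.cost_mono.comp (monotone_mul_right_of_nonneg (Nat.zero_le _))
  cost_le i := hK _
  shift_lt i := by
    have h1 := H.pos_le (i * P.l)
    have h2 := hK (i * P.l)
    change _ < 2 * P.K + 1
    omega
  shift_succ_le i := by
    have h1 := H.pos_add_le (x := i * P.l) (j := P.l)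
    have h2 := H.le_pos (i * P.l)
    have h3 := hK (i * P.l)
    have h4 := H.cost_mono (Nat.le_add_right (i * P.l) P.l)
    rw [Nat.succ_mul]
    omega
  le_shift_succ i := by
    have h1 := H.le_pos_add (x := i * P.l) (j := P.l)
    have h2 := H.le_pos (i * P.l + P.l)
    have h3 := hK (i * P.l + P.l)
    have h4 := H.cost_mono (Nat.le_add_right (i * P.l) P.l)
    rw [Nat.succ_mul]
    omega
  eq_of_cost_eq i hc := by
    obtain ⟨j, hj⟩ := Nat.exists_eq_add_of_le (hq i).1
    have hjl := (hq i).2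
    rw [Nat.succ_mul] at hc
    have h1 := H.cost_mono (Nat.le_add_right (i * P.l) j)
    have h2 := H.cost_mono (Nat.le_add_right (i * P.l + j) 1)
    have h3 := H.cost_mono (show i * P.l + j + 1 ≤ i * P.l + P.l by omega)
    have h4 := H.pos_add_le (x := i * P.l) (j := j)
    have h5 := H.le_pos_add (x := i * P.l) (j := j)
    have h6 := H.le_pos (i * P.l)
    have h7 := hK (i * P.l)
    rw [hj, shiftedChar, if_pos (by omega), show i * P.l + j + (pos (i * P.l) + P.K - i * P.l) -
      P.K = pos (i * P.l + j) by omega]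
    exact charAt_eq_of_getElem? (H.getElem?_eq _ (by omega))

theorem reachesEnd_of_editSeq {L : ℕ} (hL : P.N < 2 ^ L) (hE : P.E = (L + 2) * (P.K + 1))
    (hq : ∀ p, p * P.l ≤ q p ∧ q p < p * P.l + P.l)
    (h : EditSeq (List.ofFn A) (List.ofFn B) d) (hd : d ≤ P.K) : ReachesEnd P
      (MatchIn P (fun p t => shiftedChar A P.K (q p) t) fun p => charAt B (q p)) := by
  obtain ⟨pos, cost, H, hcost⟩ := exists_isAlignment h
  exact (H.blockAlignment (fun x => (hcost x).trans hd) hq).reachesEnd hL hE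

end BlockAlignment

end GapEditDistance

section EditWithin

variable {α : Type*} {xs ys zs : List α} {d e : ℕ}

theorem EditStep.symm (h : EditStep xs ys) : EditStep ys xs := by
  cases h with
  | insert u v c => exact .delete u v c
  | delete u v c => exact .insert u v c
  | subst u v c c' => exact .subst u v c' c

theorem EditStep.append_right (h : EditStep xs ys) (ws : List α) :
    EditStep (xs ++ ws) (ys ++ ws) := by
  cases h with
  | insert u v c => simpa using EditStep.insert u (v ++ ws) c
  | delete u v c => simpa using EditStep.delete u (v ++ ws) c
  | subst u v c c' => simpa using EditStep.subst u (v ++ ws) c c'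

theorem EditSeq.trans (h : EditSeq xs ys d) (h' : EditSeq ys zs e) : EditSeq xs zs (d + e) := by
  induction h' with
  | refl => exact h
  | step _ hs ih => exact .step ih hs

theorem EditSeq.symm (h : EditSeq xs ys d) : EditSeq ys xs d := by
  induction h with
  | refl => exact .refl _
  | @step _ _ d _ hs ih => exact add_comm 1 d ▸ (EditSeq.step (.refl _) hs.symm).trans ih

theorem EditSeq.append_right (h : EditSeq xs ys d) (ws : List α) :
    EditSeq (xs ++ ws) (ys ++ ws) d := by
  induction h with
  | refl => exact .refl _
  | step _ hs ih => exact .step ih (hs.append_right ws)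

/-- At most `d` edits turn `xs` into `ys`. -/
def EditWithin (xs ys : List α) (d : ℕ) : Prop :=
  ∃ e ≤ d, EditSeq xs ys e

namespace EditWithin

theorem refl (xs : List α) : EditWithin xs xs 0 :=
  ⟨0, le_rfl, .refl xs⟩

theorem of_editStep (h : EditStep xs ys) : EditWithin xs ys 1 :=
  ⟨1, le_rfl, .step (.refl xs) h⟩

theorem mono (h : EditWithin xs ys d) (hde : d ≤ e) : EditWithin xs ys e :=
  h.imp fun _ h => ⟨h.1.trans hde, h.2⟩

theorem symm (h : EditWithin xs ys d) : EditWithin ys xs d :=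
  h.imp fun _ h => ⟨h.1, h.2.symm⟩

theorem trans (h : EditWithin xs ys d) (h' : EditWithin ys zs e) : EditWithin xs zs (d + e) := by
  obtain ⟨d', hd, h⟩ := h
  obtain ⟨e', he, h'⟩ := h'
  exact ⟨d' + e', Nat.add_le_add hd he, h.trans h'⟩

theorem append_right (h : EditWithin xs ys d) (ws : List α) :
    EditWithin (xs ++ ws) (ys ++ ws) d :=
  h.imp fun _ h => ⟨h.1, h.2.append_right ws⟩

theorem toList (xs : List α) (o o' : Option α) :
    EditWithin (xs ++ o.toList) (xs ++ o'.toList) 1 := by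
  rcases o with _ | c <;> rcases o' with _ | c'
  · exact (refl _).mono (Nat.zero_le _)
  · simpa using of_editStep (EditStep.insert xs [] c')
  · simpa using of_editStep (EditStep.delete xs [] c)
  · exact of_editStep (EditStep.subst xs [] c c')

theorem take (xs : List α) {x y δ : ℕ} (hx : x ≤ y + δ) (hy : y ≤ x + δ) :
    EditWithin (xs.take x) (xs.take y) δ := by
  wlog hxy : x ≤ y generalizing x y
  · exact (this hy hx (le_of_not_ge hxy)).symm
  obtain ⟨k, rfl⟩ := Nat.exists_eq_add_of_le hxy
  refine mono ?_ (Nat.le_of_add_le_add_left hy)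
  clear hx hy hxy
  induction k with
  | zero => exact refl _
  | succ k ih =>
    have hstep := toList (xs.take (x + k)) none xs[x + k]?
    rw [Option.toList_none, List.append_nil, ← List.take_add_one] at hstep
    exact ih.trans hstep

end EditWithin

end EditWithin

namespace GapEditDistance

section Soundness

variable {n σ : ℕ} {A B : Fin n → Fin σ}

theorem exists_editSeq (A B : Fin n → Fin σ) :
    EditSeq (List.ofFn A) (List.ofFn B) (editDist A B) := by
  have hnil (A : Fin n → Fin σ) : EditWithin (List.ofFn A) [] n := by
    have h := EditWithin.take (List.ofFn A) (n.le_add_left 0) (n.zero_le.trans (n.le_add_right n))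
    rwa [List.take_of_length_le (by simp), List.take_zero] at h
  obtain ⟨d, -, h⟩ := (hnil A).trans (hnil B).symm
  exact Nat.sInf_mem ⟨d, h⟩

theorem editDist_le_of_editWithin {x y d : ℕ}
    (h : EditWithin ((List.ofFn A).take x) ((List.ofFn B).take y) d) (hx : n ≤ x) (hy : n ≤ y) :
    editDist A B ≤ d := by
  obtain ⟨e, he, h⟩ := h
  rw [List.take_of_length_le (by simpa using hx), List.take_of_length_le (by simpa using hy)] at h
  exact (Nat.sInf_le h).trans he

theorem getElem?_eq_of_charAt_eq {x y : ℕ} (h : charAt A x = charAt B y) :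
    (List.ofFn A)[x]? = (List.ofFn B)[y]? := by
  simp only [List.getElem?_ofFn]
  unfold charAt at h
  split_ifs at h ⊢ with hx hy hy
  · rw [Fin.ext h]
  · exact absurd h (A ⟨x, hx⟩).isLt.ne
  · exact absurd h.symm (B ⟨y, hy⟩).isLt.ne
  · rfl

theorem editWithin_take_succ {K x t d : ℕ}
    (h : EditWithin ((List.ofFn A).take (x + t - K)) ((List.ofFn B).take x) d)
    (hc : shiftedChar A K x t = charAt B x) :
    EditWithin ((List.ofFn A).take (x + 1 + t - K)) ((List.ofFn B).take (x + 1)) d := by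
  unfold shiftedChar at hc
  split_ifs at hc with hK
  · rw [show x + 1 + t - K = x + t - K + 1 by omega, List.take_add_one, List.take_add_one,
      getElem?_eq_of_charAt_eq hc]
    exact h.append_right _
  · have hx : n ≤ x := by
      by_contra! hx
      rw [charAt, dif_pos hx] at hc
      exact absurd hc.symm (B ⟨x, hx⟩).isLt.ne
    have hB (y : ℕ) (hy : n ≤ y) : (List.ofFn B).take y = List.ofFn B :=
      List.take_of_length_le (by simpa using hy)
    rwa [show x + 1 + t - K = x + t - K by omega, hB _ (hx.trans (Nat.le_add_right x 1)), ← hB x hx]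

theorem editWithin_take_succ_of_ne {K x t d : ℕ}
    (h : EditWithin ((List.ofFn A).take (x + t - K)) ((List.ofFn B).take x) d) :
    EditWithin ((List.ofFn A).take (x + 1 + t - K)) ((List.ofFn B).take (x + 1)) (d + 1) := by
  rw [List.take_add_one]
  have happ := h.append_right (List.ofFn B)[x]?.toList
  by_cases hK : K ≤ x + t
  · rw [show x + 1 + t - K = x + t - K + 1 by omega, List.take_add_one, add_comm d]
    exact (EditWithin.toList _ _ _).trans happ
  · have hstep := EditWithin.toList ((List.ofFn A).take (x + t - K)) none (List.ofFn B)[x]?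
    rw [Option.toList_none, List.append_nil] at hstep
    rw [show x + 1 + t - K = x + t - K by omega, add_comm d]
    exact hstep.trans happ

theorem editWithin_take_add {K x t d : ℕ}
    (h : EditWithin ((List.ofFn A).take (x + t - K)) ((List.ofFn B).take x) d) (m : ℕ) :
    EditWithin ((List.ofFn A).take (x + m + t - K)) ((List.ofFn B).take (x + m))
      (d + Nat.count (fun z => shiftedChar A K (x + z) t ≠ charAt B (x + z)) m) := by
  induction m with
  | zero => exact h
  | succ m ih =>
    rw [Nat.count_succ, ← add_assoc, ← add_assoc]
    split_ifs with hc
    · exact editWithin_take_succ_of_ne ih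
    · exact editWithin_take_succ ih (not_not.1 hc)

/-- The number of characters in the `h` leaf blocks of `B` from the `p`-th on that differ from the
character of `A` on the diagonal with shift `t`. -/
def mismatches (P : Params) (A B : Fin n → Fin σ) (p h t : ℕ) : ℕ :=
  Nat.count (fun z => shiftedChar A P.K (p * P.l + z) t ≠ charAt B (p * P.l + z)) (h * P.l)

/-- The positions `q`, one in every leaf block, expose each run of leaf blocks with more than
`H * P.l` mismatches. -/
def Detecting (P : Params) (A B : Fin n → Fin σ) (H : ℕ) (q : ℕ → ℕ) : Prop :=
  ∀ p h t, p + h ≤ P.N → t < P.T →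
    (∀ i, p ≤ i → i < p + h → shiftedChar A P.K (q i) t = charAt B (q i)) →
      mismatches P A B p h t ≤ H * P.l

/-- At most `d` edits turn the prefix of `A` that ends on the first diagonal of the shift class `r`
into the first `p` leaf blocks of `B`. -/
def PrefixWithin (P : Params) (A B : Fin n → Fin σ) (p r d : ℕ) : Prop :=
  EditWithin ((List.ofFn A).take (p * P.l + (r - 1) * P.l - P.K)) ((List.ofFn B).take (p * P.l)) d

variable {P : Params} {H p r r' t d : ℕ} {q : ℕ → ℕ}

namespace PrefixWithin

theorem zero (hr : r ≤ P.R + 1) : PrefixWithin P A B 0 r (P.K + P.l) := by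
  have hrl : (r - 1) * P.l ≤ 2 * P.K + P.l := by
    refine (Nat.mul_le_mul_right _ (Nat.sub_le_of_le_add hr)).trans ?_
    rw [Params.R, Nat.succ_mul]
    exact Nat.add_le_add_right (Nat.div_mul_le_self _ _) _
  unfold PrefixWithin
  rw [zero_mul, List.take_zero, ← List.take_zero (l := List.ofFn A)]
  exact .take _ (by omega) (Nat.zero_le _)

theorem class_move (hp : PrefixWithin P A B p r d) (hr : r ≤ r' + 1) (hr' : r' ≤ r + 1) :
    PrefixWithin P A B p r' (d + P.l) := by
  have h1 : (r - 1) * P.l ≤ (r' - 1) * P.l + P.l := by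
    rw [← Nat.succ_mul]
    exact Nat.mul_le_mul_right _ (by omega)
  have h2 : (r' - 1) * P.l ≤ (r - 1) * P.l + P.l := by
    rw [← Nat.succ_mul]
    exact Nat.mul_le_mul_right _ (by omega)
  exact add_comm d P.l ▸ (EditWithin.take _ (by omega) (by omega)).trans hp

theorem succ (hp : PrefixWithin P A B p r d) : PrefixWithin P A B (p + 1) r (d + P.l) := by
  have hadd := editWithin_take_add hp P.l
  rw [← Nat.succ_mul] at hadd
  exact hadd.mono (Nat.add_le_add_left (Nat.count_le _) _)

theorem add (hp : PrefixWithin P A B p r d) (ht : t / P.l + 1 = r) (h : ℕ) :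
    PrefixWithin P A B (p + h) r (d + mismatches P A B p h t + 2 * P.l) := by
  obtain rfl := ht
  have h1 := Nat.div_add_mod' t P.l
  have h2 := Nat.mod_lt t P.l_pos
  unfold PrefixWithin at hp ⊢
  rw [Nat.add_sub_cancel] at hp ⊢
  have hmove : EditWithin ((List.ofFn A).take (p * P.l + t - P.K)) ((List.ofFn B).take (p * P.l))
      (P.l + d) := (EditWithin.take _ (by omega) (by omega)).trans hp
  have hadd := editWithin_take_add hmove (h * P.l)
  rw [← add_mul] at hadd
  refine ((EditWithin.take _ (δ := P.l) (by omega) (by omega)).trans hadd).mono ?_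
  change P.l + (P.l + d + mismatches P A B p h t) ≤ _
  omega

theorem editDist_le (hp : PrefixWithin P A B p r d) (hN : n ≤ p * P.l + P.l) :
    editDist A B ≤ P.K + 2 * P.l + d := by
  have hB : EditWithin ((List.ofFn B).take (p * P.l)) ((List.ofFn B).take (p * P.l + P.l)) P.l :=
    .take _ (by omega) le_rfl
  have hA : EditWithin ((List.ofFn A).take (p * P.l + (r - 1) * P.l - P.K + (P.K + P.l)))
      ((List.ofFn A).take (p * P.l + (r - 1) * P.l - P.K)) (P.K + P.l) :=
    .take _ le_rfl (by omega)
  refine (editDist_le_of_editWithin ((hA.trans hp).trans hB) (by omega) hN).trans_eq ?_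
  ring

end PrefixWithin

theorem jump_eq_or (good : ℕ → ℕ → ℕ → Prop) (p r i : ℕ) : jump good p r i = p + 1 ∨
    ∃ j ≤ i, j ≠ 0 ∧ good (2 ^ j) p r ∧ jump good p r i = p + 2 ^ j := by
  induction i with
  | zero => exact .inl rfl
  | succ i ih =>
    unfold jump
    split_ifs with hgood
    · exact .inr ⟨i + 1, le_rfl, i.succ_ne_zero, hgood, rfl⟩
    · exact ih.imp_right fun ⟨j, hj, h⟩ => ⟨j, hj.trans i.le_succ, h⟩

theorem prefixWithin_jump (hdet : Detecting P A B H q) (hp : PrefixWithin P A B p r d) :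
    PrefixWithin P A B
      (jump (MatchIn P (fun p t => shiftedChar A P.K (q p) t) fun p => charAt B (q p)) p r
        (Nat.log 2 (P.N - p))) r (d + (H + 2) * P.l) := by
  rcases jump_eq_or (MatchIn P (fun p t => shiftedChar A P.K (q p) t) fun p => charAt B (q p)) p r
    (Nat.log 2 (P.N - p)) with hj | ⟨j, hj, hj₀, ⟨t, ht, htr, hmatch⟩, hjump⟩
  · rw [hj]
    exact hp.succ.mono (by nlinarith)
  · have hN : P.N - p ≠ 0 := fun hN => by
      rw [hN, Nat.log_zero_right] at hj
      omega
    have hpj : 2 ^ j ≤ P.N - p := Nat.pow_le_of_le_log hN hj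
    rw [hjump]
    refine (hp.add htr (2 ^ j)).mono ?_
    rw [add_mul, ← add_assoc]
    gcongr
    exact hdet p (2 ^ j) t (by omega) ht hmatch

theorem prefixWithin_furthest (hdet : Detecting P A B H q) (e : ℕ) (hr : r ≤ P.R + 1) :
    PrefixWithin P A B
      (furthest (MatchIn P (fun p t => shiftedChar A P.K (q p) t) fun p => charAt B (q p))
        P.N P.R e r) r (P.K + P.l + e * ((H + 2) * P.l)) := by
  induction e generalizing r with
  | zero => exact (PrefixWithin.zero hr).mono (Nat.le_add_right _ _)
  | succ e ih =>
    by_cases hr' : 1 ≤ r ∧ r ≤ P.R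
    · have hl : P.l ≤ (H + 2) * P.l := Nat.le_mul_of_pos_left _ (by omega)
      rw [furthest_succ hr'.1 hr'.2, Nat.succ_mul, ← add_assoc]
      refine max_rec' (PrefixWithin P A B · r _) (max_rec' (PrefixWithin P A B · r _) ?_ ?_) ?_
      · exact prefixWithin_jump hdet (ih hr)
      · exact ((ih (by omega)).class_move (by omega) (by omega)).mono (Nat.add_le_add_left hl _)
      · exact ((ih (by omega)).class_move (by omega) (by omega)).mono (Nat.add_le_add_left hl _)
    · rw [furthest, if_neg hr']
      exact (PrefixWithin.zero hr).mono (Nat.le_add_right _ _)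

theorem editDist_le_of_reachesEnd (hN : n ≤ P.N * P.l + P.l) (hdet : Detecting P A B H q)
    (hend : ReachesEnd P
      (MatchIn P (fun p t => shiftedChar A P.K (q p) t) fun p => charAt B (q p))) :
    editDist A B ≤ 2 * P.K + 3 * P.l + P.E * ((H + 2) * P.l) := by
  obtain ⟨r, -, hr, hend⟩ := hend
  have hn := hN.trans (Nat.add_le_add_right (Nat.mul_le_mul_right P.l hend) P.l)
  refine ((prefixWithin_furthest hdet P.E (Nat.le_succ_of_le hr)).editDist_le hn).trans_eq ?_
  ring

end Soundness

open Filter MeasureTheory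

section Sampling

theorem count_mod (l c : ℕ) (S : ℕ → Prop) [DecidablePred S] :
    Nat.count (fun x => S (x % l)) (c * l) = c * Nat.count S l := by
  induction c with
  | zero => rw [zero_mul, zero_mul, Nat.count_zero]
  | succ c ih =>
    rw [Nat.succ_mul, Nat.count_add, ih, Nat.succ_mul, Nat.add_left_cancel_iff,
      Nat.count_eq_card_filter_range, Nat.count_eq_card_filter_range]
    congr 1
    refine Finset.filter_congr fun x hx => ?_
    rw [Nat.mul_add_mod_self_right, Nat.mod_eq_of_lt (Finset.mem_range.1 hx)]

theorem count_not_add_count (S : ℕ → Prop) [DecidablePred S] (l : ℕ) :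
    Nat.count (fun x => ¬ S x) l + Nat.count S l = l := by
  rw [Nat.count_eq_card_filter_range, Nat.count_eq_card_filter_range, add_comm,
    Finset.card_filter_add_card_filter_not, Finset.card_range]

theorem sum_count_block (S : ℕ → Prop) [DecidablePred S] (l p h : ℕ) :
    ∑ i ∈ Finset.Ico p (p + h), Nat.count (fun z => S (i * l + z)) l =
      Nat.count (fun z => S (p * l + z)) (h * l) := by
  induction h with
  | zero => rw [add_zero, Finset.Ico_self, Finset.sum_empty, zero_mul, Nat.count_zero]
  | succ h ih =>
    rw [← add_assoc, Finset.sum_Ico_succ_top (Nat.le_add_right p h), ih, Nat.succ_mul,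
      Nat.count_add]
    simp only [add_mul, add_assoc]

theorem card_fin_mod (S : ℕ → Prop) [DecidablePred S] (l c : ℕ) :
    Fintype.card {x : Fin (c * l) // S (x % l)} = c * Nat.count S l := by
  rw [Fintype.card_subtype, ← count_mod, Nat.count_eq_card_filter_range, Finset.card_filter,
    Finset.card_filter, Fin.sum_univ_eq_sum_range fun x => if S (x % l) then 1 else 0]

theorem uniform_avoid_le {N l : ℕ} [NeZero N] (hl : l ∣ N) (S : ℕ → Prop) [DecidablePred S] :
    (PMF.uniformOfFintype (Fin N)).toMeasure {x | ¬ S (x % l)} ≤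
      ENNReal.ofReal (Real.exp (-(Nat.count S l / l))) := by
  obtain ⟨c, rfl⟩ := exists_eq_mul_left_of_dvd hl
  have hcl : 0 < c * l := Nat.pos_of_neZero _
  have hlR : (0 : ℝ) < l := by exact_mod_cast Nat.pos_of_mul_pos_left hcl
  have hcR : (0 : ℝ) < c := by exact_mod_cast Nat.pos_of_mul_pos_right hcl
  have hcount : (Nat.count (fun x => ¬ S x) l : ℝ) = l - Nat.count S l :=
    eq_sub_of_add_eq (by exact_mod_cast count_not_add_count S l)
  have hcard : Fintype.card {x : Fin (c * l) | ¬ S (x % l)} =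
      c * Nat.count (fun x => ¬ S x) l := card_fin_mod (fun x => ¬ S x) l c
  rw [PMF.toMeasure_uniformOfFintype_apply _ .of_discrete, Fintype.card_fin, hcard,
    ← ENNReal.ofReal_natCast, ← ENNReal.ofReal_natCast,
    ← ENNReal.ofReal_div_of_pos (by exact_mod_cast hcl), Nat.cast_mul, Nat.cast_mul, hcount,
    mul_div_mul_left _ _ hcR.ne', sub_div, div_self hlR.ne']
  exact ENNReal.ofReal_le_ofReal (Real.one_sub_le_exp_neg _)

variable {P : Params} {n σ w : ℕ}

instance (w : ℕ) : IsProbabilityMeasure (tapeMeasure w) := by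
  unfold tapeMeasure
  infer_instance

theorem tapeMeasure_avoid_le (hw : P.l ∣ 2 ^ w) (S : ℕ → Prop) [DecidablePred S] (p h : ℕ) :
    tapeMeasure w {ω | ∀ i, p ≤ i → i < p + h → ¬ S (samplePos P ω i)} ≤
      ENNReal.ofReal (Real.exp (-(Nat.count (fun z => S (p * P.l + z)) (h * P.l) / P.l))) := by
  have hset : {ω : ℕ → Fin (2 ^ w) | ∀ i, p ≤ i → i < p + h → ¬ S (samplePos P ω i)} =
      Set.pi (Finset.Ico p (p + h)) fun i =>
        {x : Fin (2 ^ w) | ¬ S (i * P.l + x % P.l)} := by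
    ext ω
    simp [Set.mem_pi, samplePos]
  rw [hset, tapeMeasure, Measure.infinitePi_pi _ fun _ _ => MeasurableSet.of_discrete,
    ← sum_count_block S, Nat.cast_sum, Finset.sum_div, ← Finset.sum_neg_distrib, Real.exp_sum,
    ENNReal.ofReal_prod_of_nonneg fun _ _ => (Real.exp_pos _).le]
  exact Finset.prod_le_prod' fun i _ => uniform_avoid_le hw fun z => S (i * P.l + z)

variable (A B : Fin n → Fin σ) {H p h t : ℕ}

theorem tapeMeasure_undetected_le (hw : P.l ∣ 2 ^ w) (hm : H * P.l < mismatches P A B p h t) :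
    tapeMeasure w {ω | ∀ i, p ≤ i → i < p + h →
      shiftedChar A P.K (samplePos P ω i) t = charAt B (samplePos P ω i)} ≤
        ENNReal.ofReal ((1 / 2) ^ H) := by
  have hl : (0 : ℝ) < P.l := by exact_mod_cast P.l_pos
  have hH : (H : ℝ) ≤ mismatches P A B p h t / P.l := by
    rw [le_div_iff₀ hl]
    exact_mod_cast hm.le
  have havoid := tapeMeasure_avoid_le hw (fun x => shiftedChar A P.K x t ≠ charAt B x) p h
  simp only [not_not] at havoid
  refine havoid.trans (ENNReal.ofReal_le_ofReal ?_)
  calc Real.exp (-(mismatches P A B p h t / P.l)) ≤ Real.exp (H * -1) := by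
        rw [mul_neg_one]
        exact Real.exp_le_exp.2 (neg_le_neg hH)
    _ = Real.exp (-1) ^ H := Real.exp_nat_mul _ _
    _ ≤ (1 / 2) ^ H := by
        rw [Real.exp_neg, ← one_div]
        have h2 := Real.add_one_le_exp (1 : ℝ)
        gcongr
        linarith

theorem tapeMeasure_detecting (hn : 0 < n) (hw : P.l ∣ 2 ^ w)
    (hH : n * (P.N * P.N * P.T) ≤ 2 ^ H) :
    ENNReal.ofReal (1 - 1 / n) ≤ tapeMeasure w {ω | Detecting P A B H (samplePos P ω)} := by
  let I := ((Finset.range P.N ×ˢ Finset.Icc 1 P.N) ×ˢ Finset.range P.T).filter fun x =>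
    H * P.l < mismatches P A B x.1.1 x.1.2 x.2
  have hcover : {ω : ℕ → Fin (2 ^ w) | Detecting P A B H (samplePos P ω)}ᶜ ⊆
      ⋃ x ∈ I, {ω | ∀ i, x.1.1 ≤ i → i < x.1.1 + x.1.2 →
        shiftedChar A P.K (samplePos P ω i) x.2 = charAt B (samplePos P ω i)} := by
    intro ω hω
    simp only [Detecting, Set.mem_compl_iff, Set.mem_ofPred_eq, not_forall, not_le] at hω
    obtain ⟨p, h, t, hp, ht, hi, hm⟩ := hω
    have hh : h ≠ 0 := by
      rintro rfl
      simp [mismatches] at hm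
    refine Set.mem_biUnion (x := ((p, h), t)) ?_ hi
    simp only [I, Finset.mem_coe, Finset.mem_filter, Finset.mem_product, Finset.mem_range,
      Finset.mem_Icc]
    omega
  have hcard : (I.card : ℝ) * (1 / 2) ^ H ≤ 1 / n := by
    have hI : n * I.card ≤ 2 ^ H := (Nat.mul_le_mul_left n (Finset.card_filter_le _ _)).trans
      (by simpa using hH)
    rw [one_div_pow, mul_one_div, div_le_div_iff₀ (by positivity) (by positivity), one_mul,
      mul_comm]
    exact_mod_cast hI
  have hbad : tapeMeasure w {ω | Detecting P A B H (samplePos P ω)}ᶜ ≤ ENNReal.ofReal (1 / n) := by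
    refine (measure_mono hcover).trans ((measure_biUnion_finset_le _ _).trans
      ((Finset.sum_le_card_nsmul _ _ _ fun x hx =>
        tapeMeasure_undetected_le A B hw (Finset.mem_filter.1 hx).2).trans ?_))
    rw [nsmul_eq_mul, ← ENNReal.ofReal_natCast, ← ENNReal.ofReal_mul (Nat.cast_nonneg _)]
    exact ENNReal.ofReal_le_ofReal hcard
  rw [ENNReal.ofReal_sub _ (by positivity), ENNReal.ofReal_one, tsub_le_iff_right,
    ← measure_univ (μ := tapeMeasure w)]
  exact (measure_univ_le_add_compl _).trans (add_le_add_right hbad _)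

end Sampling

section Bounds

theorem eventually_le_polylog (C e : ℕ) :
    ∀ᶠ b in atTop, ∀ n, C * (Nat.log 2 n + 1) ^ e ≤ polylog b n := by
  filter_upwards [eventually_ge_atTop C, eventually_ge_atTop e] with b hC he n
  exact Nat.mul_le_mul hC (Nat.pow_le_pow_right (Nat.succ_pos _) he)

variable {P : Params} {a n k ℓ : ℕ}

namespace Params.Fits

theorem l_le (F : P.Fits a n k ℓ) : P.l ≤ ℓ :=
  F.l_eq ▸ Nat.pow_log_le_self 2 F.ℓ_pos.ne'

theorem ℓ_le (F : P.Fits a n k ℓ) : ℓ ≤ 2 * P.l := by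
  rw [F.l_eq, ← pow_succ']
  exact (Nat.lt_pow_succ_log_self one_lt_two ℓ).le

theorem N_mul_ℓ_le (F : P.Fits a n k ℓ) : P.N * ℓ ≤ 2 * n :=
  calc P.N * ℓ ≤ P.N * (2 * P.l) := Nat.mul_le_mul_left _ F.ℓ_le
    _ = 2 * (P.N * P.l) := mul_left_comm _ _ _
    _ ≤ 2 * n := Nat.mul_le_mul_left _ F.N_mul_l_le

theorem k_le (F : P.Fits a n k ℓ) : 0 < k ∧ k ≤ (Nat.log 2 n + 1) ^ a * k :=
  ⟨F.ℓ_pos.trans_le F.ℓ_le_k, Nat.le_mul_of_pos_left _ (pow_pos (Nat.succ_pos _) _)⟩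

theorem T_le (F : P.Fits a n k ℓ) : P.T ≤ (2 * a + 1) * ((Nat.log 2 n + 1) ^ a * k) := by
  have hk := F.k_le
  calc 2 * P.K + 1 ≤ 2 * (a * (Nat.log 2 n + 1) ^ a * k) + (Nat.log 2 n + 1) ^ a * k := by
        rw [F.K_eq, polylog]
        omega
    _ = (2 * a + 1) * ((Nat.log 2 n + 1) ^ a * k) := by ring

theorem E_lt (F : P.Fits a n k ℓ) :
    P.E < (3 * a + 4) * ((Nat.log 2 n + 1) ^ (a + 1) * k) := by
  have hk := F.k_le
  have hpos : 0 < (Nat.log 2 n + 1) ^ (a + 1) * k := Nat.mul_pos (pow_pos (Nat.succ_pos _) _) hk.1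
  rw [F.E_eq, F.K_eq, polylog]
  calc (Nat.log 2 n + 3) * (a * (Nat.log 2 n + 1) ^ a * k + 1)
      ≤ 3 * (Nat.log 2 n + 1) *
          (a * (Nat.log 2 n + 1) ^ a * k + (Nat.log 2 n + 1) ^ a * k) :=
        Nat.mul_le_mul (by omega) (by omega)
    _ = (3 * a + 3) * ((Nat.log 2 n + 1) ^ (a + 1) * k) := by ring
    _ < (3 * a + 4) * ((Nat.log 2 n + 1) ^ (a + 1) * k) :=
        Nat.mul_lt_mul_of_pos_right (Nat.lt_succ_self _) hpos

theorem R_mul_ℓ_le (F : P.Fits a n k ℓ) :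
    P.R * ℓ ≤ (4 * a + 2) * ((Nat.log 2 n + 1) ^ a * k) := by
  have hk := F.k_le
  have hdiv := Nat.div_mul_le_self (2 * P.K) P.l
  have hl := F.l_le.trans F.ℓ_le_k
  calc P.R * ℓ ≤ P.R * (2 * P.l) := Nat.mul_le_mul_left _ F.ℓ_le
    _ = 2 * (2 * P.K / P.l * P.l) + 2 * P.l := by rw [Params.R]; ring
    _ ≤ 4 * P.K + 2 * ((Nat.log 2 n + 1) ^ a * k) := by omega
    _ = (4 * a + 2) * ((Nat.log 2 n + 1) ^ a * k) := by rw [F.K_eq, polylog]; ring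

theorem n_mul_card_le (F : P.Fits a n k ℓ) :
    n * (P.N * P.N * P.T) ≤ 2 ^ ((3 * a + 5) * (Nat.log 2 n + 1)) := by
  have hT := F.T_le
  have hn : n < 2 ^ (Nat.log 2 n + 1) := Nat.lt_pow_succ_log_self one_lt_two n
  have hN : P.N ≤ n := F.N_eq ▸ Nat.div_le_self _ _
  have hk := F.k_le_n
  have h2 : 2 ≤ 2 ^ (Nat.log 2 n + 1) := Nat.le_self_pow (Nat.succ_ne_zero _) 2
  generalize Nat.log 2 n + 1 = L at *
  have ha : 2 * a + 1 ≤ (2 ^ L) ^ (2 * a + 1) :=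
    Nat.lt_two_pow_self.le.trans (Nat.pow_le_pow_left h2 _)
  have hT' : P.T ≤ (2 ^ L) ^ (2 * a + 1) * ((2 ^ L) ^ a * 2 ^ L) := hT.trans
    (Nat.mul_le_mul ha (Nat.mul_le_mul (Nat.pow_le_pow_left Nat.lt_two_pow_self.le a) (by omega)))
  calc n * (P.N * P.N * P.T)
      ≤ 2 ^ L * (2 ^ L * 2 ^ L * ((2 ^ L) ^ (2 * a + 1) * ((2 ^ L) ^ a * 2 ^ L))) :=
        Nat.mul_le_mul hn.le (Nat.mul_le_mul (Nat.mul_le_mul (by omega) (by omega)) hT')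
    _ = 2 ^ ((3 * a + 5) * L) := by ring

end Params.Fits

theorem eventually_preTime_le (a c : ℕ) : ∀ᶠ b in atTop, ∀ {P : Params} {n k ℓ : ℕ},
    P.Fits a n k ℓ → c * ((Nat.log 2 n + 1) * (P.N * P.T)) * ℓ ≤ polylog b n * (n * k) := by
  filter_upwards [eventually_le_polylog (c * 2 * (2 * a + 1)) (a + 1)] with b hb P n k ℓ F
  calc c * ((Nat.log 2 n + 1) * (P.N * P.T)) * ℓ
      = c * (Nat.log 2 n + 1) * ((P.N * ℓ) * P.T) := by ring
    _ ≤ c * (Nat.log 2 n + 1) * ((2 * n) * ((2 * a + 1) * ((Nat.log 2 n + 1) ^ a * k))) :=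
      Nat.mul_le_mul_left _ (Nat.mul_le_mul F.N_mul_ℓ_le F.T_le)
    _ = c * 2 * (2 * a + 1) * (Nat.log 2 n + 1) ^ (a + 1) * (n * k) := by ring
    _ ≤ polylog b n * (n * k) := Nat.mul_le_mul_right _ (hb n)

theorem eventually_queryTime_le (a c : ℕ) : ∀ᶠ b in atTop, ∀ {P : Params} {n k ℓ : ℕ},
    P.Fits a n k ℓ →
      c * ((Nat.log 2 n + 1) * (P.N + (P.E + 1) * P.R)) * ℓ ≤ polylog b n * (n + k ^ 2) := by
  filter_upwards [eventually_le_polylog (c * (2 + (3 * a + 4) * (4 * a + 2))) (2 * a + 2)]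
    with b hb P n k ℓ F
  have hn : n ≤ n * (Nat.log 2 n + 1) ^ (2 * a + 1) :=
    Nat.le_mul_of_pos_right _ (pow_pos (Nat.succ_pos _) _)
  calc c * ((Nat.log 2 n + 1) * (P.N + (P.E + 1) * P.R)) * ℓ
      = c * (Nat.log 2 n + 1) * (P.N * ℓ + (P.E + 1) * (P.R * ℓ)) := by ring
    _ ≤ c * (Nat.log 2 n + 1) * (2 * (n * (Nat.log 2 n + 1) ^ (2 * a + 1)) +
        (3 * a + 4) * ((Nat.log 2 n + 1) ^ (a + 1) * k) *
          ((4 * a + 2) * ((Nat.log 2 n + 1) ^ a * k))) :=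
      Nat.mul_le_mul_left _ (Nat.add_le_add (F.N_mul_ℓ_le.trans (Nat.mul_le_mul_left 2 hn))
        (Nat.mul_le_mul F.E_lt F.R_mul_ℓ_le))
    _ = c * (Nat.log 2 n + 1) ^ (2 * a + 2) *
        (2 * n + (3 * a + 4) * (4 * a + 2) * k ^ 2) := by ring
    _ ≤ c * (Nat.log 2 n + 1) ^ (2 * a + 2) *
        ((2 + (3 * a + 4) * (4 * a + 2)) * (n + k ^ 2)) := by
      rw [add_mul _ _ (n + k ^ 2)]
      gcongr <;> omega
    _ = c * (2 + (3 * a + 4) * (4 * a + 2)) * (Nat.log 2 n + 1) ^ (2 * a + 2) * (n + k ^ 2) := by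
      ring
    _ ≤ polylog b n * (n + k ^ 2) := Nat.mul_le_mul_right _ (hb n)

theorem eventually_editDistBound_lt (a : ℕ) : ∀ᶠ b in atTop, ∀ {P : Params} {n k ℓ : ℕ},
    P.Fits a n k ℓ → 2 * P.K + 3 * P.l +
      P.E * (((3 * a + 5) * (Nat.log 2 n + 1) + 2) * P.l) < polylog b n * (k * ℓ) := by
  filter_upwards [eventually_le_polylog (2 * a + 3 + (3 * a + 4) * (3 * a + 7)) (a + 2)]
    with b hb P n k ℓ F
  have hk := F.k_le.1
  have hℓ := F.ℓ_pos
  refine lt_of_lt_of_le ?_ (Nat.mul_le_mul_right _ (hb n))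
  have hEL := F.E_lt
  have hl := F.l_le
  have hL : 1 ≤ Nat.log 2 n + 1 := Nat.succ_pos _
  rw [F.K_eq, polylog]
  generalize Nat.log 2 n + 1 = L at *
  have h1 : a * L ^ a * k ≤ a * (L ^ (a + 2) * (k * ℓ)) := by
    rw [mul_assoc]
    exact Nat.mul_le_mul_left _ (Nat.mul_le_mul (Nat.pow_le_pow_right hL (by omega))
      (Nat.le_mul_of_pos_right _ F.ℓ_pos))
  have h2 : P.l ≤ L ^ (a + 2) * (k * ℓ) := hl.trans ((Nat.le_mul_of_pos_left _ hk).trans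
    (Nat.le_mul_of_pos_left _ (pow_pos hL _)))
  have h3 : P.E * (((3 * a + 5) * L + 2) * P.l) <
      (3 * a + 4) * (3 * a + 7) * (L ^ (a + 2) * (k * ℓ)) :=
    calc P.E * (((3 * a + 5) * L + 2) * P.l)
        < ((3 * a + 4) * (L ^ (a + 1) * k)) * (((3 * a + 7) * L) * ℓ) := by
          refine Nat.mul_lt_mul_of_lt_of_le hEL (Nat.mul_le_mul ?_ hl) (by positivity)
          linarith
      _ = (3 * a + 4) * (3 * a + 7) * (L ^ (a + 2) * (k * ℓ)) := by ring
  linarith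

end Bounds

section Correctness

variable {P : Params} {a b n k ℓ σ w : ℕ}

namespace Params.Fits

theorem lintegral_runningTime_le (F : P.Fits a n k ℓ) (hσ : σ < P.Z)
    (hM : 2 ^ 14 * P.Z ^ 8 ≤ 2 ^ w) (A : Fin n → Fin σ)
    (hb : (preProg a).size * ((Nat.log 2 n + 1) * (P.N * P.T)) * ℓ ≤ polylog b n * (n * k)) :
    ∫⁻ ω, runningTime (preEnv w A ω) (preProg a) (preInit n k ℓ σ) ∂tapeMeasure w ≤
      ENNReal.ofReal (polylog b n * ((n : ℝ) * k / ℓ)) := by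
  have hℓ : (0 : ℝ) < ℓ := by exact_mod_cast F.ℓ_pos
  refine (lintegral_mono fun ω => (F.runs_preProg hM hσ A ω).runningTime_le).trans ?_
  rw [lintegral_const, measure_univ, mul_one, ← ENNReal.ofReal_natCast]
  refine ENNReal.ofReal_le_ofReal ?_
  rw [← mul_div_assoc, le_div_iff₀ hℓ]
  exact_mod_cast hb

theorem exists_exec_queryProg (F : P.Fits a n k ℓ) (hσ : σ < P.Z)
    (hM : 2 ^ 14 * P.Z ^ 8 ≤ 2 ^ w) (A B : Fin n → Fin σ)
    (hb : (queryProg a).size * ((Nat.log 2 n + 1) * (P.N + (P.E + 1) * P.R)) * ℓ ≤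
      polylog b n * (n + k ^ 2))
    {ω : ℕ → Fin (2 ^ w)} {s : State} {t : ℕ}
    (hs : Exec (preEnv w A ω) (preProg a) (preInit n k ℓ σ) s t) :
    ∃ s' t', Exec (queryEnv w A B) (queryProg a) (queryInit n k ℓ σ s) s' t' ∧
      (t' : ℝ) ≤ polylog b n * ((n + (k : ℝ) ^ 2) / ℓ) := by
  have hℓ : (0 : ℝ) < ℓ := by exact_mod_cast F.ℓ_pos
  obtain ⟨s₁, t₁, hs₁, -, hpre⟩ := F.runs_preProg hM hσ A ω
  obtain ⟨rfl, rfl⟩ := hs.unique hs₁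
  obtain ⟨s', t', hs', ht', -⟩ := F.runs_queryProg hM hσ A B hpre
  refine ⟨s', t', hs', ?_⟩
  rw [← mul_div_assoc, le_div_iff₀ hℓ]
  exact_mod_cast (Nat.mul_le_mul_right ℓ ht').trans hb

theorem reachesEnd_of_editDist_le (F : P.Fits a n k ℓ) {A B : Fin n → Fin σ}
    (h : editDist A B ≤ P.K) (ω : ℕ → Fin (2 ^ w)) :
    ReachesEnd P (MatchIn P (fun p t => shiftedChar A P.K (samplePos P ω p) t)
      fun p => charAt B (samplePos P ω p)) :=
  reachesEnd_of_editSeq (Nat.lt_pow_of_log_lt one_lt_two (Nat.lt_succ_of_le F.log_N_le)) F.E_eq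
    (fun _ => ⟨Nat.le_add_right _ _, Nat.add_lt_add_left (Nat.mod_lt _ P.l_pos) _⟩)
    (exists_editSeq A B) h

theorem le_tapeMeasure_correctAnswer (F : P.Fits a n k ℓ) (hσ : σ < P.Z)
    (hM : 2 ^ 14 * P.Z ^ 8 ≤ 2 ^ w) (A B : Fin n → Fin σ)
    (hb : 2 * P.K + 3 * P.l + P.E * (((3 * a + 5) * (Nat.log 2 n + 1) + 2) * P.l) <
      polylog b n * (k * ℓ)) :
    ENNReal.ofReal (1 - 1 / n) ≤ tapeMeasure w {ω | ∃ (s s' : State) (t t' : ℕ),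
      Exec (preEnv w A ω) (preProg a) (preInit n k ℓ σ) s t ∧
      Exec (queryEnv w A B) (queryProg a) (queryInit n k ℓ σ s) s' t' ∧
      CorrectAnswer (editDist A B) (polylog a n * (k : ℝ)) (polylog b n * ((k : ℝ) * ℓ)) s'} := by
  have hl : P.l ∣ 2 ^ w := by
    have hZ : 2 ^ 14 * P.Z ≤ 2 ^ w := P.Z_le (E := queryEnv w A B) hM
    have hn := F.n_lt_Z
    have hℓ := F.l_le.trans (F.ℓ_le_k.trans F.k_le_n)
    rw [F.l_eq] at hℓ ⊢
    exact pow_dvd_pow 2 ((Nat.pow_le_pow_iff_right one_lt_two).1 (by omega))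
  refine (tapeMeasure_detecting A B (F.k_le.1.trans_le F.k_le_n) hl F.n_mul_card_le).trans
    (measure_mono fun ω hdet => ?_)
  obtain ⟨s, t, hs, -, hpre⟩ := F.runs_preProg hM hσ A ω
  obtain ⟨s', t', hs', -, hanswer⟩ := F.runs_queryProg hM hσ A B hpre
  refine ⟨s, s', t, t', hs, hs', fun hsmall => ?_, fun hlarge => ?_⟩
  · rw [hanswer, if_pos (F.reachesEnd_of_editDist_le ?_ ω)]
    rw [F.K_eq]
    exact_mod_cast hsmall
  · rw [hanswer, if_neg fun hend => ?_]
    have hle := editDist_le_of_reachesEnd F.lt_N_mul_l_add.le hdet hend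
    have hlt : polylog b n * (k * ℓ) ≤ editDist A B := by exact_mod_cast hlarge
    omega

end Params.Fits

end Correctness

end GapEditDistance

theorem mainTheorem4 (a : ℕ) :
    ∃ (c b : ℕ) (pre query : Prog), 0 < c ∧ query.RandomFree ∧
      ∀ n k ℓ σ : ℕ, 1 ≤ ℓ → ℓ ≤ k → k ≤ n → ∀ A : Fin n → Fin σ,
        -- expected preprocessing time
        (∫⁻ ω, runningTime (preEnv (wordBits c n σ) A ω) pre (preInit n k ℓ σ)
            ∂(tapeMeasure (wordBits c n σ))
          ≤ ENNReal.ofReal (polylog b n * ((n : ℝ) * k / ℓ))) ∧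
        ∀ B : Fin n → Fin σ,
          -- query time, for every outcome of preprocessing
          (∀ (ω : ℕ → Fin (2 ^ wordBits c n σ)) (s : State) (t : ℕ),
            Exec (preEnv (wordBits c n σ) A ω) pre (preInit n k ℓ σ) s t →
            ∃ (s' : State) (t' : ℕ),
              Exec (queryEnv (wordBits c n σ) A B) query (queryInit n k ℓ σ s) s' t' ∧
              (t' : ℝ) ≤ polylog b n * (((n : ℝ) + (k : ℝ) ^ 2) / ℓ)) ∧
          -- success probability, over the random words used in preprocessing
          ENNReal.ofReal (1 - 1 / (n : ℝ)) ≤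
            tapeMeasure (wordBits c n σ)
              {ω | ∃ (s s' : State) (t t' : ℕ),
                Exec (preEnv (wordBits c n σ) A ω) pre (preInit n k ℓ σ) s t ∧
                Exec (queryEnv (wordBits c n σ) A B) query (queryInit n k ℓ σ s) s' t' ∧
                CorrectAnswer (editDist A B) (polylog a n * (k : ℝ))
                  (polylog b n * ((k : ℝ) * ℓ)) s'} := by
  open GapEditDistance in
  obtain ⟨b, hpre, hquery, hlarge⟩ := ((eventually_preTime_le a (preProg a).size).and
    ((eventually_queryTime_le a (queryProg a).size).and (eventually_editDistBound_lt a))).exists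
  refine ⟨16 * a + 70, b, preProg a, queryProg a, by omega, queryProg_randomFree a,
    fun n k ℓ σ hℓ hℓk hkn A => ?_⟩
  obtain ⟨P, F, hσ, hM⟩ := exists_params (a := a) (σ := σ) hℓ hℓk hkn
  exact ⟨F.lintegral_runningTime_le hσ hM A (hpre F), fun B =>
    ⟨fun _ _ _ => F.exists_exec_queryProg hσ hM A B (hquery F),
      F.le_tapeMeasure_correctAnswer hσ hM A B (hlarge F)⟩⟩
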